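/- Let $K$ be a completion of a number field at a place, i.e. $K$ is a finite extension of $\mathbb{R}$ or of some $\mathbb{Q}_p$. Let $\lambda(x)=\exp(2\pi i\{\mathrm{Tr}\,x\})$ be the basic additive character ($\mathrm{Tr}$ is the trace down to $\mathbb{Q}_p$ and $\{\cdot\}$ the polar part if $K$ is non-archimedean; $\lambda(x)=\exp(-2\pi i\,\mathrm{Tr}_{K/\mathbb{R}}x)$ if $K$ is archimedean). Let $dx$ be the self-dual additive Haar measure for $\mathcal{F}(\varphi)(y)=\int_K\varphi(x)\lambda(-yx)\,dx$ (so $\mathcal F\mathcal F\varphi(x)=\varphi(-x)$ for Schwartz–Bruhat $\varphi$), and let $|t|$ be the module, $d(tx)=|t|\,dx$. Let $d^*t$ be the Haar measure on $K^\times$ giving the units volume $1$ if $K$ is non-archimedean, and with push-forward $du/u$ on $(0,\infty)$ under $t\mapsto|t|$ if $K$ is archimedean. Let $X$ be the group of unitary characters of $K^\times$ with the Haar measure $\mu$ for which the inversion formula $f(t)=\int_X f(\chi)\overline{\chi(t)}\,d\mu(\chi)$ holds, where $f(\chi)=\int_{K^\times} f(t)\chi(t)\,d^*t$. For $\chi\in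 X$ and $0<\mathrm{Re}(s)<1$ let $\Gamma(\chi,s)$ be the constant with $\mathcal{F}(\chi(y)|y|^{s-1})=\Gamma(\chi,s)\,\chi^{-1}(x)|x|^{-s}$ as distributions on $K$; it exists, and is analytic and non-vanishing in $s$. Let $\Lambda(\chi,s)=-\frac{\partial}{\partial s}\Gamma(\chi,s)/\Gamma(\chi,s)$. The Inversion is the unitary $I:\varphi(x)\mapsto\frac1{|x|}\varphi(\frac1x)$ of $L^2(K,dx)$. The conductor operator is $H\varphi(x)=\log|x|\,\varphi(x)+\mathcal{F}\big(\log|y|\,\mathcal{F}^{-1}(\varphi)(y)\big)(x)$, defined on the space $\mathcal{S}$ of Schwartz–Bruhat functions, which it maps into $L^2(K,dx)$. Consider the unitary isomorphisms $L^2(K,dx)\cong L^2(K^\times,d^*t)\cong L^2(X,\mu)$, the first being $\varphi(x)\mapsto\alpha\sqrt{|t|}\,\varphi(t)$, where $\alpha>0$ is the constant with $d^*t=\alpha^{-2}\,dt/|t|$, and the second being the extension of the multiplicative Fourier transform $f(t)\mapsto f(\chi)$ from $L^1\cap L^2$. **Theorem G1.** Under these isometries: 1. the Inversion is transported to the unitary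 operator $f(\chi)\mapsto f(\overline\chi)$ of $L^2(X,\mu)$; 2. the additive Fourier transform (the unitary extension of $\mathcal{F}$ to $L^2(K,dx)$) is transported to the unitary operator $f(\chi)\mapsto\Gamma(\chi,\tfrac12)\,f(\overline\chi)$; 3. the conductor operator is transported to the hermitian operator of multiplication by the real-valued function $-\Lambda(\chi,\tfrac12)$: for every $\varphi\in\mathcal{S}$ with transform $f(\chi)$, the transform of $H\varphi$ is $-\Lambda(\chi,\tfrac12)f(\chi)$. **Corollary.** The conductor operator commutes with the Inversion: if $\varphi$ is a Schwartz–Bruhat function with compact support which vanishes in a neighborhood of the origin, then so is $I\varphi$, and $H I\varphi=I H\varphi$. -/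

import Mathlib

open MeasureTheory
open scoped ENNReal

noncomputable section

/-- The completions of number fields: a normed field `K` that is a finite extension of `ℝ`
(so `K` is `ℝ` or `ℂ`), or a finite extension of `ℚ_p` for some prime `p`. -/
inductive LocalPlace (K : Type*) [NormedField K]
  | archimedean (algR : NormedAlgebra ℝ K) (fin : FiniteDimensional ℝ K)
  | finite (p : ℕ) (hp : Fact p.Prime) (algP : NormedAlgebra ℚ_[p] K)
      (fin : FiniteDimensional ℚ_[p] K)

theorem norm_mul_p_pow_le_one (p : ℕ) [Fact p.Prime] (a : ℚ_[p]) :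
    ‖a * (p : ℚ_[p]) ^ (-a.valuation).toNat‖ ≤ 1 := by
  by_cases ha : a = 0
  · simp [ha]
  · have hp : (p : ℚ_[p]) ≠ 0 := by exact_mod_cast (Fact.out : p.Prime).ne_zero
    rw [Padic.norm_le_one_iff_val_nonneg, Padic.valuation_mul ha (pow_ne_zero _ hp),
      Padic.valuation_pow, Padic.valuation_p]
    omega

/-- The polar part `{a}` of a `p`-adic number: the rational number `m / p ^ n` in `[0, 1)`
with `a - m / p ^ n` a `p`-adic integer. -/
def padicPolarPart (p : ℕ) [Fact p.Prime] (a : ℚ_[p]) : ℚ :=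
  (PadicInt.appr ⟨a * (p : ℚ_[p]) ^ (-a.valuation).toNat, norm_mul_p_pow_le_one p a⟩
    (-a.valuation).toNat : ℚ) / (p : ℚ) ^ (-a.valuation).toNat

section LocalField

variable {K : Type*} [NormedField K]

/-- The basic additive character: `exp (2 π i {Tr x})` with the trace down to `ℚ_p` at a finite
place, `exp (-2 π i Tr x)` with the trace down to `ℝ` at an archimedean place. -/
def basicChar : LocalPlace K → K → ℂ
  | .archimedean _ _, x =>
      Complex.exp (2 * Real.pi * Complex.I * ((-Algebra.trace ℝ K x : ℝ) : ℂ))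
  | .finite p _ _ _, x =>
      Complex.exp (2 * Real.pi * Complex.I * (padicPolarPart p (Algebra.trace ℚ_[p] K x) : ℂ))

/-- Schwartz-Bruhat functions: Schwartz functions at an archimedean place, locally constant
functions with compact support at a finite place. -/
def IsSchwartzBruhat : LocalPlace K → (K → ℂ) → Prop
  | .archimedean _ _, φ => ∃ g : SchwartzMap K ℂ, ⇑g = φ
  | .finite _ _ _ _, φ => IsLocallyConstant φ ∧ HasCompactSupport φ

/-- The space `𝓢₀`: Schwartz-Bruhat functions with compact support which vanish identically in
a neighborhood of the origin. -/
def IsSchwartzBruhatZero (v : LocalPlace K) (φ : K → ℂ) : Prop :=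
  IsSchwartzBruhat v φ ∧ HasCompactSupport φ ∧ ∀ᶠ x in nhds (0 : K), φ x = 0

/-- The module `|x|`, with `d(tx) = |t| dx` for `t ≠ 0`, and `|0| = 0`. -/
def localModule [LocallyCompactSpace K] (x : K) : ℝ :=
  open Classical in
  if h : x = 0 then 0 else ((distribHaarChar K (Units.mk0 x h) : NNReal) : ℝ)

variable [MeasurableSpace K]

/-- The additive Fourier transform `𝓕 φ (y) = ∫ φ(x) λ(-yx) dx`. -/
def addFourier (v : LocalPlace K) (dx : Measure K) (φ : K → ℂ) (y : K) : ℂ :=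
  ∫ x, φ x * basicChar v (-(y * x)) ∂dx

/-- The inverse Fourier transform `∫ φ(x) λ(yx) dx` (for `dx` self-dual). -/
def addFourierInv (v : LocalPlace K) (dx : Measure K) (φ : K → ℂ) (y : K) : ℂ :=
  ∫ x, φ x * basicChar v (y * x) ∂dx

/-- `dx` is the self-dual additive Haar measure: `𝓕 𝓕 φ (x) = φ(-x)`. -/
def IsSelfDualMeasure (v : LocalPlace K) (dx : Measure K) : Prop :=
  dx.IsAddHaarMeasure ∧
    ∀ φ, IsSchwartzBruhat v φ → ∀ x, addFourier v dx (addFourier v dx φ) x = φ (-x)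

/-- The Inversion `φ ↦ (x ↦ |x|⁻¹ φ(1/x))`. -/
def inversionFun [LocallyCompactSpace K] (φ : K → ℂ) (x : K) : ℂ :=
  ((localModule x)⁻¹ : ℝ) * φ x⁻¹

/-- The conductor operator `H φ = log|x| φ + 𝓕 (log|y| 𝓕⁻¹ φ)`. -/
def conductorOp [LocallyCompactSpace K] (v : LocalPlace K) (dx : Measure K) (φ : K → ℂ)
    (x : K) : ℂ :=
  (Real.log (localModule x) : ℂ) * φ x +
    addFourier v dx (fun y => (Real.log (localModule y) : ℂ) * addFourierInv v dx φ y) x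

/-- The value at `x ∈ K` of a unitary character of `Kˣ`, extended by `0` at the origin. -/
def charAt (χ : PontryaginDual Kˣ) (x : K) : ℂ :=
  open Classical in
  if h : x = 0 then 0 else ((χ (Units.mk0 x h) : Circle) : ℂ)

/-- `c` is the constant in `𝓕(χ(y)|y|^(s-1)) = c χ⁻¹(x)|x|^(-s)`, an identity of
distributions on `K` (for `0 < Re s < 1`, where both sides are locally integrable). -/
def IsTateGamma [LocallyCompactSpace K] (v : LocalPlace K) (dx : Measure K)
    (χ : PontryaginDual Kˣ) (s c : ℂ) : Prop :=
  ∀ φ, IsSchwartzBruhat v φ →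
    ∫ y, addFourier v dx φ y * (charAt χ y * (localModule y : ℂ) ^ (s - 1)) ∂dx =
      c * ∫ x, φ x * (charAt χ⁻¹ x * (localModule x : ℂ) ^ (-s)) ∂dx

/-- The Tate-Gel'fand-Graev Gamma function `Γ(χ, s)` in the critical strip `0 < Re s < 1`. -/
def tateGamma [LocallyCompactSpace K] (v : LocalPlace K) (dx : Measure K)
    (χ : PontryaginDual Kˣ) (s : ℂ) : ℂ :=
  Classical.epsilon (IsTateGamma v dx χ s)

/-- `Λ(χ, s) = - Γ'(χ, s) / Γ(χ, s)`, the derivative being with respect to `s`. -/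
def tateLambda [LocallyCompactSpace K] (v : LocalPlace K) (dx : Measure K)
    (χ : PontryaginDual Kˣ) (s : ℂ) : ℂ :=
  -(deriv (tateGamma v dx χ) s / tateGamma v dx χ s)

/-- `dt` is the normalized multiplicative Haar measure `d*t`: at a finite place the units have
volume one, at an archimedean place the push-forward under the module is `du/u` on `(0, ∞)`. -/
def IsNormalizedMulHaar [LocallyCompactSpace K] (v : LocalPlace K) (dt : Measure Kˣ) : Prop :=
  dt.IsHaarMeasure ∧
    match v with
    | .archimedean _ _ =>
        dt.map (fun t : Kˣ => localModule (t : K)) =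
          (volume.restrict (Set.Ioi (0 : ℝ))).withDensity (fun u => ENNReal.ofReal u⁻¹)
    | .finite _ _ _ _ => dt {t : Kˣ | localModule (t : K) = 1} = 1

/-- The multiplicative Fourier transform `f(χ) = ∫ f(t) χ(t) d*t`. -/
def mulFourier (dt : Measure Kˣ) (f : Kˣ → ℂ) (χ : PontryaginDual Kˣ) : ℂ :=
  ∫ t, f t * ((χ t : Circle) : ℂ) ∂dt

/-- `μ` is the Haar measure on the dual of `Kˣ` for which the inversion formula
`f(t) = ∫ f(χ) conj(χ(t)) dμ(χ)` holds. -/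
def IsDualHaar [MeasurableSpace (PontryaginDual Kˣ)] (dt : Measure Kˣ)
    (μ : Measure (PontryaginDual Kˣ)) : Prop :=
  μ.IsHaarMeasure ∧
    ∀ f : Kˣ → ℂ, Continuous f → Integrable f dt → Integrable (mulFourier dt f) μ →
      ∀ t, f t = ∫ χ, mulFourier dt f χ * (starRingEnd ℂ) ((χ t : Circle) : ℂ) ∂μ

/-- `T` is the isometry `φ(x) ↦ α √|t| φ(t)` with `α > 0` such that `d*t = α⁻² dt/|t|`. -/
def IsAddMulIsometry [LocallyCompactSpace K] (dx : Measure K) (dt : Measure Kˣ)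
    (T : Lp ℂ 2 dx ≃ₗᵢ[ℂ] Lp ℂ 2 dt) : Prop :=
  ∃ α : ℝ, 0 < α ∧
    dt = ENNReal.ofReal (α ^ 2)⁻¹ • (dx.comap (Units.val : Kˣ → K)).withDensity
      (fun t => ENNReal.ofReal (localModule (t : K))⁻¹) ∧
    ∀ φ : Lp ℂ 2 dx, ∀ᵐ t ∂dt, T φ t = (α * √(localModule (t : K)) : ℝ) * φ (t : K)

/-- `M` is the Plancherel isometry: it extends the Fourier transform of integrable functions. -/
def IsPlancherelIsometry [MeasurableSpace (PontryaginDual Kˣ)] (dt : Measure Kˣ)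
    (μ : Measure (PontryaginDual Kˣ)) (M : Lp ℂ 2 dt ≃ₗᵢ[ℂ] Lp ℂ 2 μ) : Prop :=
  ∀ f : Lp ℂ 2 dt, Integrable f dt → M f =ᵐ[μ] mulFourier dt f

/-- `J` is the Inversion as a unitary operator of `L²(K, dx)`. -/
def IsInversionL2 [LocallyCompactSpace K] (dx : Measure K)
    (J : Lp ℂ 2 dx ≃ₗᵢ[ℂ] Lp ℂ 2 dx) : Prop :=
  ∀ φ : Lp ℂ 2 dx, J φ =ᵐ[dx] inversionFun φ

/-- `F` is the additive Fourier transform as a unitary operator of `L²(K, dx)`: it extends the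
Fourier integral of integrable functions. -/
def IsFourierL2 (v : LocalPlace K) (dx : Measure K)
    (F : Lp ℂ 2 dx ≃ₗᵢ[ℂ] Lp ℂ 2 dx) : Prop :=
  ∀ φ : Lp ℂ 2 dx, Integrable φ dx → F φ =ᵐ[dx] addFourier v dx φ

end LocalField

end

set_option linter.unusedSectionVars false

/-! Write `Z(φ, χ, s) = ∫ φ(x) χ(x) |x|^(s-1) dx` for Tate's zeta integral. Since `d*t = α⁻²
dx/|x|`, the two isometries together send a Schwartz–Bruhat function `φ` to `α⁻¹ Z(φ, χ, 1/2)`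
(`transform_eq_zeta`). The operators are read off on zeta integrals, and density carries the unitary
ones to all of `L²`.

Once `φ` is multiplied by `√|t|`, the Inversion is `t ↦ t⁻¹` on the units, hence `χ ↦ χ⁻¹` on the
dual. For the Fourier transform one uses the local functional equation `Z(𝓕φ, χ, s) = Γ(χ, s) Z(φ,
χ⁻¹, 1 - s)` at `s = 1/2` (`zeta_addFourier`); it holds because, by Fubini, `Z(ψ, χ⁻¹, 1 - s) Z(𝓕φ,
χ, s)` is symmetric in `φ` and `ψ`.

A factor `log|x|` under the zeta integral is a derivative in `s`. Let `φ = 𝓕ψ`. Differentiating the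
functional equation gives `Γ' Z(ψ, χ⁻¹) - Γ Z_log(ψ, χ⁻¹)` for the term `log|x| φ` of `Hφ`, while
the other term `𝓕(log|y| ψ)` gives `Γ Z_log(ψ, χ⁻¹)`. The logarithms cancel and the factor `Γ'/Γ =
-Λ` remains (`transform_conductor`).

The relations `Γ(χ, s) Γ(χ⁻¹, 1 - s) = χ(-1)` and `conj Γ(χ, s) = χ(-1) Γ(χ⁻¹, conj s)` have
logarithmic derivatives showing that `Λ(χ, 1/2)` is invariant under `χ ↦ χ⁻¹` and real. The
invariance is also why `H` commutes with the Inversion.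

The isometry `M` is constructed from the inversion formula (`exists_plancherel_isometry`). This
takes one nonzero function to which the formula applies and enough characters to separate points:
indicators of compact open subgroups serve at a finite place, band-limited functions of `log|t|` and
explicit characters at an archimedean one. What else depends on the place is collected in
`LocalPlace.Regular`. -/

theorem continuous_circle_coe : Continuous (fun z : Circle => (z : ℂ)) :=
  continuous_subtype_val

/-! ### Uniqueness theorem for Fourier coefficients. -/

section Uniqueness

open BoundedContinuousFunction

/-- A continuous circle-valued function as a bounded continuous function. -/
noncomputable def circleBCF {Y : Type*} [TopologicalSpace Y] (f : Y → Circle) (hf : Continuous f) :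
    Y →ᵇ ℂ :=
  BoundedContinuousFunction.ofNormedAddCommGroup (fun y => (f y : ℂ))
    (continuous_circle_coe.comp hf) 1 (fun _ => (Circle.norm_coe _).le)

/-- The positive and negative parts of `r` are densities of two finite measures. These have the same
integrals against the star-algebra spanned by the functions `e a`, which separates points, and on a
Polish space such an algebra determines a finite measure. -/
theorem ae_eq_zero_of_forall_integral_circle_mul_real_eq_zero {Y A : Type*} [TopologicalSpace Y]
    [PolishSpace Y] [MeasurableSpace Y] [BorelSpace Y] [Group A] (ν : Measure Y)
    (e : A →* (Y → Circle)) (he : ∀ a, Continuous (e a))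
    (hsep : ∀ x y, x ≠ y → ∃ a, e a x ≠ e a y)
    (r : Y → ℝ) (hr : Integrable r ν) (h0 : ∀ a, ∫ y, (r y : ℂ) * (e a y : ℂ) ∂ν = 0) :
    r =ᵐ[ν] 0 := by
  set P : Measure Y := ν.withDensity (fun y => ENNReal.ofReal (r y)) with hP
  set N : Measure Y := ν.withDensity (fun y => ENNReal.ofReal (-r y)) with hN
  have hPf : IsFiniteMeasure P := isFiniteMeasure_withDensity_ofReal hr.2
  have hNf : IsFiniteMeasure N := isFiniteMeasure_withDensity_ofReal hr.neg.2
  let s : Submonoid (Y →ᵇ ℂ) :=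
    { carrier := Set.range fun a => circleBCF (e a) (he a)
      one_mem' := ⟨1, by ext y; simp [circleBCF]⟩
      mul_mem' := by
        rintro _ _ ⟨a, rfl⟩ ⟨b, rfl⟩
        exact ⟨a * b, by ext y; simp [circleBCF]⟩ }
  have hstar : ∀ f ∈ s, star f ∈ s := by
    rintro _ ⟨a, rfl⟩
    refine ⟨a⁻¹, ?_⟩
    ext y
    have : ((e a y)⁻¹ : Circle) = (starRingEnd ℂ) (e a y : ℂ) := Circle.coe_inv_eq_conj _
    simpa [circleBCF] using this
  let A' : StarSubalgebra ℂ (Y →ᵇ ℂ) :=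
    { Algebra.adjoin ℂ (s : Set (Y →ᵇ ℂ)) with
      star_mem' := by
        intro f hf
        change star f ∈ Algebra.adjoin ℂ (s : Set (Y →ᵇ ℂ))
        induction hf using Algebra.adjoin_induction with
        | mem x hx => exact Algebra.subset_adjoin (hstar x hx)
        | algebraMap c =>
          rw [← algebraMap_star_comm]
          exact Subalgebra.algebraMap_mem _ _
        | add x y _ _ hx hy => rw [star_add]; exact add_mem hx hy
        | mul x y _ _ hx hy => rw [star_mul]; exact mul_mem hy hx }
  have hint : ∀ f : Y →ᵇ ℂ, ∫ y, f y ∂P - ∫ y, f y ∂N = ∫ y, (r y : ℂ) * f y ∂ν := by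
    intro f
    have hm : AEMeasurable (fun y => (r y).toNNReal) ν := hr.1.aemeasurable.real_toNNReal
    have hm' : AEMeasurable (fun y => (-r y).toNNReal) ν := hr.1.aemeasurable.neg.real_toNNReal
    have e1 : ∫ y, f y ∂P = ∫ y, (((r y).toNNReal : ℝ) : ℂ) * f y ∂ν := by
      rw [hP]
      refine (integral_withDensity_eq_integral_smul₀ hm f).trans ?_
      rfl
    have e2 : ∫ y, f y ∂N = ∫ y, (((-r y).toNNReal : ℝ) : ℂ) * f y ∂ν := by
      rw [hN]
      refine (integral_withDensity_eq_integral_smul₀ hm' f).trans ?_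
      rfl
    rw [e1, e2, ← integral_sub]
    · congr 1
      ext y
      rw [← sub_mul, ← Complex.ofReal_sub, Real.coe_toNNReal', Real.coe_toNNReal']
      congr 2
      rcases le_total 0 (r y) with h | h
      · rw [max_eq_left h, max_eq_right (by linarith)]; ring
      · rw [max_eq_right h, max_eq_left (by linarith)]; ring
    · refine Integrable.mul_bdd (c := ‖f‖) (hr.real_toNNReal.ofReal) f.continuous.aestronglyMeasurable
        (.of_forall fun y => f.norm_coe_le_norm y)
    · refine Integrable.mul_bdd (c := ‖f‖) (hr.neg.real_toNNReal.ofReal)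
        f.continuous.aestronglyMeasurable (.of_forall fun y => f.norm_coe_le_norm y)
  have hPN : P = N := by
    refine ext_of_forall_mem_subalgebra_integral_eq_of_polish (𝕜 := ℂ) (A := A') ?_ ?_
    · intro x y hxy
      obtain ⟨a, ha⟩ := hsep x y hxy
      refine ⟨_, ⟨_, ⟨circleBCF (e a) (he a), Algebra.subset_adjoin ⟨a, rfl⟩, rfl⟩, rfl⟩, ?_⟩
      intro h
      exact ha (Subtype.ext h)
    · intro g hg
      rw [← sub_eq_zero, hint g]
      -- The family is closed under products, so the algebra it generates is just its linear span,
      -- and the vanishing extends by linearity.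
      have hg' : g ∈ Submodule.span ℂ (s : Set (Y →ᵇ ℂ)) := by
        have : g ∈ Subalgebra.toSubmodule (Algebra.adjoin ℂ (s : Set (Y →ᵇ ℂ))) := hg
        rwa [Algebra.adjoin_eq_span, Submonoid.closure_eq] at this
      have hi : ∀ f : Y →ᵇ ℂ, Integrable (fun y => (r y : ℂ) * f y) ν := fun f =>
        Integrable.mul_bdd (c := ‖f‖) hr.ofReal f.continuous.aestronglyMeasurable
          (.of_forall fun y => f.norm_coe_le_norm y)
      clear hg
      induction hg' using Submodule.span_induction with
      | mem x hx =>
        obtain ⟨a, rfl⟩ := hx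
        exact h0 a
      | zero => simp
      | add x y hx hy h1 h2 =>
        have := integral_add (hi x) (hi y)
        simp only [BoundedContinuousFunction.coe_add, Pi.add_apply, mul_add]
        rw [this, h1, h2, add_zero]
      | smul c x _ h =>
        simp only [BoundedContinuousFunction.coe_smul, smul_eq_mul, mul_left_comm _ c]
        rw [integral_const_mul, h, mul_zero]
  have hd := (withDensity_eq_iff (hr.1.aemeasurable.ennreal_ofReal)
    (hr.neg.1.aemeasurable.ennreal_ofReal) (hr.lintegral_lt_top.ne)).1 hPN
  filter_upwards [hd] with y hy
  simp only [Pi.neg_apply, Pi.zero_apply] at hy ⊢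
  rcases le_total 0 (r y) with h | h
  · rw [ENNReal.ofReal_eq_zero.2 (by linarith : -r y ≤ 0), ENNReal.ofReal_eq_zero] at hy
    linarith
  · rw [ENNReal.ofReal_eq_zero.2 h, eq_comm, ENNReal.ofReal_eq_zero] at hy
    linarith

/-- An integrable function all of whose Fourier coefficients against a separating group of
circle-valued functions vanish is zero almost everywhere. -/
theorem ae_eq_zero_of_forall_integral_circle_mul_eq_zero {Y A : Type*} [TopologicalSpace Y]
    [PolishSpace Y] [MeasurableSpace Y] [BorelSpace Y] [Group A] (ν : Measure Y)
    (e : A →* (Y → Circle)) (he : ∀ a, Continuous (e a))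
    (hsep : ∀ x y, x ≠ y → ∃ a, e a x ≠ e a y)
    (h : Y → ℂ) (hh : Integrable h ν) (h0 : ∀ a, ∫ y, h y * (e a y : ℂ) ∂ν = 0) :
    h =ᵐ[ν] 0 := by
  have hi : ∀ a, Integrable (fun y => h y * (e a y : ℂ)) ν := fun a =>
    Integrable.mul_bdd (c := 1) hh (continuous_circle_coe.comp (he a)).aestronglyMeasurable
      (.of_forall fun y => (Circle.norm_coe _).le)
  have hh' : Integrable (fun y => (starRingEnd ℂ) (h y)) ν :=
    (LinearIsometryEquiv.integrable_comp_iff Complex.conjLIE).2 hh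
  have hi' : ∀ a, Integrable (fun y => (starRingEnd ℂ) (h y) * (e a y : ℂ)) ν := fun a =>
    Integrable.mul_bdd (c := 1) hh' (continuous_circle_coe.comp (he a)).aestronglyMeasurable
      (.of_forall fun y => (Circle.norm_coe _).le)
  -- The inverse of `e a` is its conjugate, so the conjugate of `h` satisfies the same hypothesis;
  -- hence so do the real and imaginary parts.
  have h0' : ∀ a, ∫ y, (starRingEnd ℂ) (h y) * (e a y : ℂ) ∂ν = 0 := by
    intro a
    have := congrArg (starRingEnd ℂ) (h0 a⁻¹)
    rw [← integral_conj, map_zero] at this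
    rw [← this]
    congr 1
    ext y
    rw [map_mul, map_inv, Pi.inv_apply, Circle.coe_inv_eq_conj, Complex.conj_conj]
  have hre := ae_eq_zero_of_forall_integral_circle_mul_real_eq_zero ν e he hsep
    (fun y => (h y).re) hh.re (fun a => by
      have : ∀ y, ((h y).re : ℂ) * (e a y : ℂ) =
          (1 / 2 : ℂ) * (h y * e a y + (starRingEnd ℂ) (h y) * e a y) := by
        intro y
        rw [← add_mul, Complex.add_conj]; push_cast; ring
      simp_rw [this]
      rw [integral_const_mul, integral_add (hi a) (hi' a), h0, h0', add_zero, mul_zero])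
  have him := ae_eq_zero_of_forall_integral_circle_mul_real_eq_zero ν e he hsep
    (fun y => (h y).im) hh.im (fun a => by
      have : ∀ y, ((h y).im : ℂ) * (e a y : ℂ) =
          (-Complex.I / 2 : ℂ) * (h y * e a y - (starRingEnd ℂ) (h y) * e a y) := by
        intro y
        rw [← sub_mul, Complex.sub_conj]; push_cast
        linear_combination (((h y).im : ℂ) * (e a y : ℂ)) * Complex.I_sq
      simp_rw [this]
      rw [integral_const_mul, integral_sub (hi a) (hi' a), h0, h0', sub_zero, mul_zero])
  filter_upwards [hre, him] with y h1 h2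
  exact Complex.ext h1 h2

end Uniqueness

/-! ### Density and unitary extension in `L²`. -/

section L2

/-- A linear map into `L²` has dense range if only `0` is orthogonal to its range. -/
theorem denseRange_of_forall_inner_eq_zero {V H : Type*} [AddCommGroup V] [Module ℂ V]
    [NormedAddCommGroup H] [InnerProductSpace ℂ H] [CompleteSpace H] (a : V →ₗ[ℂ] H)
    (h : ∀ g : H, (∀ v, inner ℂ (a v) g = 0) → g = 0) : DenseRange a := by
  have : (LinearMap.range a).topologicalClosure = ⊤ := by
    rw [Submodule.topologicalClosure_eq_top_iff, Submodule.eq_bot_iff]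
    intro g hg
    refine h g fun v => ?_
    exact (Submodule.mem_orthogonal _ _).1 hg _ ⟨v, rfl⟩
  have h2 := (Submodule.dense_iff_topologicalClosure_eq_top).2 this
  exact h2

theorem memLp_two_of_integrable_of_bounded {Y : Type*} [MeasurableSpace Y] {ν : Measure Y}
    {k : Y → ℂ} (hk : Integrable k ν) {C : ℝ} (hC : ∀ᵐ y ∂ν, ‖k y‖ ≤ C) : MemLp k 2 ν := by
  rw [memLp_two_iff_integrable_sq_norm hk.1]
  simp_rw [pow_two]
  exact hk.norm.mul_bdd (c := C) hk.norm.1 (by simpa using hC)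

/-- The linear map from a submodule of square integrable functions to `L²`. -/
noncomputable def submoduleToLp {Y : Type*} [MeasurableSpace Y] (ν : Measure Y) {V : Type*}
    [AddCommGroup V] [Module ℂ V] (Φ : V →ₗ[ℂ] (Y → ℂ)) (h : ∀ v, MemLp (Φ v) 2 ν) :
    V →ₗ[ℂ] Lp ℂ 2 ν where
  toFun v := (h v).toLp (Φ v)
  map_add' u v := by
    simp only [map_add]
    exact MemLp.toLp_add (h u) (h v)
  map_smul' c v := by
    simp only [map_smul]
    exact MemLp.toLp_const_smul c (h v)

theorem inner_toLp_left {Y : Type*} [MeasurableSpace Y] {ν : Measure Y} {k : Y → ℂ}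
    (hk : MemLp k 2 ν) (g : Lp ℂ 2 ν) :
    inner ℂ (hk.toLp k) g = ∫ y, g y * (starRingEnd ℂ) (k y) ∂ν := by
  rw [L2.inner_def]
  refine integral_congr_ae ?_
  filter_upwards [hk.coeFn_toLp] with y hy
  rw [hy, RCLike.inner_apply]

/-- Unitary extension of an isometry between dense subspaces of `L²` spaces. -/
theorem exists_linearIsometryEquiv_of_dense {H₁ H₂ V : Type*} [AddCommGroup V] [Module ℂ V]
    [NormedAddCommGroup H₁] [InnerProductSpace ℂ H₁] [CompleteSpace H₁]
    [NormedAddCommGroup H₂] [InnerProductSpace ℂ H₂] [CompleteSpace H₂]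
    (a : V →ₗ[ℂ] H₁) (b : V →ₗ[ℂ] H₂) (ha : DenseRange a) (hb : DenseRange b)
    (hab : ∀ v, ‖b v‖ = ‖a v‖) : ∃ M : H₁ ≃ₗᵢ[ℂ] H₂, ∀ v, M (a v) = b v :=
  ⟨(LinearEquiv.refl ℂ V).extendOfIsometry a b ha hb hab,
    fun v => LinearEquiv.extendOfIsometry_eq _ _ _ ha hb hab v⟩

end L2

/-! ### Plancherel's theorem deduced from the inversion formula. -/

section Plancherel

/-- Local compactness makes the group uniformity complete and second countability makes it countably
generated, so it is completely metrizable. The uniqueness theorem above needs this for the group and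
for its dual. -/
theorem polishSpace_of_locallyCompact_commGroup (H : Type*) [CommGroup H] [TopologicalSpace H]
    [IsTopologicalGroup H] [LocallyCompactSpace H] [SecondCountableTopology H] [T2Space H] :
    PolishSpace H := by
  let := IsTopologicalGroup.rightUniformSpace H
  have : IsUniformGroup H := isUniformGroup_of_commGroup
  have : CompleteSpace H := IsRightUniformGroup.completeSpace_of_weaklyLocallyCompactSpace
  have : (uniformity H).IsCountablyGenerated := IsUniformGroup.uniformity_countably_generated
  have : TopologicalSpace.IsCompletelyMetrizableSpace H := inferInstance
  infer_instance

variable {G : Type*} [CommGroup G] [TopologicalSpace G] [IsTopologicalGroup G]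

theorem secondCountableTopology_pontryaginDual [LocallyCompactSpace G]
    [SecondCountableTopology G] : SecondCountableTopology (PontryaginDual G) :=
  (ContinuousMonoidHom.isInducing_toContinuousMap G Circle).secondCountableTopology

theorem continuous_pontryaginDual_eval [LocallyCompactSpace G] :
    Continuous (fun p : G × PontryaginDual G => p.2 p.1) := by
  have : Continuous (fun p : (G →ₜ* Circle) × G => p.1 p.2) := continuous_eval
  exact this.comp continuous_swap

theorem continuous_pontryaginDual_eval_const [LocallyCompactSpace G] (t : G) :
    Continuous (fun χ : PontryaginDual G => χ t) :=
  continuous_pontryaginDual_eval.comp (Continuous.prodMk_right t)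

/-- A function all of whose products with translates of a nonzero continuous function vanish
almost everywhere is zero almost everywhere. -/
theorem ae_eq_zero_of_forall_translate_mul {Y : Type*} [Group Y] [TopologicalSpace Y]
    [IsTopologicalGroup Y] [SecondCountableTopology Y] [MeasurableSpace Y]
    (ν : Measure Y) (k : Y → ℂ) (hk : Continuous k) (y₀ : Y) (hy₀ : k y₀ ≠ 0) (g : Y → ℂ)
    (h : ∀ a, ∀ᵐ y ∂ν, g y * (starRingEnd ℂ) (k (a * y)) = 0) : g =ᵐ[ν] 0 := by
  refine measure_null_of_locally_null _ fun y _ => ?_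
  -- This translate is nonzero at `y`, hence near `y`, so `g` vanishes almost everywhere near `y`;
  -- second countability glues the local statements.
  have hc : Continuous fun z => k (y₀ * y⁻¹ * z) := hk.comp (continuous_const_mul _)
  refine ⟨{z | k (y₀ * y⁻¹ * z) ≠ 0} ∩ {z | g z ≠ 0}, ?_, ?_⟩
  · rw [Set.inter_comm]
    refine inter_mem_nhdsWithin _ ((isOpen_ne_fun hc continuous_const).mem_nhds ?_)
    simpa using hy₀
  · refine measure_mono_null ?_ (h (y₀ * y⁻¹))
    rintro z ⟨h1, h2⟩
    simpa using ⟨h2, h1⟩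

variable [LocallyCompactSpace G] [SecondCountableTopology G] [T2Space G]
  [MeasurableSpace G] [BorelSpace G]
  [MeasurableSpace (PontryaginDual G)] [BorelSpace (PontryaginDual G)]
  (dt : Measure G) [dt.IsHaarMeasure] (μ : Measure (PontryaginDual G)) [μ.IsHaarMeasure]

/-- The Fourier transform of a function on an abelian group. -/
noncomputable def dualFourier (f : G → ℂ) (χ : PontryaginDual G) : ℂ :=
  ∫ t, f t * ((χ t : Circle) : ℂ) ∂dt

theorem integrable_mul_char {f : G → ℂ} (hf : Integrable f dt) (χ : PontryaginDual G) :
    Integrable (fun t => f t * ((χ t : Circle) : ℂ)) dt :=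
  hf.mul_bdd (c := 1) (continuous_circle_coe.comp (map_continuous χ)).aestronglyMeasurable
    (.of_forall fun _ => (Circle.norm_coe _).le)

theorem norm_dualFourier_le (f : G → ℂ) (χ : PontryaginDual G) :
    ‖dualFourier dt f χ‖ ≤ ∫ t, ‖f t‖ ∂dt := by
  refine (norm_integral_le_integral_norm _).trans (le_of_eq ?_)
  congr 1
  ext t
  rw [norm_mul, Circle.norm_coe, mul_one]

theorem continuous_dualFourier {f : G → ℂ} (hf : Integrable f dt) :
    Continuous (dualFourier dt f) := by
  have := secondCountableTopology_pontryaginDual (G := G)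
  refine continuous_of_dominated (bound := fun t => ‖f t‖)
    (fun χ => (integrable_mul_char dt hf χ).1) (fun χ => .of_forall fun t => ?_) hf.norm
    (.of_forall fun t => ?_)
  · rw [norm_mul, Circle.norm_coe, mul_one]
  · exact continuous_const.mul
      (continuous_circle_coe.comp (continuous_pontryaginDual_eval_const t))

/-- Continuous integrable functions with integrable Fourier transform. -/
noncomputable def fourierInvertible : Submodule ℂ (G → ℂ) where
  carrier := {k | Continuous k ∧ Integrable k dt ∧ Integrable (dualFourier dt k) μ}
  zero_mem' := ⟨continuous_const, integrable_zero _ _ _, by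
    have : dualFourier dt (0 : G → ℂ) = 0 := by
      ext χ
      simp [dualFourier]
    rw [this]
    exact integrable_zero _ _ _⟩
  add_mem' := by
    rintro f g ⟨h1, h2, h3⟩ ⟨h1', h2', h3'⟩
    refine ⟨h1.add h1', h2.add h2', (h3.add h3').congr (.of_forall fun χ => ?_)⟩
    simp only [dualFourier, Pi.add_apply, add_mul]
    rw [integral_add (integrable_mul_char dt h2 χ) (integrable_mul_char dt h2' χ)]
  smul_mem' := by
    rintro c f ⟨h1, h2, h3⟩
    refine ⟨h1.const_smul c, h2.smul c, (h3.smul c).congr (.of_forall fun χ => ?_)⟩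
    simp only [dualFourier, Pi.smul_apply, smul_eq_mul, mul_assoc]
    rw [integral_const_mul]

/-- The Fourier transform as a linear map on `fourierInvertible`. -/
noncomputable def fourierInvertibleTransform :
    fourierInvertible dt μ →ₗ[ℂ] (PontryaginDual G → ℂ) where
  toFun k := dualFourier dt k
  map_add' f g := by
    ext χ
    simp only [dualFourier, Submodule.coe_add, Pi.add_apply, add_mul]
    rw [integral_add (integrable_mul_char dt f.2.2.1 χ) (integrable_mul_char dt g.2.2.1 χ)]
  map_smul' c f := by
    ext χ
    simp only [dualFourier, Submodule.coe_smul, Pi.smul_apply, smul_eq_mul, mul_assoc,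
      RingHom.id_apply]
    rw [integral_const_mul]

/-- Translation multiplies the transform by a circle-valued function, and modulation translates it.
Stability under both is what lets a single nonzero member prove density on both sides. -/
theorem translate_mem_fourierInvertible {k : G → ℂ} (hk : k ∈ fourierInvertible dt μ) (a : G) :
    (fun t => k (a * t)) ∈ fourierInvertible dt μ ∧
      ∀ χ, dualFourier dt (fun t => k (a * t)) χ =
        dualFourier dt k χ * ((χ a⁻¹ : Circle) : ℂ) := by
  have h2 : ∀ χ, dualFourier dt (fun t => k (a * t)) χ =
      dualFourier dt k χ * ((χ a⁻¹ : Circle) : ℂ) := by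
    intro χ
    unfold dualFourier
    rw [← integral_mul_left_eq_self _ a⁻¹, ← integral_mul_const]
    congr 1
    ext t
    simp only [mul_inv_cancel_left, map_mul, Circle.coe_mul]
    ring
  refine ⟨⟨hk.1.comp (continuous_const_mul a), hk.2.1.comp_mul_left a, ?_⟩, h2⟩
  refine Integrable.congr (Integrable.mul_bdd (c := 1) hk.2.2
    (continuous_circle_coe.comp
      (continuous_pontryaginDual_eval_const a⁻¹)).aestronglyMeasurable
    (.of_forall fun _ => (Circle.norm_coe _).le)) (.of_forall fun χ => (h2 χ).symm)

theorem modulate_mem_fourierInvertible {k : G → ℂ} (hk : k ∈ fourierInvertible dt μ)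
    (ψ : PontryaginDual G) :
    (fun t => k t * ((ψ t : Circle) : ℂ)) ∈ fourierInvertible dt μ ∧
      ∀ χ, dualFourier dt (fun t => k t * ((ψ t : Circle) : ℂ)) χ =
        dualFourier dt k (ψ * χ) := by
  have h2 : ∀ χ, dualFourier dt (fun t => k t * ((ψ t : Circle) : ℂ)) χ =
      dualFourier dt k (ψ * χ) := by
    intro χ
    unfold dualFourier
    congr 1
    ext t
    have : (ψ * χ) t = ψ t * χ t := rfl
    rw [this, Circle.coe_mul, mul_assoc]
  exact ⟨⟨hk.1.mul (continuous_circle_coe.comp (map_continuous ψ)),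
    integrable_mul_char dt hk.2.1 ψ, (hk.2.2.comp_mul_left ψ).congr
      (.of_forall fun χ => (h2 χ).symm)⟩, h2⟩

section Inversion

variable (hinv : ∀ f : G → ℂ, Continuous f → Integrable f dt → Integrable (dualFourier dt f) μ →
  ∀ t, f t = ∫ χ, dualFourier dt f χ * (starRingEnd ℂ) ((χ t : Circle) : ℂ) ∂μ)

include hinv in
-- By the inversion formula `k` is bounded by the `L¹` norm of its transform, and a bounded
-- integrable function is square integrable.
theorem memLp_of_mem_fourierInvertible {k : G → ℂ} (hk : k ∈ fourierInvertible dt μ) :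
    MemLp k 2 dt := by
  refine memLp_two_of_integrable_of_bounded hk.2.1 (C := ∫ χ, ‖dualFourier dt k χ‖ ∂μ)
    (.of_forall fun t => ?_)
  rw [hinv k hk.1 hk.2.1 hk.2.2 t]
  refine (norm_integral_le_integral_norm _).trans (le_of_eq ?_)
  congr 1
  ext χ
  rw [norm_mul, RCLike.norm_conj, Circle.norm_coe, mul_one]

theorem memLp_dualFourier_of_mem {k : G → ℂ} (hk : k ∈ fourierInvertible dt μ) :
    MemLp (dualFourier dt k) 2 μ :=
  memLp_two_of_integrable_of_bounded hk.2.2 (.of_forall (norm_dualFourier_le dt k))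

include hinv in
-- Insert the inversion formula for `k` and exchange the integrals. Of `f` only integrability is
-- asked, so that the unitary extension can later be compared with the Fourier integral on all of
-- `L¹ ∩ L²`.
theorem parseval_of_mem_fourierInvertible {f k : G → ℂ} (hf : Integrable f dt)
    (hk : k ∈ fourierInvertible dt μ) :
    ∫ t, f t * (starRingEnd ℂ) (k t) ∂dt =
      ∫ χ, dualFourier dt f χ * (starRingEnd ℂ) (dualFourier dt k χ) ∂μ := by
  have := secondCountableTopology_pontryaginDual (G := G)
  have h1 : ∀ t, f t * (starRingEnd ℂ) (k t) =
      ∫ χ, f t * (starRingEnd ℂ) (dualFourier dt k χ) * ((χ t : Circle) : ℂ) ∂μ := by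
    intro t
    rw [hinv k hk.1 hk.2.1 hk.2.2 t, ← integral_conj, ← integral_const_mul]
    congr 1
    ext χ
    rw [map_mul, Complex.conj_conj, mul_assoc]
  simp_rw [h1]
  have hc : Integrable (fun χ => (starRingEnd ℂ) (dualFourier dt k χ)) μ :=
    (LinearIsometryEquiv.integrable_comp_iff Complex.conjLIE).2 hk.2.2
  rw [integral_integral_swap]
  · congr 1
    ext χ
    simp only [dualFourier]
    rw [← integral_mul_const]
    congr 1
    ext t
    ring
  · exact (hf.mul_prod hc).mul_bdd (c := 1)
      (continuous_circle_coe.comp continuous_pontryaginDual_eval).aestronglyMeasurable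
      (.of_forall fun _ => (Circle.norm_coe _).le)

/-- Evaluation of characters at a point, as a homomorphism. -/
noncomputable def evalCharHom : G →* (PontryaginDual G → Circle) where
  toFun a χ := χ a
  map_one' := by ext χ; simp
  map_mul' a b := by ext χ; simp

/-- Characters as functions. -/
noncomputable def charFunHom : PontryaginDual G →* (G → Circle) where
  toFun χ t := χ t
  map_one' := rfl
  map_mul' _ _ := rfl

include hinv in
/-- A function on the dual that is orthogonal to all Fourier transforms vanishes. -/
theorem ae_eq_zero_of_orthogonal_dualFourier {k : G → ℂ} (hk : k ∈ fourierInvertible dt μ)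
    (hk0 : k ≠ 0) (g : PontryaginDual G → ℂ)
    (hgi : ∀ k ∈ fourierInvertible dt μ,
      Integrable (fun χ => g χ * (starRingEnd ℂ) (dualFourier dt k χ)) μ)
    (hg : ∀ k ∈ fourierInvertible dt μ,
      ∫ χ, g χ * (starRingEnd ℂ) (dualFourier dt k χ) ∂μ = 0) : g =ᵐ[μ] 0 := by
  have := secondCountableTopology_pontryaginDual (G := G)
  have := polishSpace_of_locallyCompact_commGroup (PontryaginDual G)
  have hne : ∃ χ₀, dualFourier dt k χ₀ ≠ 0 := by
    by_contra! h
    refine hk0 (funext fun t => ?_)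
    rw [hinv k hk.1 hk.2.1 hk.2.2 t]
    simp [h]
  obtain ⟨χ₀, hχ₀⟩ := hne
  refine ae_eq_zero_of_forall_translate_mul μ _ (continuous_dualFourier dt hk.2.1) χ₀ hχ₀ g
    fun ψ => ?_
  -- Modulating `k` translates its transform; translating `k` then multiplies it by evaluations at
  -- points of `G`, which separate the characters. The uniqueness theorem kills the product of `g`
  -- with each translate.
  obtain ⟨hm, hmt⟩ := modulate_mem_fourierInvertible dt μ hk ψ
  simp_rw [← hmt]
  refine ae_eq_zero_of_forall_integral_circle_mul_eq_zero μ evalCharHom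
    continuous_pontryaginDual_eval_const (fun x y hxy => ?_) _ (hgi _ hm) fun a => ?_
  · by_contra! h
    exact hxy (PontryaginDual.ext h)
  · obtain ⟨ht, htt⟩ := translate_mem_fourierInvertible dt μ hm a
    rw [← hg _ ht]
    congr 1
    ext χ
    rw [htt, map_mul, map_inv, ← Circle.coe_inv_eq_conj, inv_inv, mul_assoc]
    rfl

/-- The mirror image of the preceding argument: translates of `k` localize, and modulations supply
the separating functions. That characters separate the points of `G` now has to be assumed. -/
theorem ae_eq_zero_of_orthogonal_fourierInvertible
    (hsep : ∀ x y : G, x ≠ y → ∃ χ : PontryaginDual G, χ x ≠ χ y)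
    {k : G → ℂ} (hk : k ∈ fourierInvertible dt μ)
    (hk0 : k ≠ 0) (g : G → ℂ)
    (hgi : ∀ k ∈ fourierInvertible dt μ, Integrable (fun t => g t * (starRingEnd ℂ) (k t)) dt)
    (hg : ∀ k ∈ fourierInvertible dt μ, ∫ t, g t * (starRingEnd ℂ) (k t) ∂dt = 0) :
    g =ᵐ[dt] 0 := by
  have := polishSpace_of_locallyCompact_commGroup G
  obtain ⟨t₀, ht₀⟩ := Function.ne_iff.1 hk0
  refine ae_eq_zero_of_forall_translate_mul dt k hk.1 t₀ ht₀ g fun a => ?_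
  obtain ⟨ht, -⟩ := translate_mem_fourierInvertible dt μ hk a
  refine ae_eq_zero_of_forall_integral_circle_mul_eq_zero dt charFunHom
    (fun χ => map_continuous χ) hsep _ (hgi _ ht) fun χ => ?_
  obtain ⟨hm, -⟩ := modulate_mem_fourierInvertible dt μ ht χ⁻¹
  rw [← hg _ hm]
  congr 1
  ext t
  have : χ⁻¹ t = (χ t)⁻¹ := rfl
  rw [map_mul, this, ← Circle.coe_inv_eq_conj, inv_inv, mul_assoc]
  rfl

include hinv in
/-- Plancherel's theorem for a group on which the inversion formula holds. -/
theorem exists_plancherel_isometry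
    (hsep : ∀ x y : G, x ≠ y → ∃ χ : PontryaginDual G, χ x ≠ χ y)
    {k : G → ℂ} (hk : k ∈ fourierInvertible dt μ) (hk0 : k ≠ 0) :
    ∃ M : Lp ℂ 2 dt ≃ₗᵢ[ℂ] Lp ℂ 2 μ,
      ∀ f : Lp ℂ 2 dt, Integrable f dt → M f =ᵐ[μ] dualFourier dt f := by
  have hL : ∀ v : fourierInvertible dt μ, MemLp ((fourierInvertible dt μ).subtype v) 2 dt :=
    fun v => memLp_of_mem_fourierInvertible dt μ hinv v.2
  have hR : ∀ v : fourierInvertible dt μ, MemLp (fourierInvertibleTransform dt μ v) 2 μ :=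
    fun v => memLp_dualFourier_of_mem dt μ v.2
  have hdL : DenseRange (submoduleToLp dt _ hL) := by
    refine denseRange_of_forall_inner_eq_zero _ fun g hg => ?_
    rw [Lp.eq_zero_iff_ae_eq_zero]
    refine ae_eq_zero_of_orthogonal_fourierInvertible dt μ hsep hk hk0 g
      (fun k hk => (Lp.memLp g).integrable_mul (hL ⟨k, hk⟩).star) fun k hk => ?_
    exact (inner_toLp_left (hL ⟨k, hk⟩) g).symm.trans (hg ⟨k, hk⟩)
  have hdR : DenseRange (submoduleToLp μ _ hR) := by
    refine denseRange_of_forall_inner_eq_zero _ fun g hg => ?_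
    rw [Lp.eq_zero_iff_ae_eq_zero]
    refine ae_eq_zero_of_orthogonal_dualFourier dt μ hinv hk hk0 g
      (fun k hk => (Lp.memLp g).integrable_mul (hR ⟨k, hk⟩).star) fun k hk => ?_
    exact (inner_toLp_left (hR ⟨k, hk⟩) g).symm.trans (hg ⟨k, hk⟩)
  have hn : ∀ v, ‖submoduleToLp μ _ hR v‖ = ‖submoduleToLp dt _ hL v‖ := by
    intro v
    have e1 := inner_toLp_left (hR v) ((hR v).toLp _)
    have e2 := inner_toLp_left (hL v) ((hL v).toLp _)
    have e3 : inner ℂ ((hR v).toLp _) ((hR v).toLp _) = inner ℂ ((hL v).toLp _) ((hL v).toLp _) := by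
      rw [e1, e2]
      refine Eq.trans (integral_congr_ae ?_) ((parseval_of_mem_fourierInvertible dt μ hinv
        v.2.2.1 v.2).symm.trans (integral_congr_ae ?_))
      · filter_upwards [(hR v).coeFn_toLp] with χ hχ
        rw [hχ]; rfl
      · filter_upwards [(hL v).coeFn_toLp] with χ hχ
        rw [hχ]; rfl
    rw [inner_self_eq_norm_sq_to_K, inner_self_eq_norm_sq_to_K] at e3
    have e4 : ‖(hR v).toLp _‖ ^ 2 = ‖(hL v).toLp _‖ ^ 2 := by exact_mod_cast e3
    exact (sq_eq_sq₀ (norm_nonneg _) (norm_nonneg _)).1 e4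
  obtain ⟨M, hM⟩ := exists_linearIsometryEquiv_of_dense _ _ hdL hdR hn
  refine ⟨M, fun f hf => ?_⟩
  -- Both functions have the inner product of `f` and `k` as their pairing with the transform of
  -- `k`: the first because `M` is unitary, the second by Parseval.
  have : (fun χ => (M f) χ - dualFourier dt f χ) =ᵐ[μ] 0 := by
    refine ae_eq_zero_of_orthogonal_dualFourier dt μ hinv hk hk0 _ (fun k hk => ?_)
      fun k hk => ?_
    all_goals
      have h1 : Integrable (fun χ => (M f) χ * (starRingEnd ℂ) (dualFourier dt k χ)) μ :=
        (Lp.memLp (M f)).integrable_mul (hR ⟨k, hk⟩).star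
      have h2 : Integrable (fun χ => dualFourier dt f χ *
          (starRingEnd ℂ) (dualFourier dt k χ)) μ :=
        Integrable.bdd_mul (c := ∫ t, ‖f t‖ ∂dt)
          ((LinearIsometryEquiv.integrable_comp_iff Complex.conjLIE).2 hk.2.2)
          (continuous_dualFourier dt hf).aestronglyMeasurable
          (.of_forall (norm_dualFourier_le dt f))
      simp only [sub_mul]
    · exact h1.sub h2
    · rw [integral_sub h1 h2, ← parseval_of_mem_fourierInvertible dt μ hinv hf hk, sub_eq_zero]
      have e1 := inner_toLp_left (hR ⟨k, hk⟩) (M f)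
      have e2 := inner_toLp_left (hL ⟨k, hk⟩) f
      have e3 : (hR ⟨k, hk⟩).toLp _ = M ((hL ⟨k, hk⟩).toLp _) := (hM ⟨k, hk⟩).symm
      rw [e3, LinearIsometryEquiv.inner_map_map, e2] at e1
      exact e1.symm
  filter_upwards [this] with χ hχ
  exact sub_eq_zero.1 hχ

end Inversion

end Plancherel

/-! ### The module and its comparison with the norm. -/

section LocalModule

open Pointwise

variable {K : Type*} [NormedField K] [ProperSpace K]

theorem localModule_zero : localModule (0 : K) = 0 := by simp [localModule]

theorem localModule_of_ne_zero {x : K} (hx : x ≠ 0) :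
    localModule x = (distribHaarChar K (Units.mk0 x hx) : NNReal) := by simp [localModule, hx]

theorem localModule_units (t : Kˣ) : localModule (t : K) = (distribHaarChar K t : NNReal) := by
  rw [localModule_of_ne_zero t.ne_zero, Units.mk0_val]

theorem localModule_pos {x : K} (hx : x ≠ 0) : 0 < localModule x := by
  rw [localModule_of_ne_zero hx]
  exact NNReal.coe_pos.2 distribHaarChar_pos

theorem localModule_units_pos (t : Kˣ) : 0 < localModule (t : K) := localModule_pos t.ne_zero

theorem localModule_nonneg (x : K) : 0 ≤ localModule x := by
  by_cases hx : x = 0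
  · simp [hx, localModule_zero]
  · exact (localModule_pos hx).le

theorem localModule_one : localModule (1 : K) = 1 := by
  have := localModule_units (1 : Kˣ)
  simpa using this

theorem localModule_mul (x y : K) : localModule (x * y) = localModule x * localModule y := by
  by_cases hx : x = 0
  · simp [hx, localModule_zero]
  by_cases hy : y = 0
  · simp [hy, localModule_zero]
  have := localModule_units (Units.mk0 x hx * Units.mk0 y hy)
  rw [Units.val_mul, Units.val_mk0, Units.val_mk0, map_mul] at this
  rw [this, localModule_of_ne_zero hx, localModule_of_ne_zero hy, NNReal.coe_mul]

/-- The module as a monoid homomorphism. -/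
noncomputable def localModuleHom : K →*₀ ℝ where
  toFun := localModule
  map_zero' := localModule_zero
  map_one' := localModule_one
  map_mul' := localModule_mul

theorem localModule_inv (x : K) : localModule x⁻¹ = (localModule x)⁻¹ :=
  map_inv₀ (localModuleHom (K := K)) x

theorem localModule_pow (x : K) (n : ℕ) : localModule (x ^ n) = localModule x ^ n :=
  map_pow (localModuleHom (K := K)) x n

theorem localModule_zpow (x : K) (n : ℤ) : localModule (x ^ n) = localModule x ^ n :=
  map_zpow₀ (localModuleHom (K := K)) x n

section Measure

variable [MeasurableSpace K] [BorelSpace K] (dx : Measure K) [dx.IsAddHaarMeasure]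

theorem addHaar_smul_units (t : Kˣ) (A : Set K) :
    dx (t • A) = ENNReal.ofReal (localModule (t : K)) * dx A := by
  rw [← distribHaarChar_mul dx t A, localModule_units, ENNReal.ofReal_coe_nnreal]

theorem map_mul_addHaar (t : Kˣ) :
    dx.map (fun y => (t : K) * y) = ENNReal.ofReal (localModule (t : K))⁻¹ • dx := by
  ext s hs
  rw [Measure.map_apply (measurable_const_mul _) hs, Measure.smul_apply, smul_eq_mul]
  have h1 : (fun y => (t : K) * y) ⁻¹' s = t⁻¹ • s := by
    rw [← Set.preimage_smul]
    rfl
  rw [h1, addHaar_smul_units, Units.val_inv_eq_inv_val, localModule_inv]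

theorem integral_comp_mul_addHaar {E : Type*} [NormedAddCommGroup E] [NormedSpace ℝ E]
    (t : Kˣ) (f : K → E) :
    ∫ y, f ((t : K) * y) ∂dx = (localModule (t : K))⁻¹ • ∫ y, f y ∂dx := by
  have he : MeasurableEmbedding (fun y : K => (t : K) * y) :=
    (Homeomorph.mulLeft₀ (t : K) t.ne_zero).measurableEmbedding
  rw [← he.integral_map, map_mul_addHaar, integral_smul_measure,
    ENNReal.toReal_ofReal (inv_nonneg.2 (localModule_nonneg _))]

theorem integrable_comp_mul_addHaar {E : Type*} [NormedAddCommGroup E]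
    (t : Kˣ) (f : K → E) :
    Integrable (fun y => f ((t : K) * y)) dx ↔ Integrable f dx := by
  have he : MeasurableEmbedding (fun y : K => (t : K) * y) :=
    (Homeomorph.mulLeft₀ (t : K) t.ne_zero).measurableEmbedding
  have := he.integrable_map_iff (μ := dx) (g := f)
  rw [map_mul_addHaar, integrable_smul_measure] at this
  · exact this.symm
  · simpa using (localModule_units_pos t)
  · exact ENNReal.ofReal_ne_top

theorem lintegral_comp_mul_addHaar (t : Kˣ) (f : K → ℝ≥0∞) :
    ∫⁻ y, f ((t : K) * y) ∂dx = ENNReal.ofReal (localModule (t : K))⁻¹ * ∫⁻ y, f y ∂dx := by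
  have he : MeasurableEmbedding (fun y : K => (t : K) * y) :=
    (Homeomorph.mulLeft₀ (t : K) t.ne_zero).measurableEmbedding
  rw [← he.lintegral_map, map_mul_addHaar, lintegral_smul_measure, smul_eq_mul]

end Measure

/-- Multiplication by `x` maps the closed unit ball into itself, and that ball has positive finite
measure. -/
theorem localModule_le_one_of_norm_le_one {x : K} (hx : ‖x‖ ≤ 1) : localModule x ≤ 1 := by
  by_cases h0 : x = 0
  · simp [h0, localModule_zero]
  borelize K
  let dx : Measure K := Measure.addHaar
  have h1 := addHaar_smul_units dx (Units.mk0 x h0) (Metric.closedBall 0 1)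
  have h2 : (Units.mk0 x h0) • Metric.closedBall (0 : K) 1 ⊆ Metric.closedBall 0 1 := by
    rintro _ ⟨y, hy, rfl⟩
    rw [mem_closedBall_zero_iff] at hy ⊢
    change ‖x * y‖ ≤ 1
    rw [norm_mul]
    exact mul_le_one₀ hx (norm_nonneg _) hy
  have h3 := measure_mono (μ := dx) h2
  have h4 : dx (Metric.closedBall 0 1) ≠ ∞ := (isCompact_closedBall 0 1).measure_lt_top.ne
  have h5 : dx (Metric.closedBall 0 1) ≠ 0 := (Metric.measure_closedBall_pos dx 0 one_pos).ne'
  rw [h1, Units.val_mk0] at h3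
  have h6 : ENNReal.ofReal (localModule x) ≤ 1 := by
    by_contra! h
    have := ENNReal.mul_lt_mul_left h5 h4 h
    rw [one_mul] at this
    exact absurd h3 (not_le.2 this)
  simpa using h6

/-- If `|x|` were `1`, the images of the unit ball under the powers of `x` would keep its measure
while shrinking to `{0}`. Then `{0}` would carry the whole measure, leaving none for the open set of
nonzero points of norm less than one, which contains `x`. -/
theorem localModule_lt_one_of_norm_lt_one {x : K} (hx : ‖x‖ < 1) : localModule x < 1 := by
  by_cases h0 : x = 0
  · simp [h0, localModule_zero]
  borelize K
  let dx : Measure K := Measure.addHaar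
  refine lt_of_le_of_ne (localModule_le_one_of_norm_le_one hx.le) fun h => ?_
  have hb : ∀ n : ℕ, dx (Metric.closedBall 0 1) ≤ dx (Metric.closedBall 0 (‖x‖ ^ n)) := by
    intro n
    have h1 := addHaar_smul_units dx (Units.mk0 x h0 ^ n) (Metric.closedBall 0 1)
    rw [Units.val_pow_eq_pow_val, Units.val_mk0, localModule_pow, h, one_pow, ENNReal.ofReal_one,
      one_mul] at h1
    rw [← h1]
    refine measure_mono ?_
    rintro _ ⟨y, hy, rfl⟩
    rw [mem_closedBall_zero_iff] at hy ⊢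
    change ‖((Units.mk0 x h0 ^ n : Kˣ) : K) * y‖ ≤ _
    rw [norm_mul, Units.val_pow_eq_pow_val, Units.val_mk0, norm_pow]
    exact mul_le_of_le_one_right (by positivity) hy
  have hI : ⋂ n : ℕ, Metric.closedBall (0 : K) (‖x‖ ^ n) = {0} := by
    ext y
    simp only [Set.mem_iInter, mem_closedBall_zero_iff, Set.mem_singleton_iff]
    refine ⟨fun hy => ?_, fun hy n => by rw [hy, norm_zero]; positivity⟩
    have := ge_of_tendsto' (tendsto_pow_atTop_nhds_zero_of_lt_one (norm_nonneg x) hx) hy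
    exact norm_le_zero_iff.1 this
  have ht := tendsto_measure_iInter_atTop (μ := dx)
    (s := fun n : ℕ => Metric.closedBall (0 : K) (‖x‖ ^ n))
    (fun n => Metric.isClosed_closedBall.measurableSet.nullMeasurableSet)
    (fun m n hmn => Metric.closedBall_subset_closedBall
      (pow_le_pow_of_le_one (norm_nonneg x) hx.le hmn))
    ⟨0, (isCompact_closedBall _ _).measure_lt_top.ne⟩
  rw [hI] at ht
  have h1 : dx (Metric.closedBall 0 1) ≤ dx {0} := ge_of_tendsto' ht hb
  have hpos : 0 < dx (Metric.ball 0 1 \ {0}) :=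
    (Metric.isOpen_ball.sdiff isClosed_singleton).measure_pos dx
      ⟨x, by simpa using ⟨hx, h0⟩⟩
  have h2 : dx {0} + dx (Metric.ball 0 1 \ {0}) ≤ dx (Metric.closedBall 0 1) := by
    rw [← measure_union Set.disjoint_sdiff_right
      (Metric.isOpen_ball.sdiff isClosed_singleton).measurableSet]
    refine measure_mono (Set.union_subset (by simp) ?_)
    exact Set.sdiff_subset.trans Metric.ball_subset_closedBall
  have h3 : dx {0} ≠ ∞ := isCompact_singleton.measure_lt_top.ne
  exact absurd (h2.trans h1) (not_le.2 (ENNReal.lt_add_right h3 hpos.ne'))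

theorem localModule_le_one_iff {x : K} : localModule x ≤ 1 ↔ ‖x‖ ≤ 1 := by
  refine ⟨fun h => ?_, localModule_le_one_of_norm_le_one⟩
  by_contra! h1
  have h2 : ‖x⁻¹‖ < 1 := by
    rw [norm_inv]; exact inv_lt_one_of_one_lt₀ h1
  have h3 := localModule_lt_one_of_norm_lt_one h2
  have hx : x ≠ 0 := by
    rintro rfl
    norm_num at h1
  rw [localModule_inv, inv_lt_one₀ (localModule_pos hx)] at h3
  exact absurd h (not_le.2 h3)

/-- The module is a power of the norm. -/
theorem exists_localModule_eq_norm_rpow [hK : Fact (∃ p : K, p ≠ 0 ∧ ‖p‖ < 1)] :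
    ∃ d : ℝ, 0 < d ∧ ∀ x : K, localModule x = ‖x‖ ^ d := by
  obtain ⟨p, hp0, hp1⟩ := hK.out
  have hlp : Real.log ‖p‖ < 0 := Real.log_neg (norm_pos_iff.2 hp0) hp1
  have hlm : Real.log (localModule p) < 0 :=
    Real.log_neg (localModule_pos hp0) (localModule_lt_one_of_norm_lt_one hp1)
  refine ⟨Real.log (localModule p) / Real.log ‖p‖, div_pos_of_neg_of_neg hlm hlp, fun x => ?_⟩
  by_cases hx : x = 0
  · rw [hx, localModule_zero, norm_zero, Real.zero_rpow (div_pos_of_neg_of_neg hlm hlp).ne']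
  -- Module and norm have the same unit ball. Applied to `x ^ m / p ^ k`, this says that the two
  -- ratios of logarithms make the same cut in the rationals.
  have key : ∀ (m : ℕ) (k : ℤ), (m : ℝ) * Real.log ‖x‖ ≤ k * Real.log ‖p‖ ↔
      (m : ℝ) * Real.log (localModule x) ≤ k * Real.log (localModule p) := by
    intro m k
    have h := localModule_le_one_iff (x := x ^ m * (p ^ k)⁻¹)
    have hx' := norm_pos_iff.2 hx
    have hp' := norm_pos_iff.2 hp0
    rw [localModule_mul, localModule_inv, localModule_pow, localModule_zpow, norm_mul, norm_inv,
      norm_pow, norm_zpow, ← div_eq_mul_inv, ← div_eq_mul_inv,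
      div_le_one (zpow_pos (localModule_pos hp0) _), div_le_one (zpow_pos hp' _),
      ← Real.log_le_log_iff (pow_pos (localModule_pos hx) _) (zpow_pos (localModule_pos hp0) _),
      ← Real.log_le_log_iff (pow_pos hx' _) (zpow_pos hp' _), Real.log_pow, Real.log_pow,
      Real.log_zpow, Real.log_zpow] at h
    exact h.symm
  have hq : ∀ q : ℚ, (q : ℝ) ≤ Real.log ‖x‖ / Real.log ‖p‖ ↔
      (q : ℝ) ≤ Real.log (localModule x) / Real.log (localModule p) := by
    intro q
    rw [le_div_iff_of_neg hlp, le_div_iff_of_neg hlm]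
    have hd : (0 : ℝ) < q.den := by exact_mod_cast q.den_pos
    have h := key q.den q.num
    have hqe : (q.num : ℝ) = q.den * q := by
      exact_mod_cast (Rat.den_mul_eq_num q).symm
    rw [hqe, mul_assoc, mul_assoc, mul_le_mul_iff_right₀ hd, mul_le_mul_iff_right₀ hd] at h
    exact h
  have heq : Real.log ‖x‖ / Real.log ‖p‖ = Real.log (localModule x) / Real.log (localModule p) := by
    refine le_antisymm ?_ ?_ <;> refine le_of_forall_rat_lt_imp_le fun q hq' => ?_
    · exact (hq q).1 hq'.le
    · exact (hq q).2 hq'.le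
  rw [Real.rpow_def_of_pos (norm_pos_iff.2 hx), ← Real.exp_log (localModule_pos hx)]
  congr 1
  have h1 := hlp.ne
  have h2 := hlm.ne
  field_simp at heq ⊢
  linarith

end LocalModule

/-! ### The multiplicative Haar measure `dx/|x|`. -/

section UnitsMeasure

variable {K : Type*} [NormedField K] [ProperSpace K] [hK : Fact (∃ p : K, p ≠ 0 ∧ ‖p‖ < 1)]

theorem continuous_localModule : Continuous (localModule : K → ℝ) := by
  obtain ⟨d, hd, h⟩ := exists_localModule_eq_norm_rpow (K := K)
  simp_rw [funext h]
  exact continuous_norm.rpow_const fun _ => Or.inr hd.le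

instance secondCountableTopology_units : SecondCountableTopology Kˣ :=
  (Units.isOpenEmbedding_val (R := K)).isInducing.secondCountableTopology

instance locallyCompactSpace_units : LocallyCompactSpace Kˣ :=
  (Units.isOpenEmbedding_val (R := K)).locallyCompactSpace

variable [MeasurableSpace K] [BorelSpace K]

instance borelSpace_units : BorelSpace Kˣ where
  measurable_eq := by
    have h : (Units.instTopologicalSpaceUnits : TopologicalSpace Kˣ) =
        TopologicalSpace.induced Units.val inferInstance :=
      (Units.isOpenEmbedding_val (R := K)).isInducing.eq_induced
    have h2 : (Units.instMeasurableSpace : MeasurableSpace Kˣ) =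
        (borel K).comap Units.val := by
      rw [← BorelSpace.measurable_eq (α := K)]
      rfl
    rw [h2, h, ← borel_comap]

theorem measurableEmbedding_unitsVal : MeasurableEmbedding (Units.val : Kˣ → K) :=
  (Units.isOpenEmbedding_val (R := K)).measurableEmbedding

variable (dx : Measure K) [dx.IsAddHaarMeasure]

/-- Multiplication by `p` fixes `{0}` but scales the measure by a factor different from `1`. -/
theorem addHaar_singleton_zero : dx {0} = 0 := by
  obtain ⟨p, hp0, hp1⟩ := hK.out
  have h := lintegral_comp_mul_addHaar dx (Units.mk0 p hp0) (Set.indicator {0} 1)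
  have h1 : (fun y : K => Set.indicator {0} (1 : K → ℝ≥0∞) ((Units.mk0 p hp0 : Kˣ) * y)) =
      Set.indicator {0} 1 := by
    ext y
    by_cases hy : y = 0
    · simp [hy]
    · simp [hy, hp0]
  rw [h1, lintegral_indicator_one (measurableSet_singleton _)] at h
  by_contra h0
  have hlt : (1 : ℝ≥0∞) < ENNReal.ofReal (localModule p)⁻¹ := by
    rw [ENNReal.one_lt_ofReal]
    exact (one_lt_inv₀ (localModule_pos hp0)).2 (localModule_lt_one_of_norm_lt_one hp1)
  have := ENNReal.mul_lt_mul_left h0 isCompact_singleton.measure_lt_top.ne hlt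
  rw [one_mul] at this
  exact this.ne h

theorem ae_ne_zero_addHaar : ∀ᵐ x ∂dx, x ≠ 0 := by
  rw [ae_iff]
  simpa using addHaar_singleton_zero dx

theorem map_val_comap_val : (dx.comap (Units.val : Kˣ → K)).map Units.val = dx := by
  rw [measurableEmbedding_unitsVal.map_comap, Measure.restrict_eq_self_of_ae_mem]
  filter_upwards [ae_ne_zero_addHaar dx] with x hx
  exact ⟨Units.mk0 x hx, rfl⟩

/-- The multiplicative Haar measure `dx / |x|`. -/
noncomputable def mulHaarOfAdd : Measure Kˣ :=
  (dx.comap (Units.val : Kˣ → K)).withDensity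
    (fun t => ENNReal.ofReal (localModule (t : K))⁻¹)

theorem measurable_density :
    Measurable (fun x : K => ENNReal.ofReal (localModule x)⁻¹) :=
  (continuous_localModule.measurable.inv).ennreal_ofReal

theorem measurable_density_units :
    Measurable (fun t : Kˣ => ENNReal.ofReal (localModule (t : K))⁻¹) :=
  measurable_density.comp measurableEmbedding_unitsVal.measurable

theorem lintegral_mulHaarOfAdd {g : K → ℝ≥0∞} (hg : Measurable g) :
    ∫⁻ t : Kˣ, g t ∂(mulHaarOfAdd dx) = ∫⁻ x, ENNReal.ofReal (localModule x)⁻¹ * g x ∂dx := by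
  rw [mulHaarOfAdd, lintegral_withDensity_eq_lintegral_mul _ measurable_density_units
    (g := fun t : Kˣ => g (t : K)) (hg.comp measurableEmbedding_unitsVal.measurable)]
  conv_rhs => rw [← map_val_comap_val dx, measurableEmbedding_unitsVal.lintegral_map]
  rfl

/-- Invariance holds because the factor by which multiplication scales `dx` cancels against that of
the density `|x|⁻¹`. -/
instance isHaarMeasure_mulHaarOfAdd : (mulHaarOfAdd dx).IsHaarMeasure where
  map_mul_left_eq_self a := by
    ext s hs
    rw [Measure.map_apply (measurable_const_mul a) hs]
    set S : Set K := Units.val '' s with hS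
    have hSm : MeasurableSet S := measurableEmbedding_unitsVal.measurableSet_image.2 hs
    have hind : Measurable (S.indicator (1 : K → ℝ≥0∞)) := measurable_one.indicator hSm
    have h1 : ∀ t : Kˣ, (t : K) ∈ S ↔ t ∈ s := fun t =>
      Function.Injective.mem_set_image Units.val_injective
    have e1 : mulHaarOfAdd dx s = ∫⁻ t : Kˣ, S.indicator (1 : K → ℝ≥0∞) t ∂(mulHaarOfAdd dx) := by
      rw [← lintegral_indicator_one hs]
      congr 1
      ext t
      by_cases ht : t ∈ s
      · rw [Set.indicator_of_mem ht, Set.indicator_of_mem ((h1 t).2 ht)]; rfl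
      · rw [Set.indicator_of_notMem ht, Set.indicator_of_notMem (mt (h1 t).1 ht)]
    have e2 : mulHaarOfAdd dx ((fun x => a * x) ⁻¹' s) =
        ∫⁻ t : Kˣ, S.indicator (1 : K → ℝ≥0∞) (a * t) ∂(mulHaarOfAdd dx) := by
      rw [← lintegral_indicator_one (measurable_const_mul a hs)]
      congr 1
      ext t
      rw [← Units.val_mul]
      by_cases ht : a * t ∈ s
      · rw [Set.indicator_of_mem (show t ∈ (fun x => a * x) ⁻¹' s from ht),
          Set.indicator_of_mem ((h1 _).2 ht)]; rfl
      · rw [Set.indicator_of_notMem (show t ∉ (fun x => a * x) ⁻¹' s from ht),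
          Set.indicator_of_notMem (mt (h1 _).1 ht)]
    have ha := localModule_units_pos a
    rw [e1, e2, lintegral_mulHaarOfAdd dx hind,
      lintegral_mulHaarOfAdd dx (g := fun x => S.indicator (1 : K → ℝ≥0∞) (a * x))
        (hind.comp (measurable_const_mul _))]
    have e3 := lintegral_comp_mul_addHaar dx a
      (fun x => ENNReal.ofReal (localModule x)⁻¹ * S.indicator (1 : K → ℝ≥0∞) x)
    have e4 : ∀ x : K, ENNReal.ofReal (localModule ((a : K) * x))⁻¹ *
        S.indicator (1 : K → ℝ≥0∞) (a * x) = ENNReal.ofReal (localModule (a : K))⁻¹ *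
        (ENNReal.ofReal (localModule x)⁻¹ * S.indicator (1 : K → ℝ≥0∞) (a * x)) := by
      intro x
      rw [localModule_mul, mul_inv, ENNReal.ofReal_mul (inv_nonneg.2 ha.le), mul_assoc]
    simp_rw [e4] at e3
    rw [lintegral_const_mul _ (f := fun y => ENNReal.ofReal (localModule y)⁻¹ *
      S.indicator (1 : K → ℝ≥0∞) (a * y))
      (measurable_density.mul (hind.comp (measurable_const_mul _)))] at e3
    have hne : ENNReal.ofReal (localModule (a : K))⁻¹ ≠ 0 := by simpa using ha
    exact (ENNReal.mul_right_inj hne ENNReal.ofReal_ne_top).1 e3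
  lt_top_of_isCompact := by
    intro C hC
    have hc : ContinuousOn (fun t : Kˣ => (localModule (t : K))⁻¹) C :=
      ((continuous_localModule.comp Units.continuous_val).inv₀
        fun t => (localModule_units_pos t).ne').continuousOn
    obtain ⟨M, hM⟩ := (hC.bddAbove_image hc)
    have h1 : ∀ t ∈ C, ENNReal.ofReal (localModule (t : K))⁻¹ ≤ ENNReal.ofReal M := fun t ht =>
      ENNReal.ofReal_le_ofReal (hM ⟨t, ht, rfl⟩)
    rw [mulHaarOfAdd, withDensity_apply _ hC.measurableSet]
    refine (setLIntegral_mono measurable_const h1).trans_lt ?_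
    rw [setLIntegral_const]
    refine ENNReal.mul_lt_top ENNReal.ofReal_lt_top ?_
    rw [measurableEmbedding_unitsVal.comap_apply]
    exact (hC.image Units.continuous_val).measure_lt_top
  open_pos := by
    intro U hU hne h0
    rw [mulHaarOfAdd, withDensity_apply_eq_zero measurable_density_units] at h0
    have h1 : {t : Kˣ | ENNReal.ofReal (localModule (t : K))⁻¹ ≠ 0} ∩ U = U := by
      refine Set.inter_eq_right.2 fun t _ => ?_
      simpa using localModule_units_pos t
    rw [h1, measurableEmbedding_unitsVal.comap_apply] at h0
    exact ((Units.isOpenEmbedding_val (R := K)).isOpenMap U hU).measure_ne_zero dx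
      (hne.image _) h0

theorem exists_mulHaar_eq (dt : Measure Kˣ) [dt.IsHaarMeasure] :
    ∃ α : ℝ, 0 < α ∧ dt = ENNReal.ofReal (α ^ 2)⁻¹ • mulHaarOfAdd dx := by
  have h := Measure.isMulLeftInvariant_eq_smul dt (mulHaarOfAdd dx)
  set c := Measure.haarScalarFactor dt (mulHaarOfAdd dx) with hc
  have hc0 : 0 < c := Measure.haarScalarFactor_pos_of_isHaarMeasure _ _
  -- The ratio of the two Haar measures has to be `α⁻²`.
  refine ⟨√((c : ℝ)⁻¹), by positivity, ?_⟩
  rw [Real.sq_sqrt (by positivity), inv_inv, ENNReal.ofReal_coe_nnreal]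
  exact h

/-- Integration of a function of `K` against a multiplicative Haar measure. -/
theorem integral_mulHaar {E : Type*} [NormedAddCommGroup E] [NormedSpace ℝ E] {dt : Measure Kˣ}
    {α : ℝ} (hdt : dt = ENNReal.ofReal (α ^ 2)⁻¹ • mulHaarOfAdd dx) (f : K → E) :
    ∫ t : Kˣ, f t ∂dt = (α ^ 2)⁻¹ • ∫ x, (localModule x)⁻¹ • f x ∂dx := by
  rw [hdt, integral_smul_measure, ENNReal.toReal_ofReal (by positivity)]
  congr 1
  rw [mulHaarOfAdd]
  have hm : Measurable fun t : Kˣ => (localModule (t : K))⁻¹.toNNReal :=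
    ((continuous_localModule.measurable.comp
      measurableEmbedding_unitsVal.measurable).inv).real_toNNReal
  refine (integral_withDensity_eq_integral_smul hm _).trans ?_
  conv_rhs => rw [← map_val_comap_val dx, measurableEmbedding_unitsVal.integral_map]
  congr 1
  ext t
  rw [NNReal.smul_def, Real.coe_toNNReal _ (inv_nonneg.2 (localModule_nonneg _))]

theorem integrable_mulHaar_iff {E : Type*} [NormedAddCommGroup E] [NormedSpace ℝ E]
    {dt : Measure Kˣ} {α : ℝ} (hα : 0 < α)
    (hdt : dt = ENNReal.ofReal (α ^ 2)⁻¹ • mulHaarOfAdd dx) (f : K → E) :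
    Integrable (fun t : Kˣ => f t) dt ↔ Integrable (fun x => (localModule x)⁻¹ • f x) dx := by
  have hα' : 0 < (α ^ 2)⁻¹ := by positivity
  rw [hdt, integrable_smul_measure (by simpa using hα.ne') ENNReal.ofReal_ne_top, mulHaarOfAdd]
  have hm : Measurable fun t : Kˣ => (localModule (t : K))⁻¹.toNNReal :=
    ((continuous_localModule.measurable.comp
      measurableEmbedding_unitsVal.measurable).inv).real_toNNReal
  refine (integrable_withDensity_iff_integrable_smul hm).trans ?_
  conv_rhs => rw [← map_val_comap_val dx, measurableEmbedding_unitsVal.integrable_map_iff]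
  refine iff_of_eq (congrArg (fun g => Integrable g _) ?_)
  ext t
  simp [NNReal.smul_def, Real.coe_toNNReal _ (inv_nonneg.2 (localModule_nonneg (t : K)))]

theorem ae_mulHaar_iff {dt : Measure Kˣ} {α : ℝ} (hα : 0 < α)
    (hdt : dt = ENNReal.ofReal (α ^ 2)⁻¹ • mulHaarOfAdd dx) (P : K → Prop) :
    (∀ᵐ t : Kˣ ∂dt, P t) ↔ ∀ᵐ x ∂dx, P x := by
  have hα' : 0 < (α ^ 2)⁻¹ := by positivity
  rw [hdt, Measure.ae_ennreal_smul_measure_iff (by simpa using hα.ne'), mulHaarOfAdd,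
    ae_withDensity_iff measurable_density_units]
  conv_rhs => rw [← map_val_comap_val dx, measurableEmbedding_unitsVal.ae_map_iff]
  refine Filter.eventually_congr (.of_forall fun t => ?_)
  have := localModule_units_pos t
  simp [this]

end UnitsMeasure

/-! ### Integrable majorants for functions of moderate decay. -/

section Majorant

variable {K : Type*} [NormedField K] [ProperSpace K] [hK : Fact (∃ p : K, p ≠ 0 ∧ ‖p‖ < 1)]
variable [MeasurableSpace K] [BorelSpace K] (dx : Measure K) [dx.IsAddHaarMeasure]

theorem isCompact_localModule_le (r : ℝ) : IsCompact {x : K | localModule x ≤ r} := by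
  obtain ⟨d, hd, h⟩ := exists_localModule_eq_norm_rpow (K := K)
  refine Metric.isCompact_of_isClosed_isBounded
    (isClosed_le continuous_localModule continuous_const) ?_
  refine (Metric.isBounded_closedBall (x := (0 : K)) (r := r ^ d⁻¹)).subset fun x hx => ?_
  rw [mem_closedBall_zero_iff]
  have hx' : ‖x‖ ^ d ≤ r := by rw [← h]; exact hx
  calc ‖x‖ = (‖x‖ ^ d) ^ d⁻¹ := by
        rw [← Real.rpow_mul (norm_nonneg _), mul_inv_cancel₀ hd.ne', Real.rpow_one]
    _ ≤ r ^ d⁻¹ := Real.rpow_le_rpow (by positivity) hx' (inv_nonneg.2 hd.le)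

theorem measurable_ofReal_localModule_rpow (a : ℝ) :
    Measurable fun x : K => ENNReal.ofReal (localModule x ^ a) :=
  (continuous_localModule.measurable.pow_const a).ennreal_ofReal

theorem lintegral_scaled_rpow (a : ℝ) (u : Kˣ) (A : Set K) (hA : MeasurableSet A) :
    ∫⁻ x in {x | ((u⁻¹ : Kˣ) : K) * x ∈ A}, ENNReal.ofReal (localModule x ^ a) ∂dx =
      ENNReal.ofReal (localModule (u : K) ^ (1 + a)) *
        ∫⁻ x in A, ENNReal.ofReal (localModule x ^ a) ∂dx := by
  have hu := localModule_units_pos u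
  have hA' : MeasurableSet {x | ((u⁻¹ : Kˣ) : K) * x ∈ A} := measurable_const_mul _ hA
  have h := lintegral_comp_mul_addHaar dx u⁻¹
    (fun y => A.indicator (fun y => ENNReal.ofReal (localModule ((u : K) * y) ^ a)) y)
  rw [lintegral_indicator hA] at h
  rw [← lintegral_indicator hA']
  have e1 : ∀ x : K, ({x | ((u⁻¹ : Kˣ) : K) * x ∈ A}).indicator
      (fun x => ENNReal.ofReal (localModule x ^ a)) x =
      A.indicator (fun y => ENNReal.ofReal (localModule ((u : K) * y) ^ a))
        (((u⁻¹ : Kˣ) : K) * x) := by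
    intro x
    by_cases hx : ((u⁻¹ : Kˣ) : K) * x ∈ A
    · rw [Set.indicator_of_mem hx, Set.indicator_of_mem (show x ∈ {x | _ ∈ A} from hx),
        ← mul_assoc, Units.mul_inv, one_mul]
    · rw [Set.indicator_of_notMem hx, Set.indicator_of_notMem (show x ∉ {x | _ ∈ A} from hx)]
  simp_rw [e1]
  rw [h, Units.val_inv_eq_inv_val, localModule_inv, inv_inv]
  have e2 : ∀ y : K, ENNReal.ofReal (localModule ((u : K) * y) ^ a) =
      ENNReal.ofReal (localModule (u : K) ^ a) * ENNReal.ofReal (localModule y ^ a) := by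
    intro y
    rw [localModule_mul, Real.mul_rpow hu.le (localModule_nonneg _),
      ENNReal.ofReal_mul (by positivity)]
  simp_rw [e2]
  rw [lintegral_const_mul _ (measurable_ofReal_localModule_rpow a), ← mul_assoc,
    ← ENNReal.ofReal_mul hu.le, Real.rpow_add hu, Real.rpow_one]

/-- Scaling turns the integrals over the shells `u ^ n A` into a geometric series of ratio `|u| ^ (1
+ a)`. The condition on the ratio covers both `a > -1` near the origin (`|u| < 1`) and `a < -1` near
infinity (`|u| > 1`). -/
theorem lintegral_shells_lt_top (a : ℝ) (u : Kˣ) (hu : localModule (u : K) ^ (1 + a) < 1) (q : ℝ)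
    (hq : 0 < q) :
    ∫⁻ x in ⋃ n : ℕ, {x : K | (((u ^ n)⁻¹ : Kˣ) : K) * x ∈ {y | q < localModule y ∧
      localModule y ≤ 1}}, ENNReal.ofReal (localModule x ^ a) ∂dx < ∞ := by
  have hA : MeasurableSet {y : K | q < localModule y ∧ localModule y ≤ 1} :=
    (measurableSet_lt measurable_const continuous_localModule.measurable).inter
      (measurableSet_le continuous_localModule.measurable measurable_const)
  refine (lintegral_iUnion_le _ _).trans_lt ?_
  have hup := localModule_units_pos u
  have h1 : ∀ n : ℕ, ENNReal.ofReal (localModule ((u ^ n : Kˣ) : K) ^ (1 + a)) =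
      ENNReal.ofReal (localModule (u : K) ^ (1 + a)) ^ n := by
    intro n
    rw [Units.val_pow_eq_pow_val, localModule_pow, ← ENNReal.ofReal_pow (by positivity),
      ← Real.rpow_natCast, ← Real.rpow_natCast, ← Real.rpow_mul hup.le, ← Real.rpow_mul hup.le,
      mul_comm]
  simp_rw [lintegral_scaled_rpow dx a _ _ hA, h1]
  rw [ENNReal.tsum_mul_right, ENNReal.tsum_geometric]
  refine ENNReal.mul_lt_top ?_ ?_
  · rw [ENNReal.inv_lt_top, tsub_pos_iff_lt]
    simpa using hu
  · have hb : ∀ y ∈ {y : K | q < localModule y ∧ localModule y ≤ 1},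
        ENNReal.ofReal (localModule y ^ a) ≤ ENNReal.ofReal (max 1 (q ^ a)) := by
      rintro y ⟨hy1, hy2⟩
      refine ENNReal.ofReal_le_ofReal ?_
      rcases le_total 0 a with h | h
      · exact (Real.rpow_le_one (hq.trans hy1).le hy2 h).trans (le_max_left _ _)
      · exact (Real.rpow_le_rpow_of_nonpos hq hy1.le h).trans (le_max_right _ _)
    refine (setLIntegral_mono measurable_const hb).trans_lt ?_
    rw [setLIntegral_const]
    refine ENNReal.mul_lt_top ENNReal.ofReal_lt_top ?_
    exact (measure_mono fun y hy => hy.2).trans_lt (isCompact_localModule_le 1).measure_lt_top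

/-- The function equal to `|x| ^ a` for `|x| ≤ 1` and to `|x| ^ b` for `|x| > 1`. -/
noncomputable def powerMajorant (a b : ℝ) (x : K) : ℝ :=
  open Classical in if localModule x ≤ 1 then localModule x ^ a else localModule x ^ b

theorem powerMajorant_nonneg (a b : ℝ) (x : K) : 0 ≤ powerMajorant a b x := by
  have := localModule_nonneg x
  unfold powerMajorant
  split_ifs <;> positivity

theorem measurable_powerMajorant (a b : ℝ) : Measurable (powerMajorant a b : K → ℝ) := by
  classical
  unfold powerMajorant
  exact Measurable.ite (measurableSet_le continuous_localModule.measurable measurable_const)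
    (continuous_localModule.measurable.pow_const a) (continuous_localModule.measurable.pow_const b)

theorem integrable_powerMajorant {a b : ℝ} (ha : -1 < a) (hb : b < -1) :
    Integrable (powerMajorant a b) dx := by
  obtain ⟨p, hp0, hp1⟩ := hK.out
  set u : Kˣ := Units.mk0 p hp0 with hu
  set q := localModule p with hq
  have hq0 : 0 < q := localModule_pos hp0
  have hq1 : q < 1 := localModule_lt_one_of_norm_lt_one hp1
  have h1 := lintegral_shells_lt_top dx a u (Real.rpow_lt_one hq0.le hq1 (by linarith)) q hq0
  have h2 := lintegral_shells_lt_top dx b u⁻¹ (by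
    rw [Units.val_inv_eq_inv_val, localModule_inv]
    exact Real.rpow_lt_one_of_one_lt_of_neg ((one_lt_inv₀ hq0).2 hq1) (by linarith)) q hq0
  refine ⟨(measurable_powerMajorant a b).aestronglyMeasurable, ?_⟩
  rw [hasFiniteIntegral_iff_ofReal (.of_forall (powerMajorant_nonneg a b))]
  set S := ⋃ n : ℕ, {x : K | (((u ^ n)⁻¹ : Kˣ) : K) * x ∈ {y | q < localModule y ∧
      localModule y ≤ 1}} with hS
  set S' := ⋃ n : ℕ, {x : K | (((u⁻¹ ^ n)⁻¹ : Kˣ) : K) * x ∈ {y | q < localModule y ∧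
      localModule y ≤ 1}} with hS'
  have hcov : ∀ᵐ x ∂dx, ENNReal.ofReal (powerMajorant a b x) ≤
      S.indicator (fun x => ENNReal.ofReal (localModule x ^ a)) x +
      S'.indicator (fun x => ENNReal.ofReal (localModule x ^ b)) x := by
    filter_upwards [ae_ne_zero_addHaar dx] with x hx
    have hxp := localModule_pos hx
    by_cases hx1 : localModule x ≤ 1
    · obtain ⟨n, hn1, hn2⟩ := exists_nat_pow_near_of_lt_one hxp hx1 hq0 hq1
      have hxS : x ∈ S := by
        refine Set.mem_iUnion.2 ⟨n, ?_⟩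
        simp only [Set.mem_ofPred_eq, localModule_mul, Units.val_inv_eq_inv_val, localModule_inv,
          Units.val_pow_eq_pow_val, localModule_pow, hu, Units.val_mk0, ← hq]
        have hqn : 0 < q ^ n := by positivity
        rw [inv_mul_eq_div, lt_div_iff₀ hqn, div_le_one hqn]
        exact ⟨by rw [← pow_succ']; exact hn1, hn2⟩
      rw [Set.indicator_of_mem hxS, powerMajorant, if_pos hx1]
      exact le_self_add
    · push Not at hx1
      obtain ⟨n, hn1, hn2⟩ := exists_nat_pow_near_of_lt_one (inv_pos.2 hxp)
        (inv_le_one_of_one_le₀ hx1.le) hq0 hq1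
      have hmem : ∀ m : ℕ, q < localModule x * q ^ m → localModule x * q ^ m ≤ 1 → x ∈ S' := by
        intro m h1 h2
        refine Set.mem_iUnion.2 ⟨m, ?_⟩
        simp only [Set.mem_ofPred_eq, localModule_mul,
          Units.val_pow_eq_pow_val, localModule_pow, hu, Units.val_mk0, ← hq, inv_pow, inv_inv]
        rw [mul_comm]
        exact ⟨h1, h2⟩
      have hn1' : localModule x * q ^ (n + 1) < 1 := by
        rwa [lt_inv_comm₀ (by positivity) hxp, ← one_div, lt_div_iff₀ (by positivity)] at hn1
      have hn2' : 1 ≤ localModule x * q ^ n := by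
        rwa [inv_le_comm₀ hxp (by positivity), ← one_div, div_le_iff₀ (by positivity)] at hn2
      -- The inequalities give `|x| q ^ (n + 1) < 1 ≤ |x| q ^ n`, closed at the wrong end for the
      -- shell `q < |y| ≤ 1`: the index is `n` in the case of equality and `n + 1` otherwise.
      have hxS : x ∈ S' := by
        rcases hn2'.eq_or_lt with h | h
        · exact hmem n (h ▸ hq1) h.ge
        · refine hmem (n + 1) ?_ hn1'.le
          rw [pow_succ, ← mul_assoc]
          exact lt_mul_of_one_lt_left hq0 h
      rw [Set.indicator_of_mem hxS, powerMajorant, if_neg (not_le.2 hx1)]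
      exact le_add_self
  refine (lintegral_mono_ae hcov).trans_lt ?_
  have hAm : MeasurableSet {y : K | q < localModule y ∧ localModule y ≤ 1} :=
    (measurableSet_lt measurable_const continuous_localModule.measurable).inter
      (measurableSet_le continuous_localModule.measurable measurable_const)
  have hSm : MeasurableSet S := .iUnion fun n => measurable_const_mul _ hAm
  have hSm' : MeasurableSet S' := .iUnion fun n => measurable_const_mul _ hAm
  rw [lintegral_add_left ((measurable_ofReal_localModule_rpow a).indicator hSm),
    lintegral_indicator hSm, lintegral_indicator hSm']
  exact ENNReal.add_lt_top.2 ⟨h1, h2⟩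

theorem abs_log_le_rpow_of_le_one {u ε : ℝ} (hu : 0 < u) (hu1 : u ≤ 1) (hε : 0 < ε) :
    |Real.log u| ≤ ε⁻¹ * u ^ (-ε) := by
  have h := (Real.abs_log_mul_self_rpow_lt u ε hu hu1 hε).le
  have hp : 0 < u ^ ε := Real.rpow_pos_of_pos hu ε
  rw [abs_mul, abs_of_pos hp] at h
  rw [Real.rpow_neg hu.le, ← div_eq_mul_inv, le_div_iff₀ hp, ← one_div]
  exact h

theorem abs_log_le_self_of_one_le {u : ℝ} (hu : 1 ≤ u) : |Real.log u| ≤ u := by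
  rw [abs_of_nonneg (Real.log_nonneg hu)]
  exact (Real.log_le_sub_one_of_pos (by linarith)).trans (by linarith)

/-- Rapidly decaying functions: continuous with `|φ(x)| ≤ C (1 + |x|)⁻³`. -/
def IsModerate (φ : K → ℂ) : Prop :=
  Continuous φ ∧ ∃ C : ℝ, 0 ≤ C ∧ ∀ x, ‖φ x‖ ≤ C * ((1 + localModule x) ^ 3)⁻¹

theorem IsModerate.exists_bound {φ : K → ℂ} (h : IsModerate φ) :
    ∃ C : ℝ, 0 ≤ C ∧ (∀ x, ‖φ x‖ ≤ C) ∧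
      ∀ x, 1 < localModule x → ‖φ x‖ ≤ C * localModule x ^ (-3 : ℝ) := by
  obtain ⟨-, C, hC, hb⟩ := h
  refine ⟨C, hC, fun x => (hb x).trans ?_, fun x hx => (hb x).trans ?_⟩
  · refine mul_le_of_le_one_right hC (inv_le_one_of_one_le₀ ?_)
    exact one_le_pow₀ (by linarith [localModule_nonneg x])
  · refine mul_le_mul_of_nonneg_left ?_ hC
    rw [Real.rpow_neg (localModule_nonneg x)]
    have : localModule x ^ (3 : ℝ) = localModule x ^ (3 : ℕ) := by exact_mod_cast Real.rpow_natCast _ 3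
    rw [this]
    have hx0 : 0 < localModule x := by linarith
    gcongr
    linarith

/-- Pointwise domination of `φ(x) |x| ^ (σ - 1)`, with or without a logarithm. -/
theorem IsModerate.exists_majorant {φ : K → ℂ} (h : IsModerate φ) {σ₀ : ℝ} (h0 : 0 < σ₀) :
    ∃ C : ℝ, ∃ a : ℝ, -1 < a ∧ ∀ x : K, x ≠ 0 → ∀ σ, σ₀ ≤ σ → σ ≤ 1 →
      ‖φ x‖ * localModule x ^ (σ - 1) ≤ C * powerMajorant a (-2) x ∧
      ‖φ x‖ * (|Real.log (localModule x)| * localModule x ^ (σ - 1)) ≤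
        C * powerMajorant a (-2) x := by
  obtain ⟨C, hC, hb1, hb2⟩ := h.exists_bound
  -- Near the origin half of `σ₀` absorbs the logarithm, at the cost of the constant `(σ₀ / 2)⁻¹`,
  -- and the other half ensures integrability. Near infinity the logarithm is bounded by one factor
  -- `|x|`, which lowers the decay from order 3 to order 2.
  refine ⟨C * (1 + (σ₀ / 2)⁻¹), σ₀ / 2 - 1, by linarith, fun x hx σ hσ hσ1 => ?_⟩
  have hxp := localModule_pos hx
  have hi : 0 < (σ₀ / 2)⁻¹ := by positivity
  by_cases hx1 : localModule x ≤ 1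
  · rw [powerMajorant, if_pos hx1]
    have e1 : localModule x ^ (σ - 1) ≤ localModule x ^ (σ₀ / 2 - 1) :=
      Real.rpow_le_rpow_of_exponent_ge hxp hx1 (by linarith)
    have e2 : |Real.log (localModule x)| * localModule x ^ (σ - 1) ≤
        (σ₀ / 2)⁻¹ * localModule x ^ (σ₀ / 2 - 1) := by
      calc _ ≤ (σ₀ / 2)⁻¹ * localModule x ^ (-(σ₀ / 2)) * localModule x ^ (σ₀ - 1) := by
            refine mul_le_mul (abs_log_le_rpow_of_le_one hxp hx1 (by linarith))
              (Real.rpow_le_rpow_of_exponent_ge hxp hx1 (by linarith)) (by positivity)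
              (by positivity)
        _ = _ := by
            rw [mul_assoc, ← Real.rpow_add hxp]
            congr 2
            ring
    constructor
    · calc _ ≤ C * localModule x ^ (σ₀ / 2 - 1) :=
            mul_le_mul (hb1 x) e1 (by positivity) hC
        _ ≤ _ := by
            rw [mul_assoc]
            refine mul_le_mul_of_nonneg_left ?_ hC
            refine le_mul_of_one_le_left (by positivity) (by linarith)
    · calc _ ≤ C * ((σ₀ / 2)⁻¹ * localModule x ^ (σ₀ / 2 - 1)) :=
            mul_le_mul (hb1 x) e2 (by positivity) hC
        _ ≤ _ := by
            rw [mul_assoc]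
            refine mul_le_mul_of_nonneg_left ?_ hC
            refine mul_le_mul_of_nonneg_right (by linarith) (by positivity)
  · have hx1' := not_le.1 hx1
    rw [powerMajorant, if_neg hx1]
    have e1 : localModule x ^ (σ - 1) ≤ 1 :=
      Real.rpow_le_one_of_one_le_of_nonpos hx1'.le (by linarith)
    have e2 : |Real.log (localModule x)| * localModule x ^ (σ - 1) ≤ localModule x := by
      calc _ ≤ localModule x * 1 := mul_le_mul (abs_log_le_self_of_one_le hx1'.le) e1
            (by positivity) hxp.le
        _ = _ := mul_one _
    have e3 : localModule x ^ (-3 : ℝ) * localModule x = localModule x ^ (-2 : ℝ) := by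
      nth_rw 2 [← Real.rpow_one (localModule x)]
      rw [← Real.rpow_add hxp]
      norm_num
    have key : C * localModule x ^ (-2 : ℝ) ≤
        C * (1 + (σ₀ / 2)⁻¹) * localModule x ^ (-2 : ℝ) := by
      refine mul_le_mul_of_nonneg_right ?_ (by positivity)
      exact le_mul_of_one_le_right hC (by linarith)
    constructor
    · refine le_trans ?_ key
      calc _ ≤ C * localModule x ^ (-3 : ℝ) * localModule x :=
            mul_le_mul (hb2 x hx1') (e1.trans hx1'.le) (by positivity) (by positivity)
        _ = _ := by rw [mul_assoc, e3]
    · refine le_trans ?_ key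
      calc _ ≤ C * localModule x ^ (-3 : ℝ) * localModule x :=
            mul_le_mul (hb2 x hx1') e2 (by positivity) (by positivity)
        _ = _ := by rw [mul_assoc, e3]

theorem IsModerate.integrable {φ : K → ℂ} (h : IsModerate φ) : Integrable φ dx := by
  obtain ⟨C, a, ha, hb⟩ := h.exists_majorant one_pos
  refine Integrable.mono' ((integrable_powerMajorant dx ha (by norm_num : (-2 : ℝ) < -1)).const_mul C)
    h.1.aestronglyMeasurable ?_
  filter_upwards [ae_ne_zero_addHaar dx] with x hx
  simpa using (hb x hx 1 le_rfl le_rfl).1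

theorem IsModerate.memLp {φ : K → ℂ} (h : IsModerate φ) : MemLp φ 2 dx := by
  obtain ⟨C, hC, hb1, -⟩ := h.exists_bound
  exact memLp_two_of_integrable_of_bounded (h.integrable dx) (.of_forall hb1)

theorem IsModerate.integrable_log_mul {φ : K → ℂ} (h : IsModerate φ) :
    Integrable (fun x => (Real.log (localModule x) : ℂ) * φ x) dx := by
  obtain ⟨C, a, ha, hb⟩ := h.exists_majorant one_pos
  refine Integrable.mono' ((integrable_powerMajorant dx ha (by norm_num : (-2 : ℝ) < -1)).const_mul C)
    ((Complex.measurable_ofReal.comp (Real.measurable_log.comp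
      continuous_localModule.measurable)).aestronglyMeasurable.mul h.1.aestronglyMeasurable) ?_
  filter_upwards [ae_ne_zero_addHaar dx] with x hx
  have := (hb x hx 1 le_rfl le_rfl).2
  rw [norm_mul, Complex.norm_real, Real.norm_eq_abs, mul_comm]
  simpa using this

theorem IsModerate.memLp_log_mul {φ : K → ℂ} (h : IsModerate φ) :
    MemLp (fun x => (Real.log (localModule x) : ℂ) * φ x) 2 dx := by
  have hm : AEStronglyMeasurable (fun x => (Real.log (localModule x) : ℂ) * φ x) dx :=
    (Complex.measurable_ofReal.comp (Real.measurable_log.comp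
      continuous_localModule.measurable)).aestronglyMeasurable.mul h.1.aestronglyMeasurable
  obtain ⟨C, hC, hb1, hb2⟩ := h.exists_bound
  rw [memLp_two_iff_integrable_sq_norm hm]
  -- Near the origin `|log u| ≤ 4 u ^ (-1/4)` is squared, whence the constant 16 and the exponent
  -- `-1/2`.
  refine Integrable.mono' ((integrable_powerMajorant dx (by norm_num : (-1 : ℝ) < -1/2)
    (by norm_num : (-2 : ℝ) < -1)).const_mul (16 * C ^ 2)) (hm.norm.pow 2) ?_
  filter_upwards [ae_ne_zero_addHaar dx] with x hx
  have hxp := localModule_pos hx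
  rw [norm_pow, norm_norm, norm_mul, Complex.norm_real, Real.norm_eq_abs]
  by_cases hx1 : localModule x ≤ 1
  · rw [powerMajorant, if_pos hx1]
    have e1 := abs_log_le_rpow_of_le_one hxp hx1 (by norm_num : (0 : ℝ) < 1/4)
    calc (|Real.log (localModule x)| * ‖φ x‖) ^ 2
        ≤ ((1/4 : ℝ)⁻¹ * localModule x ^ (-(1/4) : ℝ) * C) ^ 2 :=
          pow_le_pow_left₀ (by positivity) (mul_le_mul e1 (hb1 x) (norm_nonneg _)
            (by positivity)) 2
      _ = 16 * C ^ 2 * (localModule x ^ (-(1/4) : ℝ) * localModule x ^ (-(1/4) : ℝ)) := by ring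
      _ = _ := by
          rw [← Real.rpow_add hxp]
          norm_num
  · have hx1' := not_le.1 hx1
    rw [powerMajorant, if_neg hx1]
    have e3 : localModule x * localModule x ^ (-3 : ℝ) = localModule x ^ (-2 : ℝ) := by
      nth_rw 1 [← Real.rpow_one (localModule x)]
      rw [← Real.rpow_add hxp]
      norm_num
    have e4 : localModule x ^ (-2 : ℝ) ≤ 1 :=
      Real.rpow_le_one_of_one_le_of_nonpos hx1'.le (by norm_num)
    calc (|Real.log (localModule x)| * ‖φ x‖) ^ 2
        ≤ (localModule x * (C * localModule x ^ (-3 : ℝ))) ^ 2 :=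
          pow_le_pow_left₀ (by positivity) (mul_le_mul (abs_log_le_self_of_one_le hx1'.le)
            (hb2 x hx1') (norm_nonneg _) (by positivity)) 2
      _ = C ^ 2 * (localModule x ^ (-2 : ℝ) * localModule x ^ (-2 : ℝ)) := by
          rw [← e3]; ring
      _ ≤ C ^ 2 * (localModule x ^ (-2 : ℝ) * 1) := by gcongr
      _ ≤ _ := by
          have : 0 ≤ C ^ 2 * localModule x ^ (-2 : ℝ) := by positivity
          nlinarith

end Majorant

/-! ### Quasi-characters and zeta integrals. -/

section QuasiCharacter

variable {K : Type*} [NormedField K] [ProperSpace K] [hK : Fact (∃ p : K, p ≠ 0 ∧ ‖p‖ < 1)]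

theorem charAt_zero (χ : PontryaginDual Kˣ) : charAt χ (0 : K) = 0 := by simp [charAt]

theorem charAt_units (χ : PontryaginDual Kˣ) (t : Kˣ) : charAt χ (t : K) = (χ t : Circle) := by
  simp [charAt]

theorem charAt_mul (χ : PontryaginDual Kˣ) (x y : K) :
    charAt χ (x * y) = charAt χ x * charAt χ y := by
  by_cases hx : x = 0
  · simp [hx, charAt_zero]
  by_cases hy : y = 0
  · simp [hy, charAt_zero]
  have := charAt_units χ (Units.mk0 x hx * Units.mk0 y hy)
  rw [map_mul, Circle.coe_mul, ← charAt_units, ← charAt_units] at this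
  simpa using this

theorem charAt_one (χ : PontryaginDual Kˣ) : charAt χ (1 : K) = 1 := by
  have := charAt_units χ 1
  simpa using this

theorem norm_charAt (χ : PontryaginDual Kˣ) {x : K} (hx : x ≠ 0) : ‖charAt χ x‖ = 1 := by
  have := charAt_units χ (Units.mk0 x hx)
  rw [Units.val_mk0] at this
  rw [this, Circle.norm_coe]

theorem charAt_inv (χ : PontryaginDual Kˣ) (x : K) :
    charAt χ⁻¹ x = (starRingEnd ℂ) (charAt χ x) := by
  by_cases hx : x = 0
  · simp [hx, charAt_zero]
  have h1 := charAt_units χ⁻¹ (Units.mk0 x hx)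
  have h2 := charAt_units χ (Units.mk0 x hx)
  rw [Units.val_mk0] at h1 h2
  rw [h1, h2, ← Circle.coe_inv_eq_conj]
  rfl

theorem charAt_mul_charAt_inv (χ : PontryaginDual Kˣ) {x : K} (hx : x ≠ 0) :
    charAt χ x * charAt χ⁻¹ x = 1 := by
  rw [charAt_inv, Complex.mul_conj, Complex.normSq_eq_norm_sq, norm_charAt χ hx]
  norm_num

theorem continuousAt_charAt (χ : PontryaginDual Kˣ) {x : K} (hx : x ≠ 0) :
    ContinuousAt (charAt χ) x := by
  have h := (Units.isOpenEmbedding_val (R := K)).continuousAt_iff (g := charAt χ)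
    (x := Units.mk0 x hx)
  rw [Units.val_mk0] at h
  rw [← h]
  have : charAt χ ∘ Units.val = fun t : Kˣ => ((χ t : Circle) : ℂ) := by
    ext t
    exact charAt_units χ t
  rw [this]
  exact (continuous_circle_coe.comp (map_continuous χ)).continuousAt

/-- The quasi-character `χ(x) |x| ^ (s - 1)`. -/
noncomputable def quasiChar (χ : PontryaginDual Kˣ) (s : ℂ) (x : K) : ℂ :=
  charAt χ x * (localModule x : ℂ) ^ (s - 1)

theorem quasiChar_mul (χ : PontryaginDual Kˣ) (s : ℂ) (x y : K) :
    quasiChar χ s (x * y) = quasiChar χ s x * quasiChar χ s y := by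
  unfold quasiChar
  rw [charAt_mul, localModule_mul, Complex.ofReal_mul,
    Complex.mul_cpow_ofReal_nonneg (localModule_nonneg x) (localModule_nonneg y)]
  ring

theorem norm_quasiChar (χ : PontryaginDual Kˣ) (s : ℂ) {x : K} (hx : x ≠ 0) :
    ‖quasiChar χ s x‖ = localModule x ^ (s.re - 1) := by
  rw [quasiChar, norm_mul, norm_charAt χ hx, one_mul,
    Complex.norm_cpow_eq_rpow_re_of_pos (localModule_pos hx)]
  simp

theorem quasiChar_mul_quasiChar_inv (χ : PontryaginDual Kˣ) (s : ℂ) {x : K} (hx : x ≠ 0) :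
    quasiChar χ s x * quasiChar χ⁻¹ (1 - s) x * localModule x = 1 := by
  have hm : (localModule x : ℂ) ≠ 0 := by exact_mod_cast (localModule_pos hx).ne'
  calc quasiChar χ s x * quasiChar χ⁻¹ (1 - s) x * localModule x
      = (charAt χ x * charAt χ⁻¹ x) * ((localModule x : ℂ) ^ (s - 1) *
        (localModule x : ℂ) ^ (1 - s - 1) * (localModule x : ℂ) ^ (1 : ℂ)) := by
        rw [Complex.cpow_one]; unfold quasiChar; ring
    _ = 1 := by
        rw [charAt_mul_charAt_inv χ hx, ← Complex.cpow_add _ _ hm, ← Complex.cpow_add _ _ hm]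
        ring_nf
        simp

theorem conj_quasiChar (χ : PontryaginDual Kˣ) (s : ℂ) (x : K) :
    (starRingEnd ℂ) (quasiChar χ s x) = quasiChar χ⁻¹ ((starRingEnd ℂ) s) x := by
  by_cases hx : x = 0
  · simp [hx, quasiChar, charAt_zero]
  have hm := localModule_pos hx
  have h1 : (starRingEnd ℂ) ((localModule x : ℂ) ^ (s - 1)) =
      (localModule x : ℂ) ^ ((starRingEnd ℂ) s - 1) := by
    have h2 : (starRingEnd ℂ) s - 1 = (starRingEnd ℂ) (s - 1) := by simp
    rw [h2, Complex.cpow_conj _ _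
      (by rw [Complex.arg_ofReal_of_nonneg hm.le]; exact Real.pi_pos.ne), Complex.conj_ofReal]
  rw [quasiChar, quasiChar, map_mul, charAt_inv, h1]

variable [MeasurableSpace K] [BorelSpace K]

theorem measurable_charAt (χ : PontryaginDual Kˣ) : Measurable (charAt χ : K → ℂ) := by
  refine measurable_of_continuousOn_compl_singleton 0 fun x hx => ?_
  exact (continuousAt_charAt χ hx).continuousWithinAt

theorem measurable_quasiChar (χ : PontryaginDual Kˣ) (s : ℂ) :
    Measurable (quasiChar χ s : K → ℂ) :=
  (measurable_charAt χ).mul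
    ((Complex.measurable_ofReal.comp continuous_localModule.measurable).pow_const _)

variable (dx : Measure K) [dx.IsAddHaarMeasure]

/-- The zeta integral `∫ φ(x) χ(x) |x| ^ (s - 1) dx`. -/
noncomputable def zetaIntegral (φ : K → ℂ) (χ : PontryaginDual Kˣ) (s : ℂ) : ℂ :=
  ∫ x, φ x * quasiChar χ s x ∂dx

/-- The zeta integral with an additional factor `log |x|`. -/
noncomputable def zetaLogIntegral (φ : K → ℂ) (χ : PontryaginDual Kˣ) (s : ℂ) : ℂ :=
  ∫ x, φ x * (quasiChar χ s x * (Real.log (localModule x) : ℂ)) ∂dx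

theorem measurable_log_localModule :
    Measurable fun x : K => (Real.log (localModule x) : ℂ) :=
  Complex.measurable_ofReal.comp (Real.measurable_log.comp continuous_localModule.measurable)

theorem IsModerate.integrable_zeta {φ : K → ℂ} (h : IsModerate φ) (χ : PontryaginDual Kˣ) {s : ℂ}
    (hs : 0 < s.re) (hs1 : s.re ≤ 1) : Integrable (fun x => φ x * quasiChar χ s x) dx := by
  obtain ⟨C, a, ha, hb⟩ := h.exists_majorant hs
  refine Integrable.mono' ((integrable_powerMajorant dx ha (by norm_num : (-2 : ℝ) < -1)).const_mul C)
    (h.1.measurable.mul (measurable_quasiChar χ s)).aestronglyMeasurable ?_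
  filter_upwards [ae_ne_zero_addHaar dx] with x hx
  rw [norm_mul, norm_quasiChar χ s hx]
  exact (hb x hx _ le_rfl hs1).1

theorem IsModerate.integrable_zetaLog {φ : K → ℂ} (h : IsModerate φ) (χ : PontryaginDual Kˣ)
    {s : ℂ} (hs : 0 < s.re) (hs1 : s.re ≤ 1) :
    Integrable (fun x => φ x * (quasiChar χ s x * (Real.log (localModule x) : ℂ))) dx := by
  obtain ⟨C, a, ha, hb⟩ := h.exists_majorant hs
  refine Integrable.mono' ((integrable_powerMajorant dx ha (by norm_num : (-2 : ℝ) < -1)).const_mul C)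
    (h.1.measurable.mul ((measurable_quasiChar χ s).mul
      measurable_log_localModule)).aestronglyMeasurable ?_
  filter_upwards [ae_ne_zero_addHaar dx] with x hx
  rw [norm_mul, norm_mul, norm_quasiChar χ s hx, Complex.norm_real, Real.norm_eq_abs,
    mul_comm (localModule x ^ _)]
  exact (hb x hx _ le_rfl hs1).2

/-- Differentiation under the integral sign; one majorant serves the neighborhood `Re s / 2 < Re z <
1` of `s`. -/
theorem IsModerate.hasDerivAt_zeta {φ : K → ℂ} (h : IsModerate φ) (χ : PontryaginDual Kˣ) {s : ℂ}
    (hs : 0 < s.re) (hs1 : s.re < 1) :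
    HasDerivAt (zetaIntegral dx φ χ) (zetaLogIntegral dx φ χ s) s := by
  obtain ⟨C, a, ha, hb⟩ := h.exists_majorant (half_pos hs)
  have hU : {z : ℂ | s.re / 2 < z.re ∧ z.re < 1} ∈ nhds s :=
    ((isOpen_lt continuous_const Complex.continuous_re).inter
      (isOpen_lt Complex.continuous_re continuous_const)).mem_nhds ⟨half_lt_self hs, hs1⟩
  refine (hasDerivAt_integral_of_dominated_loc_of_deriv_le hU
    (F := fun z x => φ x * quasiChar χ z x)
    (F' := fun z x => φ x * (quasiChar χ z x * (Real.log (localModule x) : ℂ)))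
    (bound := fun x => C * powerMajorant a (-2) x)
    (.of_forall fun z => (h.1.measurable.mul (measurable_quasiChar χ z)).aestronglyMeasurable)
    (h.integrable_zeta dx χ hs hs1.le) (h.integrable_zetaLog dx χ hs hs1.le).1 ?_
    ((integrable_powerMajorant dx ha (by norm_num : (-2 : ℝ) < -1)).const_mul C) ?_).2
  · filter_upwards [ae_ne_zero_addHaar dx] with x hx z hz
    rw [norm_mul, norm_mul, norm_quasiChar χ z hx, Complex.norm_real, Real.norm_eq_abs,
      mul_comm (localModule x ^ _)]
    exact (hb x hx _ hz.1.le hz.2.le).2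
  · filter_upwards [ae_ne_zero_addHaar dx] with x hx z _
    have hm : (localModule x : ℂ) ≠ 0 := by exact_mod_cast (localModule_pos hx).ne'
    have h1 : HasDerivAt (fun z : ℂ => (localModule x : ℂ) ^ (z - 1))
        ((localModule x : ℂ) ^ (z - 1) * Complex.log (localModule x) * 1) z :=
      ((hasDerivAt_id z).sub_const 1).const_cpow (Or.inl hm)
    rw [mul_one, ← Complex.ofReal_log (localModule_nonneg x)] at h1
    have h2 := (h1.const_mul (charAt χ x)).const_mul (φ x)
    convert! h2 using 1
    unfold quasiChar
    ring

/-- Fubini and a change of variables for `(y, u) ↦ a(y) |y| g(yu)`. -/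
theorem integrable_prod_scaled {a g : K → ℂ} (ha : Integrable a dx) (ham : Measurable a)
    (hg : Integrable g dx) (hgm : Measurable g) :
    Integrable (fun p : K × K => a p.1 * (localModule p.1 * g (p.1 * p.2))) (dx.prod dx) := by
  have hm : Measurable (fun p : K × K => a p.1 * (localModule p.1 * g (p.1 * p.2))) :=
    (ham.comp measurable_fst).mul ((Complex.measurable_ofReal.comp
      (continuous_localModule.measurable.comp measurable_fst)).mul
      (hgm.comp (measurable_fst.mul measurable_snd)))
  rw [integrable_prod_iff hm.aestronglyMeasurable]
  constructor
  · filter_upwards [ae_ne_zero_addHaar dx] with y hy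
    exact (((integrable_comp_mul_addHaar dx (Units.mk0 y hy) g).2 hg).const_mul _).const_mul _
  · refine (ha.norm.mul_const (∫ u, ‖g u‖ ∂dx)).congr ?_
    filter_upwards [ae_ne_zero_addHaar dx] with y hy
    have h1 := integral_comp_mul_addHaar dx (Units.mk0 y hy) (fun u => ‖g u‖)
    simp only [Units.val_mk0, smul_eq_mul] at h1
    simp only [norm_mul, Complex.norm_real, Real.norm_eq_abs, abs_of_pos (localModule_pos hy)]
    rw [integral_const_mul, integral_const_mul, h1, mul_inv_cancel_left₀ (localModule_pos hy).ne']

theorem integral_integral_scaled {a g : K → ℂ} :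
    ∫ y, ∫ u, a y * (localModule y * g (y * u)) ∂dx ∂dx = (∫ y, a y ∂dx) * ∫ u, g u ∂dx := by
  rw [← integral_mul_const]
  refine integral_congr_ae ?_
  filter_upwards [ae_ne_zero_addHaar dx] with y hy
  have h1 := integral_comp_mul_addHaar dx (Units.mk0 y hy) g
  have hm : (localModule y : ℂ) ≠ 0 := by exact_mod_cast (localModule_pos hy).ne'
  simp only [Units.val_mk0, Complex.real_smul, Complex.ofReal_inv] at h1
  rw [integral_const_mul, integral_const_mul, h1, mul_inv_cancel_left₀ hm]

end QuasiCharacter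

/-! ### The local functional equation and the Gamma function. -/

section Tate

variable {K : Type*} [NormedField K] [ProperSpace K] [hK : Fact (∃ p : K, p ≠ 0 ∧ ‖p‖ < 1)]
variable [MeasurableSpace K] [BorelSpace K]

/-- The properties of the additive character and of Schwartz-Bruhat functions on which the
harmonic analysis of a local field rests. -/
structure LocalPlace.Regular (v : LocalPlace K) : Prop where
  char_add : ∀ x y, basicChar v (x + y) = basicChar v x * basicChar v y
  norm_char : ∀ x, ‖basicChar v x‖ = 1
  continuous_char : Continuous (basicChar v)
  moderate : ∀ φ, IsSchwartzBruhat v φ → IsModerate φ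
  add : ∀ φ ψ, IsSchwartzBruhat v φ → IsSchwartzBruhat v ψ → IsSchwartzBruhat v (φ + ψ)
  smul : ∀ (c : ℂ) (φ), IsSchwartzBruhat v φ → IsSchwartzBruhat v (c • φ)
  conj : ∀ φ, IsSchwartzBruhat v φ → IsSchwartzBruhat v (fun x => (starRingEnd ℂ) (φ x))
  neg : ∀ φ, IsSchwartzBruhat v φ → IsSchwartzBruhat v (fun x => φ (-x))
  fourier : ∀ (dx : Measure K) [dx.IsAddHaarMeasure] (φ), IsSchwartzBruhat v φ →
    IsSchwartzBruhat v (addFourier v dx φ)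
  bump : ∀ U ∈ nhds (1 : K), ∃ r : K → ℝ, IsSchwartzBruhat v (fun x => (r x : ℂ)) ∧
    Continuous r ∧ (∀ x, 0 ≤ r x) ∧ (∀ x ∉ U, r x = 0) ∧ r 1 ≠ 0
  ae_eq_zero : ∀ (dx : Measure K) [dx.IsAddHaarMeasure] (h : K → ℂ), LocallyIntegrable h dx →
    (∀ φ, IsSchwartzBruhat v φ → ∫ x, h x * φ x ∂dx = 0) → h =ᵐ[dx] 0
  inversion : ∀ φ, IsSchwartzBruhatZero v φ → IsSchwartzBruhatZero v (inversionFun φ)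

variable {v : LocalPlace K} (hv : v.Regular)

include hv in
theorem basicChar_neg (x : K) : basicChar v (-x) = (starRingEnd ℂ) (basicChar v x) := by
  have h0 : basicChar v 0 = 1 := by
    have h := hv.char_add 0 0
    rw [add_zero] at h
    have hne : basicChar v 0 ≠ 0 := norm_ne_zero_iff.1 (by rw [hv.norm_char]; norm_num)
    exact (mul_eq_left₀ hne).1 h.symm
  have h := hv.char_add x (-x)
  rw [add_neg_cancel, h0] at h
  have h2 : basicChar v x * (starRingEnd ℂ) (basicChar v x) = 1 := by
    rw [Complex.mul_conj, Complex.normSq_eq_norm_sq, hv.norm_char]; norm_num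
  have hne : basicChar v x ≠ 0 := norm_ne_zero_iff.1 (by rw [hv.norm_char]; norm_num)
  exact mul_left_cancel₀ hne (h.symm.trans h2.symm)

variable (dx : Measure K)

theorem addFourierInv_eq (φ : K → ℂ) (y : K) :
    addFourierInv v dx φ y = addFourier v dx φ (-y) := by
  simp [addFourierInv, addFourier]

variable [dx.IsAddHaarMeasure]

include hv in
theorem integrable_mul_basicChar {φ : K → ℂ} (hφ : Integrable φ dx) (y : K) :
    Integrable (fun x => φ x * basicChar v (-(y * x))) dx :=
  hφ.mul_bdd (c := 1) (hv.continuous_char.comp (by fun_prop)).aestronglyMeasurable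
    (.of_forall fun _ => (hv.norm_char _).le)

include hv in
/-- `∫ ψ(y) φ^(yu) dy` is symmetric in `φ` and `ψ`. -/
theorem integral_mul_addFourier_comm {φ ψ : K → ℂ} (hφ : Integrable φ dx) (hψ : Integrable ψ dx)
    (u : K) :
    ∫ y, ψ y * addFourier v dx φ (y * u) ∂dx = ∫ y, φ y * addFourier v dx ψ (y * u) ∂dx := by
  simp_rw [addFourier, ← integral_const_mul]
  rw [integral_integral_swap]
  · congr 1
    ext x
    congr 1
    ext y
    rw [show x * u * y = y * u * x by ring]
    ring
  · have : Function.uncurry (fun y x => ψ y * (φ x * basicChar v (-(y * u * x)))) =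
        fun p : K × K => (ψ p.1 * φ p.2) * basicChar v (-(p.1 * u * p.2)) := by
      ext p
      simp [Function.uncurry, mul_assoc]
    rw [this]
    exact (hψ.mul_prod hφ).mul_bdd (c := 1)
      (hv.continuous_char.comp (by fun_prop)).aestronglyMeasurable
      (.of_forall fun _ => (hv.norm_char _).le)

include hv in
/-- The symmetry behind the functional equation. -/
theorem zeta_mul_zeta_eq {φ ψ : K → ℂ} (hφ : IsSchwartzBruhat v φ) (hψ : IsSchwartzBruhat v ψ)
    (χ : PontryaginDual Kˣ) {s : ℂ} (hs : 0 < s.re) (hs1 : s.re < 1) :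
    zetaIntegral dx ψ χ⁻¹ (1 - s) * zetaIntegral dx (addFourier v dx φ) χ s =
      ∫ u, quasiChar χ s u * ∫ y, ψ y * addFourier v dx φ (y * u) ∂dx ∂dx := by
  have hψm := hv.moderate ψ hψ
  have hφm := hv.moderate _ (hv.fourier dx φ hφ)
  have hs' : 0 < (1 - s).re := by simpa using hs1
  have hs1' : (1 - s).re ≤ 1 := by simpa using hs.le
  have ha := hψm.integrable_zeta dx χ⁻¹ hs' hs1'
  have hg := hφm.integrable_zeta dx χ hs hs1.le
  have ham : Measurable fun x => ψ x * quasiChar χ⁻¹ (1 - s) x :=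
    hψm.1.measurable.mul (measurable_quasiChar _ _)
  have hgm : Measurable fun x => addFourier v dx φ x * quasiChar χ s x :=
    hφm.1.measurable.mul (measurable_quasiChar _ _)
  have hp := integrable_prod_scaled dx ha ham hg hgm
  unfold zetaIntegral
  rw [← integral_integral_scaled dx (a := fun x => ψ x * quasiChar χ⁻¹ (1 - s) x)
    (g := fun x => addFourier v dx φ x * quasiChar χ s x), integral_integral_swap hp]
  congr 1
  ext u
  rw [← integral_const_mul]
  refine integral_congr_ae ?_
  filter_upwards [ae_ne_zero_addHaar dx] with y hy
  -- With `yu` as the variable of the second zeta integral, the quasi-characters in `y` multiply to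
  -- `|y|⁻¹`, which cancels the Jacobian `|y|`.
  have h := quasiChar_mul_quasiChar_inv χ s hy
  rw [quasiChar_mul]
  linear_combination (ψ y * addFourier v dx φ (y * u) * quasiChar χ s u) * h

include hv in
theorem zeta_mul_zeta_comm {φ ψ : K → ℂ} (hφ : IsSchwartzBruhat v φ) (hψ : IsSchwartzBruhat v ψ)
    (χ : PontryaginDual Kˣ) {s : ℂ} (hs : 0 < s.re) (hs1 : s.re < 1) :
    zetaIntegral dx ψ χ⁻¹ (1 - s) * zetaIntegral dx (addFourier v dx φ) χ s =
      zetaIntegral dx φ χ⁻¹ (1 - s) * zetaIntegral dx (addFourier v dx ψ) χ s := by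
  rw [zeta_mul_zeta_eq hv dx hφ hψ χ hs hs1, zeta_mul_zeta_eq hv dx hψ hφ χ hs hs1]
  congr 1
  ext u
  rw [integral_mul_addFourier_comm hv dx ((hv.moderate φ hφ).integrable dx)
    ((hv.moderate ψ hψ).integrable dx)]

include hv in
-- The quasi-character is continuous at `1` with value `1`; against a nonnegative bump living where
-- its real part is positive, the integral has positive real part.
theorem exists_zeta_ne_zero (χ : PontryaginDual Kˣ) {s : ℂ} (hs : 0 < s.re) (hs1 : s.re < 1) :
    ∃ ψ, IsSchwartzBruhat v ψ ∧ zetaIntegral dx ψ χ s ≠ 0 := by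
  have hc : ContinuousAt (fun x : K => (quasiChar χ s x).re) 1 := by
    refine Complex.continuous_re.continuousAt.comp ?_
    have h1 := continuousAt_charAt χ (one_ne_zero (α := K))
    have h2 : ContinuousAt (fun x : K => (localModule x : ℂ) ^ (s - 1)) 1 := by
      refine ContinuousAt.cpow (Complex.continuous_ofReal.comp continuous_localModule).continuousAt
        continuousAt_const ?_
      simp [localModule_one]
    exact h1.mul h2
  have h1 : (quasiChar χ s (1 : K)).re = 1 := by
    simp [quasiChar, charAt_one, localModule_one]
  have hU : {x : K | 0 < (quasiChar χ s x).re} ∈ nhds (1 : K) :=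
    hc.eventually (lt_mem_nhds (by
      change 0 < (quasiChar χ s (1 : K)).re
      rw [h1]; exact one_pos))
  obtain ⟨r, hr, hrc, hr0, hrU, hr1⟩ := hv.bump _ hU
  refine ⟨_, hr, fun h => ?_⟩
  have hi := (hv.moderate _ hr).integrable_zeta dx χ hs hs1.le
  have h2 : ∫ x, r x * (quasiChar χ s x).re ∂dx = 0 := by
    have := congrArg Complex.re h
    rw [zetaIntegral, ← RCLike.re_eq_complex_re, ← integral_re hi] at this
    simpa using this
  have hnn : ∀ x, 0 ≤ r x * (quasiChar χ s x).re := by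
    intro x
    by_cases hx : x ∈ {x : K | 0 < (quasiChar χ s x).re}
    · exact mul_nonneg (hr0 x) (le_of_lt hx)
    · rw [hrU x hx, zero_mul]
  have hi' : Integrable (fun x => r x * (quasiChar χ s x).re) dx := by
    have := hi.re
    simpa using this
  rw [integral_eq_zero_iff_of_nonneg hnn hi'] at h2
  have hV : {x : K | r x ≠ 0} ∈ nhds (1 : K) := hrc.continuousAt.eventually_ne hr1
  have hpos : 0 < dx ({x : K | r x ≠ 0} ∩ {x : K | 0 < (quasiChar χ s x).re}) :=
    Measure.measure_pos_of_mem_nhds dx (Filter.inter_mem hV hU)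
  refine hpos.ne' (measure_mono_null ?_ h2)
  rintro x ⟨hx1, hx2⟩
  exact mul_ne_zero hx1 (ne_of_gt hx2)

theorem isTateGamma_iff (χ : PontryaginDual Kˣ) (s c : ℂ) :
    IsTateGamma v dx χ s c ↔ ∀ φ, IsSchwartzBruhat v φ →
      zetaIntegral dx (addFourier v dx φ) χ s = c * zetaIntegral dx φ χ⁻¹ (1 - s) := by
  unfold IsTateGamma zetaIntegral quasiChar
  have : (1 : ℂ) - s - 1 = -s := by ring
  rw [this]

include hv in
-- The constant is the quotient of the two zeta integrals of one test function with nonzero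
-- denominator; `zeta_mul_zeta_comm` shows that it serves every `φ`. Existence is what gives the
-- choice in `tateGamma` its meaning.
theorem isTateGamma_tateGamma (χ : PontryaginDual Kˣ) {s : ℂ} (hs : 0 < s.re) (hs1 : s.re < 1) :
    IsTateGamma v dx χ s (tateGamma v dx χ s) := by
  refine Classical.epsilon_spec (p := IsTateGamma v dx χ s) ?_
  obtain ⟨ψ, hψ, hne⟩ := exists_zeta_ne_zero hv dx χ⁻¹ (s := 1 - s) (by simpa using hs1)
    (by simpa using hs)
  refine ⟨zetaIntegral dx (addFourier v dx ψ) χ s / zetaIntegral dx ψ χ⁻¹ (1 - s), ?_⟩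
  rw [isTateGamma_iff]
  intro φ hφ
  have := zeta_mul_zeta_comm hv dx hφ hψ χ hs hs1
  field_simp
  linear_combination this

include hv in
/-- The local functional equation. -/
theorem zeta_addFourier (χ : PontryaginDual Kˣ) {s : ℂ} (hs : 0 < s.re) (hs1 : s.re < 1)
    {φ : K → ℂ} (hφ : IsSchwartzBruhat v φ) :
    zetaIntegral dx (addFourier v dx φ) χ s =
      tateGamma v dx χ s * zetaIntegral dx φ χ⁻¹ (1 - s) :=
  (isTateGamma_iff dx χ s _).1 (isTateGamma_tateGamma hv dx χ hs hs1) φ hφ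

include hv in
-- Near `s` the Gamma function is the quotient of two differentiable zeta integrals of a fixed test
-- function.
theorem differentiableAt_tateGamma (χ : PontryaginDual Kˣ) {s : ℂ} (hs : 0 < s.re)
    (hs1 : s.re < 1) : DifferentiableAt ℂ (tateGamma v dx χ) s := by
  obtain ⟨ψ, hψ, hne⟩ := exists_zeta_ne_zero hv dx χ⁻¹ (s := 1 - s) (by simpa using hs1)
    (by simpa using hs)
  have h1 : DifferentiableAt ℂ (zetaIntegral dx (addFourier v dx ψ) χ) s :=
    ((hv.moderate _ (hv.fourier dx ψ hψ)).hasDerivAt_zeta dx χ hs hs1).differentiableAt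
  have h2 : DifferentiableAt ℂ (fun z => zetaIntegral dx ψ χ⁻¹ (1 - z)) s :=
    (((hv.moderate _ hψ).hasDerivAt_zeta dx χ⁻¹ (s := 1 - s) (by simpa using hs1)
      (by simpa using hs)).differentiableAt).comp s (differentiableAt_id.const_sub 1)
  have hU : {z : ℂ | 0 < z.re ∧ z.re < 1} ∈ nhds s :=
    ((isOpen_lt continuous_const Complex.continuous_re).inter
      (isOpen_lt Complex.continuous_re continuous_const)).mem_nhds ⟨hs, hs1⟩
  refine (h1.div h2 hne).congr_of_eventuallyEq ?_
  filter_upwards [hU, h2.continuousAt.eventually_ne hne] with z hz hz2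
  refine (eq_div_iff hz2).2 ?_
  exact (zeta_addFourier hv dx χ hz.1 hz.2 hψ).symm

include hv in
/-- The derivative of the local functional equation. -/
theorem zetaLog_addFourier (χ : PontryaginDual Kˣ) {s : ℂ} (hs : 0 < s.re) (hs1 : s.re < 1)
    {φ : K → ℂ} (hφ : IsSchwartzBruhat v φ) :
    zetaLogIntegral dx (addFourier v dx φ) χ s =
      deriv (tateGamma v dx χ) s * zetaIntegral dx φ χ⁻¹ (1 - s) -
        tateGamma v dx χ s * zetaLogIntegral dx φ χ⁻¹ (1 - s) := by
  have h1 := (hv.moderate _ (hv.fourier dx φ hφ)).hasDerivAt_zeta dx χ hs hs1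
  have h2 : HasDerivAt (fun z => zetaIntegral dx φ χ⁻¹ (1 - z))
      (zetaLogIntegral dx φ χ⁻¹ (1 - s) * -1) s :=
    ((hv.moderate _ hφ).hasDerivAt_zeta dx χ⁻¹ (s := 1 - s) (by simpa using hs1)
      (by simpa using hs)).comp s ((hasDerivAt_id s).const_sub 1)
  have h3 := (differentiableAt_tateGamma hv dx χ hs hs1).hasDerivAt.mul h2
  have hU : {z : ℂ | 0 < z.re ∧ z.re < 1} ∈ nhds s :=
    ((isOpen_lt continuous_const Complex.continuous_re).inter
      (isOpen_lt Complex.continuous_re continuous_const)).mem_nhds ⟨hs, hs1⟩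
  have h4 := h3.congr_of_eventuallyEq (f₁ := zetaIntegral dx (addFourier v dx φ) χ) (by
    filter_upwards [hU] with z hz
    exact zeta_addFourier hv dx χ hz.1 hz.2 hφ)
  rw [h1.unique h4]
  ring

theorem localModule_neg_one : localModule (-1 : K) = 1 := by
  have h := localModule_pow (-1 : K) 2
  rw [neg_one_sq, localModule_one] at h
  have h0 := localModule_nonneg (-1 : K)
  nlinarith

theorem quasiChar_neg (χ : PontryaginDual Kˣ) (s : ℂ) (x : K) :
    quasiChar χ s (-x) = charAt χ (-1 : K) * quasiChar χ s x := by
  rw [neg_eq_neg_one_mul, quasiChar_mul]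
  congr 1
  simp [quasiChar, localModule_neg_one]

theorem charAt_neg_one_mul_self (χ : PontryaginDual Kˣ) :
    charAt χ (-1 : K) * charAt χ (-1 : K) = 1 := by
  rw [← charAt_mul]
  simp [charAt_one]

theorem zetaIntegral_neg (φ : K → ℂ) (χ : PontryaginDual Kˣ) (s : ℂ) :
    zetaIntegral dx (fun x => φ (-x)) χ s = charAt χ (-1 : K) * zetaIntegral dx φ χ s := by
  unfold zetaIntegral
  rw [← integral_neg_eq_self, ← integral_const_mul]
  congr 1
  ext x
  simp only [neg_neg, quasiChar_neg]
  ring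

include hv in
theorem conj_addFourier (φ : K → ℂ) (x : K) :
    (starRingEnd ℂ) (addFourier v dx φ x) =
      addFourier v dx (fun y => (starRingEnd ℂ) (φ y)) (-x) := by
  unfold addFourier
  rw [← integral_conj]
  congr 1
  ext y
  rw [map_mul, ← basicChar_neg hv, neg_mul]

theorem conj_zetaIntegral (φ : K → ℂ) (χ : PontryaginDual Kˣ) (s : ℂ) :
    (starRingEnd ℂ) (zetaIntegral dx φ χ s) =
      zetaIntegral dx (fun y => (starRingEnd ℂ) (φ y)) χ⁻¹ ((starRingEnd ℂ) s) := by
  unfold zetaIntegral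
  rw [← integral_conj]
  congr 1
  ext y
  rw [map_mul, conj_quasiChar]

include hv in
-- Apply the functional equation twice: `𝓕𝓕` is the reflection `x ↦ -x`, which multiplies zeta
-- integrals by `χ(-1)`.
theorem tateGamma_mul_tateGamma_inv (hF : ∀ φ, IsSchwartzBruhat v φ →
    ∀ x, addFourier v dx (addFourier v dx φ) x = φ (-x)) (χ : PontryaginDual Kˣ) {s : ℂ}
    (hs : 0 < s.re) (hs1 : s.re < 1) :
    tateGamma v dx χ s * tateGamma v dx χ⁻¹ (1 - s) = charAt χ (-1 : K) := by
  obtain ⟨φ, hφ, hne⟩ := exists_zeta_ne_zero hv dx χ hs hs1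
  have h1 := zeta_addFourier hv dx χ hs hs1 (hv.fourier dx φ hφ)
  have h2 := zeta_addFourier hv dx χ⁻¹ (s := 1 - s) (by simpa using hs1) (by simpa using hs) hφ
  rw [h2, funext (hF φ hφ), zetaIntegral_neg, inv_inv, sub_sub_cancel, ← mul_assoc] at h1
  exact (mul_right_cancel₀ hne h1).symm

include hv in
theorem tateGamma_ne_zero (hF : ∀ φ, IsSchwartzBruhat v φ →
    ∀ x, addFourier v dx (addFourier v dx φ) x = φ (-x)) (χ : PontryaginDual Kˣ) {s : ℂ}
    (hs : 0 < s.re) (hs1 : s.re < 1) : tateGamma v dx χ s ≠ 0 := by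
  intro h
  have h1 := tateGamma_mul_tateGamma_inv hv dx hF χ hs hs1
  rw [h, zero_mul] at h1
  have h2 := charAt_neg_one_mul_self χ
  rw [← h1] at h2
  simp at h2

include hv in
-- Conjugation commutes with `𝓕` up to the reflection `x ↦ -x`, which accounts for the sign; compare
-- the functional equation for `φ` with that for its conjugate.
theorem conj_tateGamma (χ : PontryaginDual Kˣ) {s : ℂ} (hs : 0 < s.re) (hs1 : s.re < 1) :
    (starRingEnd ℂ) (tateGamma v dx χ s) =
      charAt χ⁻¹ (-1 : K) * tateGamma v dx χ⁻¹ ((starRingEnd ℂ) s) := by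
  obtain ⟨φ, hφ, hne⟩ := exists_zeta_ne_zero hv dx χ⁻¹ (s := 1 - s) (by simpa using hs1)
    (by simpa using hs)
  have h1 := congrArg (starRingEnd ℂ) (zeta_addFourier hv dx χ hs hs1 hφ)
  have h2 := zeta_addFourier hv dx χ⁻¹ (s := (starRingEnd ℂ) s) (by simpa using hs)
    (by simpa using hs1) (hv.conj φ hφ)
  have h3 : ((starRingEnd ℂ) (zetaIntegral dx φ χ⁻¹ (1 - s))) ≠ 0 := by simpa using hne
  rw [map_mul, conj_zetaIntegral dx (addFourier v dx φ), funext (conj_addFourier hv dx φ),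
    zetaIntegral_neg dx (addFourier v dx _), h2] at h1
  have h4 := conj_zetaIntegral dx φ χ⁻¹ (1 - s)
  rw [map_sub, map_one] at h4
  rw [← h4, ← mul_assoc] at h1
  exact (mul_right_cancel₀ h3 h1).symm

include hv in
-- Take the logarithmic derivative of `Γ(χ, s) Γ(χ⁻¹, 1 - s) = χ(-1)` at `1/2`, the fixed point of
-- `s ↦ 1 - s`.
theorem tateLambda_inv (hF : ∀ φ, IsSchwartzBruhat v φ →
    ∀ x, addFourier v dx (addFourier v dx φ) x = φ (-x)) (χ : PontryaginDual Kˣ) :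
    tateLambda v dx χ⁻¹ (1 / 2) = tateLambda v dx χ (1 / 2) := by
  have hs : 0 < (1 / 2 : ℂ).re := by norm_num
  have hs1 : (1 / 2 : ℂ).re < 1 := by norm_num
  have e : (1 : ℂ) - 1 / 2 = 1 / 2 := by norm_num
  have h1 := (differentiableAt_tateGamma hv dx χ hs hs1).hasDerivAt
  have h2 := (differentiableAt_tateGamma hv dx χ⁻¹ hs hs1).hasDerivAt
  rw [← e] at h2
  have h3 := h2.comp (1 / 2 : ℂ) ((hasDerivAt_id (1 / 2 : ℂ)).const_sub 1)
  have h4 := h1.mul h3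
  have hU : {z : ℂ | 0 < z.re ∧ z.re < 1} ∈ nhds (1 / 2 : ℂ) :=
    ((isOpen_lt continuous_const Complex.continuous_re).inter
      (isOpen_lt Complex.continuous_re continuous_const)).mem_nhds ⟨hs, hs1⟩
  have h5 := (hasDerivAt_const (1 / 2 : ℂ) (charAt χ (-1 : K))).congr_of_eventuallyEq
    (f₁ := tateGamma v dx χ * (tateGamma v dx χ⁻¹ ∘ fun z => 1 - id z)) (by
      filter_upwards [hU] with z hz
      exact tateGamma_mul_tateGamma_inv hv dx hF χ hz.1 hz.2)
  have h6 := h4.unique h5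
  simp only [Function.comp, e] at h6
  have n1 := tateGamma_ne_zero hv dx hF χ hs hs1
  have n2 := tateGamma_ne_zero hv dx hF χ⁻¹ hs hs1
  unfold tateLambda
  rw [neg_inj, div_eq_div_iff n2 n1]
  linear_combination -h6

include hv in
-- The logarithmic derivative of the conjugation relation turns `Λ(χ, 1/2)` into the conjugate of
-- `Λ(χ⁻¹, 1/2)`, and the two values of `Λ` agree by `tateLambda_inv`.
theorem tateLambda_im (hF : ∀ φ, IsSchwartzBruhat v φ →
    ∀ x, addFourier v dx (addFourier v dx φ) x = φ (-x)) (χ : PontryaginDual Kˣ) :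
    (tateLambda v dx χ (1 / 2)).im = 0 := by
  have hs : 0 < (1 / 2 : ℂ).re := by norm_num
  have hs1 : (1 / 2 : ℂ).re < 1 := by norm_num
  have e : (starRingEnd ℂ) (1 / 2 : ℂ) = 1 / 2 := by
    rw [map_div₀, map_one, Complex.conj_ofNat]
  have h1 := (differentiableAt_tateGamma hv dx χ hs hs1).hasDerivAt
  have h2 := (differentiableAt_tateGamma hv dx χ⁻¹ hs hs1).hasDerivAt
  rw [← e] at h1
  have h3 := h1.conj_conj
  rw [Complex.conj_conj] at h3
  have hU : {z : ℂ | 0 < z.re ∧ z.re < 1} ∈ nhds (1 / 2 : ℂ) :=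
    ((isOpen_lt continuous_const Complex.continuous_re).inter
      (isOpen_lt Complex.continuous_re continuous_const)).mem_nhds ⟨hs, hs1⟩
  have h4 := (h2.const_mul (charAt χ⁻¹ (-1 : K))).congr_of_eventuallyEq
    (f₁ := (starRingEnd ℂ) ∘ tateGamma v dx χ ∘ (starRingEnd ℂ)) (by
      filter_upwards [hU] with z hz
      have := conj_tateGamma hv dx χ (s := (starRingEnd ℂ) z) (by simpa using hz.1)
        (by simpa using hz.2)
      rw [Complex.conj_conj] at this
      exact this)
  have h5 := h3.unique h4
  rw [e] at h5
  have h6 := conj_tateGamma hv dx χ hs hs1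
  rw [e] at h6
  have hc : charAt χ⁻¹ (-1 : K) ≠ 0 := by
    intro h
    have := charAt_neg_one_mul_self χ⁻¹
    rw [h] at this
    simp at this
  -- The two rewrites leave `χ⁻¹` on the right-hand side only.
  rw [← Complex.conj_eq_iff_im, ← tateLambda_inv hv dx hF χ]
  conv_lhs => rw [tateLambda_inv hv dx hF χ]
  unfold tateLambda
  rw [map_neg, map_div₀, h5, h6, mul_div_mul_left _ _ hc]

end Tate

/-! ### The additive Fourier transform as a unitary operator. -/

section L2Theory

variable {K : Type*} [NormedField K] [ProperSpace K] [hK : Fact (∃ p : K, p ≠ 0 ∧ ‖p‖ < 1)]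
variable [MeasurableSpace K] [BorelSpace K]
variable {v : LocalPlace K} (hv : v.Regular)

/-- The space of Schwartz-Bruhat functions. -/
noncomputable def schwartzBruhat : Submodule ℂ (K → ℂ) where
  carrier := {φ | IsSchwartzBruhat v φ}
  zero_mem' := by
    obtain ⟨r, hr, -⟩ := hv.bump Set.univ Filter.univ_mem
    have := hv.smul 0 _ hr
    rwa [zero_smul] at this
  add_mem' := fun h1 h2 => hv.add _ _ h1 h2
  smul_mem' := fun c _ h => hv.smul c _ h

variable (dx : Measure K) [dx.IsAddHaarMeasure]

/-- The inclusion of the Schwartz-Bruhat functions in `L²`. -/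
noncomputable def schwartzToLp : schwartzBruhat hv →ₗ[ℂ] Lp ℂ 2 dx :=
  submoduleToLp dx (schwartzBruhat hv).subtype fun φ => (hv.moderate φ φ.2).memLp dx

theorem coeFn_schwartzToLp (φ : schwartzBruhat hv) :
    schwartzToLp hv dx φ =ᵐ[dx] (φ : K → ℂ) :=
  ((hv.moderate φ φ.2).memLp dx).coeFn_toLp

include hv

theorem eq_zero_of_forall_integral_mul_eq_zero (g : Lp ℂ 2 dx)
    (h : ∀ φ, IsSchwartzBruhat v φ → ∫ x, g x * φ x ∂dx = 0) : g = 0 := by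
  rw [Lp.eq_zero_iff_ae_eq_zero]
  exact hv.ae_eq_zero dx g ((Lp.memLp g).locallyIntegrable (by norm_num)) h

theorem denseRange_schwartzToLp : DenseRange (schwartzToLp hv dx) := by
  refine denseRange_of_forall_inner_eq_zero _ fun g hg => ?_
  refine eq_zero_of_forall_integral_mul_eq_zero hv dx g fun φ hφ => ?_
  have := hg ⟨_, hv.conj φ hφ⟩
  have e := inner_toLp_left ((hv.moderate _ (hv.conj φ hφ)).memLp dx) g
  simp only [Complex.conj_conj] at e
  exact e.symm.trans this

/-- The Fourier transform as a linear map on Schwartz-Bruhat functions. -/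
noncomputable def schwartzFourier : schwartzBruhat hv →ₗ[ℂ] schwartzBruhat hv where
  toFun φ := ⟨addFourier v dx φ, hv.fourier dx φ φ.2⟩
  map_add' φ ψ := by
    ext y
    have h1 := integrable_mul_basicChar hv dx ((hv.moderate φ φ.2).integrable dx) y
    have h2 := integrable_mul_basicChar hv dx ((hv.moderate ψ ψ.2).integrable dx) y
    simp only [addFourier, Submodule.coe_add, Pi.add_apply, add_mul]
    exact integral_add h1 h2
  map_smul' c φ := by
    ext y
    simp only [addFourier, Submodule.coe_smul, Pi.smul_apply, smul_eq_mul, mul_assoc,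
      RingHom.id_apply]
    rw [integral_const_mul]

theorem addFourier_mul_eq {φ ψ : K → ℂ} (hφ : Integrable φ dx) (hψ : Integrable ψ dx) :
    ∫ y, ψ y * addFourier v dx φ y ∂dx = ∫ y, φ y * addFourier v dx ψ y ∂dx := by
  have := integral_mul_addFourier_comm hv dx hφ hψ 1
  simpa using this

variable (hF : ∀ φ, IsSchwartzBruhat v φ → ∀ x, addFourier v dx (addFourier v dx φ) x = φ (-x))

include hF in
theorem addFourier_conj_addFourier {ψ : K → ℂ} (hψ : IsSchwartzBruhat v ψ) (x : K) :
    addFourier v dx (fun y => (starRingEnd ℂ) (addFourier v dx ψ y)) x =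
      (starRingEnd ℂ) (ψ x) := by
  have h := conj_addFourier hv dx (addFourier v dx ψ) (-x)
  rw [hF ψ hψ, neg_neg] at h
  exact h.symm

include hF in
theorem addFourier_surjective {ψ : K → ℂ} (hψ : IsSchwartzBruhat v ψ) :
    ∃ φ, IsSchwartzBruhat v φ ∧ addFourier v dx φ = ψ ∧ addFourierInv v dx ψ = φ := by
  have h1 : IsSchwartzBruhat v (addFourierInv v dx ψ) := by
    rw [funext (addFourierInv_eq dx ψ)]
    exact hv.neg _ (hv.fourier dx ψ hψ)
  refine ⟨_, h1, ?_, rfl⟩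
  ext x
  have h2 : addFourierInv v dx ψ = addFourier v dx (fun y => ψ (-y)) := by
    ext y
    rw [addFourierInv_eq, addFourier, addFourier, ← integral_neg_eq_self]
    simp
  rw [h2, hF _ (hv.neg ψ hψ), neg_neg]

include hF in
-- The multiplication formula for `φ` and the conjugate of `𝓕ψ`, whose transform is the conjugate of
-- `ψ`. Only integrability of `φ` is asked, as in the multiplicative case.
theorem parseval_schwartzBruhat {φ ψ : K → ℂ} (hφ : Integrable φ dx) (hψ : IsSchwartzBruhat v ψ) :
    ∫ x, addFourier v dx φ x * (starRingEnd ℂ) (addFourier v dx ψ x) ∂dx =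
      ∫ x, φ x * (starRingEnd ℂ) (ψ x) ∂dx := by
  have h := addFourier_mul_eq hv dx hφ
    ((hv.moderate _ (hv.conj _ (hv.fourier dx ψ hψ))).integrable dx)
  simp_rw [addFourier_conj_addFourier hv dx hF hψ] at h
  rw [← h]
  congr 1
  ext x
  ring

include hF in
/-- The Fourier transform as a unitary operator of `L²`. -/
theorem exists_fourierL2 : ∃ F : Lp ℂ 2 dx ≃ₗᵢ[ℂ] Lp ℂ 2 dx, IsFourierL2 v dx F ∧
    ∀ φ : schwartzBruhat hv, F (schwartzToLp hv dx φ) =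
      schwartzToLp hv dx (schwartzFourier hv dx φ) := by
  have hd1 := denseRange_schwartzToLp hv dx
  have hd2 : DenseRange (schwartzToLp hv dx ∘ₗ schwartzFourier hv dx) := by
    have hs : Function.Surjective (schwartzFourier hv dx) := by
      rintro ⟨ψ, hψ⟩
      obtain ⟨φ, hφ, h, -⟩ := addFourier_surjective hv dx hF hψ
      exact ⟨⟨φ, hφ⟩, Subtype.ext h⟩
    rw [DenseRange, LinearMap.coe_comp, hs.range_comp]
    exact hd1
  have hL : ∀ φ : schwartzBruhat hv, MemLp (φ : K → ℂ) 2 dx :=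
    fun φ => (hv.moderate φ φ.2).memLp dx
  have hn : ∀ φ, ‖(schwartzToLp hv dx ∘ₗ schwartzFourier hv dx) φ‖ = ‖schwartzToLp hv dx φ‖ := by
    intro φ
    have e1 := inner_toLp_left (hL (schwartzFourier hv dx φ))
      ((hL (schwartzFourier hv dx φ)).toLp _)
    have e2 := inner_toLp_left (hL φ) ((hL φ).toLp _)
    have e3 : inner ℂ ((hL (schwartzFourier hv dx φ)).toLp _)
        ((hL (schwartzFourier hv dx φ)).toLp _) = inner ℂ ((hL φ).toLp _) ((hL φ).toLp _) := by
      rw [e1, e2]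
      refine Eq.trans (integral_congr_ae ?_) ((parseval_schwartzBruhat hv dx hF
        ((hv.moderate φ φ.2).integrable dx) φ.2).trans (integral_congr_ae ?_))
      · filter_upwards [(hL (schwartzFourier hv dx φ)).coeFn_toLp] with x hx
        rw [hx]; rfl
      · filter_upwards [(hL φ).coeFn_toLp] with x hx
        rw [hx]
    rw [inner_self_eq_norm_sq_to_K, inner_self_eq_norm_sq_to_K] at e3
    have e4 : ‖(hL (schwartzFourier hv dx φ)).toLp _‖ ^ 2 = ‖(hL φ).toLp _‖ ^ 2 := by
      exact_mod_cast e3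
    exact (sq_eq_sq₀ (norm_nonneg _) (norm_nonneg _)).1 e4
  obtain ⟨F, hFM⟩ := exists_linearIsometryEquiv_of_dense _ _ hd1 hd2 hn
  refine ⟨F, fun f hf => ?_, hFM⟩
  have hcont : Continuous (addFourier v dx f) := by
    refine continuous_of_dominated (bound := fun t => ‖f t‖)
      (fun y => (integrable_mul_basicChar hv dx hf y).1) (fun y => .of_forall fun t => ?_) hf.norm
      (.of_forall fun t => ?_)
    · rw [norm_mul, hv.norm_char, mul_one]
    · exact continuous_const.mul (hv.continuous_char.comp (by fun_prop))
  -- Every Schwartz–Bruhat `η` is the conjugate of some `𝓕ψ`; against it both functions integrate to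
  -- the pairing of `f` with `ψ`, by unitarity of `F` and by Parseval respectively.
  have : (fun x => (F f) x - addFourier v dx f x) =ᵐ[dx] 0 := by
    have hl1 : LocallyIntegrable (F f) dx := (Lp.memLp (F f)).locallyIntegrable (by norm_num)
    refine hv.ae_eq_zero dx _ (hl1.sub hcont.locallyIntegrable) fun η hη => ?_
    obtain ⟨ψ, hψ, hψη, -⟩ := addFourier_surjective hv dx hF (hv.conj η hη)
    have hψη' : ∀ x, (starRingEnd ℂ) (addFourier v dx ψ x) = η x := by
      intro x; rw [hψη, Complex.conj_conj]
    have e1 := inner_toLp_left (hL (schwartzFourier hv dx ⟨ψ, hψ⟩)) (F f)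
    have e2 := inner_toLp_left (hL ⟨ψ, hψ⟩) f
    have e3 : (hL (schwartzFourier hv dx ⟨ψ, hψ⟩)).toLp _ = F ((hL ⟨ψ, hψ⟩).toLp _) :=
      (hFM ⟨ψ, hψ⟩).symm
    rw [e3, LinearIsometryEquiv.inner_map_map, e2,
      ← parseval_schwartzBruhat hv dx hF hf hψ] at e1
    have e4 : ∫ x, addFourier v dx f x * η x ∂dx = ∫ x, (F f) x * η x ∂dx := by
      simpa only [schwartzFourier, LinearMap.coe_mk, AddHom.coe_mk, hψη'] using e1
    have i1 : Integrable (fun x => (F f) x * η x) dx :=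
      (Lp.memLp (F f)).integrable_mul (hL ⟨η, hη⟩)
    have i2 : Integrable (fun x => addFourier v dx f x * η x) dx := by
      refine Integrable.bdd_mul (c := ∫ t, ‖f t‖ ∂dx) ((hv.moderate η hη).integrable dx)
        hcont.aestronglyMeasurable (.of_forall fun x => ?_)
      refine (norm_integral_le_integral_norm _).trans (le_of_eq ?_)
      congr 1
      ext t
      rw [norm_mul, hv.norm_char, mul_one]
    simp only [sub_mul]
    rw [integral_sub i1 i2, e4, sub_self]
  filter_upwards [this] with x hx
  exact sub_eq_zero.1 hx

end L2Theory

/-! ### Passage from `L²(K, dx)` to `L²` of the units. -/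

section Transport

variable {K : Type*} [NormedField K] [ProperSpace K] [hK : Fact (∃ p : K, p ≠ 0 ∧ ‖p‖ < 1)]
variable [MeasurableSpace K] [BorelSpace K]
variable (dx : Measure K) [dx.IsAddHaarMeasure] {dt : Measure Kˣ} {α : ℝ}

theorem quasiMeasurePreserving_val (hα : 0 < α)
    (hdt : dt = ENNReal.ofReal (α ^ 2)⁻¹ • mulHaarOfAdd dx) :
    Measure.QuasiMeasurePreserving (Units.val : Kˣ → K) dt dx where
  measurable := measurableEmbedding_unitsVal.measurable
  absolutelyContinuous := by
    refine Measure.AbsolutelyContinuous.mk fun s hs h0 => ?_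
    rw [Measure.map_apply measurableEmbedding_unitsVal.measurable hs]
    have h1 : ∀ᵐ x ∂dx, x ∉ s := measure_eq_zero_iff_ae_notMem.1 h0
    exact measure_eq_zero_iff_ae_notMem.2 ((ae_mulHaar_iff dx hα hdt (fun x => x ∉ s)).2 h1)

/-- The function `t ↦ α √|t| φ(t)` on the units. -/
noncomputable def unitsTwist (α : ℝ) (φ : K → ℂ) (t : Kˣ) : ℂ :=
  (α * √(localModule (t : K)) : ℝ) * φ (t : K)

theorem norm_sq_unitsTwist (φ : K → ℂ) (t : Kˣ) :
    ‖unitsTwist α φ t‖ ^ 2 = α ^ 2 * (localModule (t : K) * ‖φ t‖ ^ 2) := by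
  rw [unitsTwist, norm_mul, Complex.norm_real, Real.norm_eq_abs, mul_pow, sq_abs, mul_pow,
    Real.sq_sqrt (localModule_nonneg _), mul_assoc]

theorem aestronglyMeasurable_unitsTwist (hα : 0 < α)
    (hdt : dt = ENNReal.ofReal (α ^ 2)⁻¹ • mulHaarOfAdd dx) {φ : K → ℂ}
    (hφ : AEStronglyMeasurable φ dx) : AEStronglyMeasurable (unitsTwist α φ) dt := by
  have h1 : Measurable fun t : Kˣ => ((α * √(localModule (t : K)) : ℝ) : ℂ) :=
    Complex.measurable_ofReal.comp ((continuous_localModule.measurable.comp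
      measurableEmbedding_unitsVal.measurable).sqrt.const_mul α)
  exact h1.aestronglyMeasurable.mul
    (hφ.comp_quasiMeasurePreserving (quasiMeasurePreserving_val dx hα hdt))

theorem inv_localModule_mul_ae (φ : K → ℂ) :
    (fun x => (localModule x)⁻¹ • (α ^ 2 * (localModule x * ‖φ x‖ ^ 2))) =ᵐ[dx]
      fun x => α ^ 2 * ‖φ x‖ ^ 2 := by
  filter_upwards [ae_ne_zero_addHaar dx] with x hx
  have := (localModule_pos hx).ne'
  rw [smul_eq_mul]
  field_simp

theorem memLp_unitsTwist_iff (hα : 0 < α)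
    (hdt : dt = ENNReal.ofReal (α ^ 2)⁻¹ • mulHaarOfAdd dx) {φ : K → ℂ}
    (hφ : AEStronglyMeasurable φ dx) : MemLp (unitsTwist α φ) 2 dt ↔ MemLp φ 2 dx := by
  rw [memLp_two_iff_integrable_sq_norm (aestronglyMeasurable_unitsTwist dx hα hdt hφ),
    memLp_two_iff_integrable_sq_norm hφ]
  simp_rw [norm_sq_unitsTwist]
  rw [integrable_mulHaar_iff dx hα hdt (fun x => α ^ 2 * (localModule x * ‖φ x‖ ^ 2)),
    integrable_congr (inv_localModule_mul_ae dx φ)]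
  have h2 : α ^ 2 ≠ 0 := by positivity
  exact integrable_const_mul_iff h2.isUnit _

theorem integral_norm_sq_unitsTwist (hα : 0 < α)
    (hdt : dt = ENNReal.ofReal (α ^ 2)⁻¹ • mulHaarOfAdd dx) (φ : K → ℂ) :
    ∫ t, ‖unitsTwist α φ t‖ ^ 2 ∂dt = ∫ x, ‖φ x‖ ^ 2 ∂dx := by
  simp_rw [norm_sq_unitsTwist]
  rw [integral_mulHaar dx hdt (fun x => α ^ 2 * (localModule x * ‖φ x‖ ^ 2)),
    integral_congr_ae (inv_localModule_mul_ae dx φ), integral_const_mul, smul_eq_mul]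
  have h2 : α ^ 2 ≠ 0 := by positivity
  rw [inv_mul_cancel_left₀ h2]

theorem norm_sq_Lp_two {Y : Type*} [MeasurableSpace Y] {ν : Measure Y} (f : Lp ℂ 2 ν) :
    ‖f‖ ^ 2 = ∫ y, ‖f y‖ ^ 2 ∂ν := by
  have h := inner_self_eq_norm_sq_to_K (𝕜 := ℂ) f
  rw [L2.inner_def] at h
  have h2 : ∀ y, inner ℂ (f y) (f y) = ((‖f y‖ ^ 2 : ℝ) : ℂ) := by
    intro y
    rw [inner_self_eq_norm_sq_to_K]
    norm_cast
  simp_rw [h2] at h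
  rw [integral_complex_ofReal] at h
  exact Complex.ofReal_injective ((Complex.ofReal_pow _ _).trans h.symm)

/-- The isometry of `L²(K, dx)` with `L²(Kˣ, d*t)`. -/
theorem exists_isAddMulIsometry (hα : 0 < α)
    (hdt : dt = ENNReal.ofReal (α ^ 2)⁻¹ • mulHaarOfAdd dx) :
    ∃ T : Lp ℂ 2 dx ≃ₗᵢ[ℂ] Lp ℂ 2 dt, ∀ φ : Lp ℂ 2 dx, T φ =ᵐ[dt] unitsTwist α φ := by
  have hq := quasiMeasurePreserving_val dx hα hdt
  have hm : ∀ φ : Lp ℂ 2 dx, MemLp (unitsTwist α φ) 2 dt := fun φ =>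
    (memLp_unitsTwist_iff dx hα hdt (Lp.memLp φ).1).2 (Lp.memLp φ)
  let T₀ : Lp ℂ 2 dx →ₗᵢ[ℂ] Lp ℂ 2 dt :=
    { toFun := fun φ => (hm φ).toLp _
      map_add' := fun φ ψ => by
        rw [← MemLp.toLp_add, MemLp.toLp_eq_toLp_iff]
        filter_upwards [hq.ae (Lp.coeFn_add φ ψ)] with t ht
        simp only [unitsTwist, ht, Pi.add_apply, mul_add]
      map_smul' := fun c φ => by
        rw [RingHom.id_apply, ← MemLp.toLp_const_smul, MemLp.toLp_eq_toLp_iff]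
        filter_upwards [hq.ae (Lp.coeFn_smul c φ)] with t ht
        simp only [unitsTwist, ht, Pi.smul_apply, smul_eq_mul]
        ring
      norm_map' := fun φ => by
        refine (sq_eq_sq₀ (norm_nonneg _) (norm_nonneg _)).1 ?_
        rw [norm_sq_Lp_two, norm_sq_Lp_two, ← integral_norm_sq_unitsTwist dx hα hdt φ]
        refine integral_congr_ae ?_
        filter_upwards [(hm φ).coeFn_toLp] with t ht
        exact congrArg (fun z => ‖z‖ ^ 2) ht }
  have hsurj : Function.Surjective T₀ := by
    intro f
    obtain ⟨g, hg, hfg⟩ := (Lp.memLp f).1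
    -- Undo the twist on the units; the value at the null set `{0}` is immaterial.
    let φ : K → ℂ := Function.extend Units.val
      (fun t : Kˣ => ((α * √(localModule (t : K)) : ℝ) : ℂ)⁻¹ * g t) 0
    have h1 : Measurable fun t : Kˣ => ((α * √(localModule (t : K)) : ℝ) : ℂ) :=
      Complex.measurable_ofReal.comp ((continuous_localModule.measurable.comp
        measurableEmbedding_unitsVal.measurable).sqrt.const_mul α)
    have hφ : Measurable φ :=
      measurableEmbedding_unitsVal.measurable_extend (h1.inv.mul hg.measurable) measurable_const
    have hφt : ∀ t : Kˣ, unitsTwist α φ t = g t := by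
      intro t
      have h2 : ((α * √(localModule (t : K)) : ℝ) : ℂ) ≠ 0 := by
        have := Real.sqrt_pos.2 (localModule_units_pos t)
        exact_mod_cast (mul_pos hα this).ne'
      change _ * Function.extend Units.val _ _ _ = _
      rw [Units.val_injective.extend_apply, mul_inv_cancel_left₀ h2]
    have hφ2 : MemLp φ 2 dx := by
      rw [← memLp_unitsTwist_iff dx hα hdt hφ.aestronglyMeasurable, funext hφt]
      exact (memLp_congr_ae hfg).1 (Lp.memLp f)
    refine ⟨hφ2.toLp φ, ?_⟩
    refine Lp.ext ?_
    refine (hm _).coeFn_toLp.trans ?_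
    filter_upwards [hfg, hq.ae hφ2.coeFn_toLp] with t ht1 ht2
    rw [ht1, ← hφt]
    simp only [unitsTwist, ht2]
  refine ⟨LinearIsometryEquiv.ofSurjective T₀ hsurj, fun φ => ?_⟩
  exact (hm φ).coeFn_toLp

/-- Composition with the inversion of a commutative group, as a unitary operator. -/
theorem exists_inv_isometry {G : Type*} [CommGroup G] [MeasurableSpace G] [MeasurableInv G]
    (ν : Measure G) [ν.IsInvInvariant] :
    ∃ R : Lp ℂ 2 ν ≃ₗᵢ[ℂ] Lp ℂ 2 ν, ∀ f : Lp ℂ 2 ν, R f =ᵐ[ν] fun t => f t⁻¹ := by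
  have hp := Measure.measurePreserving_inv ν
  let R₀ : Lp ℂ 2 ν →ₗᵢ[ℂ] Lp ℂ 2 ν := Lp.compMeasurePreservingₗᵢ ℂ Inv.inv hp
  have h : ∀ f : Lp ℂ 2 ν, R₀ f =ᵐ[ν] fun t => f t⁻¹ := fun f =>
    Lp.coeFn_compMeasurePreserving f hp
  have hsurj : Function.Surjective R₀ := by
    intro f
    refine ⟨R₀ f, Lp.ext ?_⟩
    filter_upwards [h (R₀ f), hp.quasiMeasurePreserving.ae (h f)] with t h1 h2
    rw [h1, h2, inv_inv]
  exact ⟨LinearIsometryEquiv.ofSurjective R₀ hsurj, h⟩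

/-- An identity `A u = g · B u` of `L²` functions passes from a dense set to the whole space. -/
theorem ae_eq_mul_of_dense {V H Y : Type*} [NormedAddCommGroup H] [MeasurableSpace Y]
    {ν : Measure Y} (a : V → H) (ha : DenseRange a) (A B : H → Lp ℂ 2 ν) (hA : Continuous A)
    (hB : Continuous B) (g : Y → ℂ) (h : ∀ v, ∀ᵐ y ∂ν, A (a v) y = g y * B (a v) y) (u : H) :
    ∀ᵐ y ∂ν, A u y = g y * B u y := by
  obtain ⟨w, hw, hwt⟩ := mem_closure_iff_seq_limit.1 (ha u)
  choose x hx using hw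
  have hAt := (hA.tendsto u).comp hwt
  have hBt := (hB.tendsto u).comp hwt
  -- Nothing is assumed of `g`, so multiplication by it need not be continuous on `L²`. The identity
  -- is passed to the limit pointwise, along a subsequence on which both sequences converge almost
  -- everywhere.
  obtain ⟨n₁, hn₁, h1⟩ := (tendstoInMeasure_of_tendsto_Lp hAt).exists_seq_tendsto_ae
  obtain ⟨n₂, hn₂, h2⟩ := (tendstoInMeasure_of_tendsto_Lp
    (hBt.comp hn₁.tendsto_atTop)).exists_seq_tendsto_ae
  have h3 : ∀ᵐ y ∂ν, ∀ n, A (w n) y = g y * B (w n) y := by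
    rw [ae_all_iff]
    intro n
    rw [← hx n]
    exact h _
  filter_upwards [h1, h2, h3] with y hy1 hy2 hy3
  refine tendsto_nhds_unique (hy1.comp hn₂.tendsto_atTop) ?_
  refine (hy2.const_mul (g y)).congr fun n => ?_
  exact (hy3 _).symm

end Transport

/-! ### Transport of the operators to the dual group. -/

section Main

variable {K : Type*} [NormedField K] [ProperSpace K] [hK : Fact (∃ p : K, p ≠ 0 ∧ ‖p‖ < 1)]

instance secondCountableTopology_dual_units : SecondCountableTopology (PontryaginDual Kˣ) :=
  secondCountableTopology_pontryaginDual

variable [MeasurableSpace K] [BorelSpace K]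
  [MeasurableSpace (PontryaginDual Kˣ)] [BorelSpace (PontryaginDual Kˣ)]
variable (dx : Measure K) [dx.IsAddHaarMeasure] {dt : Measure Kˣ} [dt.IsHaarMeasure]
  {μ : Measure (PontryaginDual Kˣ)} [μ.IsHaarMeasure] {α : ℝ}

/-- This is the origin of the point `s = 1/2`: relative to `dx/|x|`, the twist `√|x|` becomes `|x| ^
(1/2 - 1)` against `dx`. -/
theorem sqrt_mul_charAt (χ : PontryaginDual Kˣ) {x : K} (hx : x ≠ 0) :
    ((√(localModule x) : ℝ) : ℂ) * charAt χ x = localModule x * quasiChar χ (1 / 2) x := by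
  have hm := localModule_pos hx
  have hm' : (localModule x : ℂ) ≠ 0 := by exact_mod_cast hm.ne'
  have h1 : ((√(localModule x) : ℝ) : ℂ) = (localModule x : ℂ) ^ (1 / 2 : ℂ) := by
    rw [Real.sqrt_eq_rpow, Complex.ofReal_cpow hm.le]
    norm_num
  have h2 : (localModule x : ℂ) ^ (1 / 2 : ℂ) =
      localModule x * (localModule x : ℂ) ^ (1 / 2 - 1 : ℂ) := by
    rw [Complex.cpow_sub _ _ hm', Complex.cpow_one]
    field_simp
  rw [h1, h2, quasiChar]
  ring

theorem unitsTwist_mul_char (φ : K → ℂ) (χ : PontryaginDual Kˣ) (t : Kˣ) :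
    unitsTwist α φ t * ((χ t : Circle) : ℂ) =
      α * (localModule (t : K) * (φ t * quasiChar χ (1 / 2) t)) := by
  rw [← charAt_units, unitsTwist, Complex.ofReal_mul]
  linear_combination (α * φ t) * sqrt_mul_charAt χ t.ne_zero

variable {T : Lp ℂ 2 dx ≃ₗᵢ[ℂ] Lp ℂ 2 dt} {M : Lp ℂ 2 dt ≃ₗᵢ[ℂ] Lp ℂ 2 μ}

section Transform

variable (hα : 0 < α) (hdt : dt = ENNReal.ofReal (α ^ 2)⁻¹ • mulHaarOfAdd dx)
  (hT : ∀ φ : Lp ℂ 2 dx, T φ =ᵐ[dt] unitsTwist α φ) (hM : IsPlancherelIsometry dt μ M)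

include hα hdt hT

/-- The absolute value of the integrand does not depend on the character, so convergence for the
trivial one suffices. -/
theorem integrable_transport {u : Lp ℂ 2 dx} {φ : K → ℂ} (hu : u =ᵐ[dx] φ)
    (hi : Integrable (fun x => φ x * quasiChar (1 : PontryaginDual Kˣ) (1 / 2) x) dx) :
    Integrable (T u) dt := by
  have hq := quasiMeasurePreserving_val dx hα hdt
  have h1 : T u =ᵐ[dt] fun t : Kˣ => (α : ℂ) * (localModule (t : K) *
      (φ t * quasiChar (1 : PontryaginDual Kˣ) (1 / 2) t)) := by
    filter_upwards [hT u, hq.ae hu] with t ht1 ht2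
    have := unitsTwist_mul_char (α := α) φ 1 t
    rw [← this, ht1]
    simp [unitsTwist, ht2]
  rw [integrable_congr h1, integrable_mulHaar_iff dx hα hdt (fun x : K => (α : ℂ) *
    (localModule x * (φ x * quasiChar (1 : PontryaginDual Kˣ) (1 / 2) x)))]
  refine (hi.const_mul (α : ℂ)).congr ?_
  filter_upwards [ae_ne_zero_addHaar dx] with x hx
  have hm' : (localModule x : ℂ) ≠ 0 := by exact_mod_cast (localModule_pos hx).ne'
  rw [Complex.real_smul, Complex.ofReal_inv]
  field_simp

include hM

/-- The transform of a function on which the zeta integral converges. -/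
theorem transform_eq_zeta {u : Lp ℂ 2 dx} {φ : K → ℂ} (hu : u =ᵐ[dx] φ)
    (hi : Integrable (fun x => φ x * quasiChar (1 : PontryaginDual Kˣ) (1 / 2) x) dx) :
    M (T u) =ᵐ[μ] fun χ => (α : ℂ)⁻¹ * zetaIntegral dx φ χ (1 / 2) := by
  have hq := quasiMeasurePreserving_val dx hα hdt
  refine (hM (T u) (integrable_transport dx hα hdt hT hu hi)).trans (.of_forall fun χ => ?_)
  have h1 : mulFourier dt (T u) χ = ∫ t : Kˣ, (α : ℂ) * (localModule (t : K) *
      (φ t * quasiChar χ (1 / 2) t)) ∂dt := by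
    refine integral_congr_ae ?_
    filter_upwards [hT u, hq.ae hu] with t ht1 ht2
    rw [← unitsTwist_mul_char, ht1]
    simp [unitsTwist, ht2]
  simp only [h1]
  rw [integral_mulHaar dx hdt (fun x : K => (α : ℂ) * (localModule x *
      (φ x * quasiChar χ (1 / 2) x)))]
  have h2 : ∫ x, (localModule x)⁻¹ • ((α : ℂ) * (localModule x *
      (φ x * quasiChar χ (1 / 2) x))) ∂dx = α * zetaIntegral dx φ χ (1 / 2) := by
    unfold zetaIntegral
    rw [← integral_const_mul]
    refine integral_congr_ae ?_
    filter_upwards [ae_ne_zero_addHaar dx] with x hx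
    have hm' : (localModule x : ℂ) ≠ 0 := by exact_mod_cast (localModule_pos hx).ne'
    rw [Complex.real_smul, Complex.ofReal_inv]
    field_simp
  rw [h2, Complex.real_smul]
  have hα' : (α : ℂ) ≠ 0 := by exact_mod_cast hα.ne'
  push_cast
  field_simp

variable {v : LocalPlace K} (hv : v.Regular)

theorem transform_schwartz {u : Lp ℂ 2 dx} {φ : K → ℂ} (hu : u =ᵐ[dx] φ) (hφ : IsModerate φ) :
    M (T u) =ᵐ[μ] fun χ => (α : ℂ)⁻¹ * zetaIntegral dx φ χ (1 / 2) :=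
  transform_eq_zeta dx hα hdt hT hM hu
    (hφ.integrable_zeta dx 1 (by norm_num) (by norm_num))

theorem transform_log_schwartz {u : Lp ℂ 2 dx} {φ : K → ℂ}
    (hu : u =ᵐ[dx] fun x => (Real.log (localModule x) : ℂ) * φ x) (hφ : IsModerate φ) :
    M (T u) =ᵐ[μ] fun χ => (α : ℂ)⁻¹ * zetaLogIntegral dx φ χ (1 / 2) := by
  have e : ∀ (χ : PontryaginDual Kˣ) (x : K), (Real.log (localModule x) : ℂ) * φ x *
      quasiChar χ (1 / 2) x =
      φ x * (quasiChar χ (1 / 2) x * (Real.log (localModule x) : ℂ)) := fun χ x => by ring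
  refine (transform_eq_zeta dx hα hdt hT hM hu ?_).trans (.of_forall fun χ => ?_)
  · simp_rw [e]
    exact hφ.integrable_zetaLog dx 1 (by norm_num) (by norm_num)
  · simp only [zetaIntegral, zetaLogIntegral, e]

include hv

theorem denseRange_transport : DenseRange fun φ => T (schwartzToLp hv dx φ) :=
  T.surjective.denseRange.comp (denseRange_schwartzToLp hv dx) T.continuous

/-- The inversion of the group is transported to the inversion of its dual. -/
theorem transform_comp_inv {R : Lp ℂ 2 dt ≃ₗᵢ[ℂ] Lp ℂ 2 dt}
    (hR : ∀ f : Lp ℂ 2 dt, R f =ᵐ[dt] fun t => f t⁻¹) {R' : Lp ℂ 2 μ ≃ₗᵢ[ℂ] Lp ℂ 2 μ}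
    (hR' : ∀ f : Lp ℂ 2 μ, R' f =ᵐ[μ] fun χ => f χ⁻¹) (f : Lp ℂ 2 dt) : M (R f) = R' (M f) := by
  have hinvt := (Measure.measurePreserving_inv dt).quasiMeasurePreserving
  have hinvμ := (Measure.measurePreserving_inv μ).quasiMeasurePreserving
  -- On the dense image of the Schwartz–Bruhat functions `M` is given by an integral, and there the
  -- claim is the substitution `t ↦ t⁻¹`.
  refine congrFun (f := fun f => M (R f)) (g := fun f => R' (M f))
    ((denseRange_transport dx hα hdt hT hM hv).equalizer
    (M.continuous.comp R.continuous) (R'.continuous.comp M.continuous) ?_) f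
  ext1 φ
  set g := T (schwartzToLp hv dx φ) with hg
  have hgi : Integrable g dt := integrable_transport dx hα hdt hT (coeFn_schwartzToLp hv dx φ)
    ((hv.moderate φ φ.2).integrable_zeta dx 1 (by norm_num) (by norm_num))
  have hRi : Integrable (R g) dt := by
    rw [integrable_congr (hR g)]
    exact hgi.comp_inv
  refine Lp.ext ?_
  change M (R g) =ᵐ[μ] R' (M g)
  filter_upwards [hM _ hRi, hR' (M g), hinvμ.ae (hM g hgi)] with χ h1 h2 h3
  rw [h1, h2, h3]
  unfold mulFourier
  rw [← integral_inv_eq_self _ dt]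
  refine integral_congr_ae ?_
  filter_upwards [hinvt.ae (hR g)] with t ht
  rw [ht, inv_inv, map_inv]
  rfl

variable (hF : ∀ φ, IsSchwartzBruhat v φ → ∀ x, addFourier v dx (addFourier v dx φ) x = φ (-x))
  {F : Lp ℂ 2 dx ≃ₗᵢ[ℂ] Lp ℂ 2 dx} (hFS : ∀ φ : schwartzBruhat hv, F (schwartzToLp hv dx φ) =
      schwartzToLp hv dx (schwartzFourier hv dx φ))

include hFS in
/-- The transport of the additive Fourier transform. -/
theorem transform_fourier (u : Lp ℂ 2 dx) :
    ∀ᵐ χ ∂μ, M (T (F u)) χ = tateGamma v dx χ (1 / 2) * M (T u) χ⁻¹ := by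
  obtain ⟨R', hR'⟩ := exists_inv_isometry μ
  have hinvμ := (Measure.measurePreserving_inv μ).quasiMeasurePreserving
  have h := ae_eq_mul_of_dense (ν := μ) (schwartzToLp hv dx) (denseRange_schwartzToLp hv dx)
    (fun u => M (T (F u))) (fun u => R' (M (T u)))
    (M.continuous.comp (T.continuous.comp F.continuous))
    (R'.continuous.comp (M.continuous.comp T.continuous))
    (fun χ => tateGamma v dx χ (1 / 2)) (fun φ => ?_) u
  · filter_upwards [h, hR' (M (T u))] with χ h1 h2
    rw [h1, h2]
  · have h1 := transform_schwartz dx hα hdt hT hM (coeFn_schwartzToLp hv dx φ)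
      (hv.moderate φ φ.2)
    have h2 := transform_schwartz dx hα hdt hT hM
      (coeFn_schwartzToLp hv dx (schwartzFourier hv dx φ)) (hv.moderate _ (hv.fourier dx φ φ.2))
    filter_upwards [h2, hinvμ.ae h1, hR' (M (T (schwartzToLp hv dx φ)))] with χ e1 e2 e3
    rw [hFS, e1, e3, e2]
    have e4 := zeta_addFourier hv dx χ (s := 1 / 2) (by norm_num) (by norm_num) φ.2
    rw [show (1 : ℂ) - 1 / 2 = 1 / 2 by norm_num] at e4
    have e5 : ((schwartzFourier hv dx φ : schwartzBruhat hv) : K → ℂ) = addFourier v dx φ := rfl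
    rw [e5, e4]
    ring

include hF hFS in
/-- The transport of the conductor operator. -/
theorem transform_conductor (hFL : IsFourierL2 v dx F) {φ : K → ℂ} (hφ : IsSchwartzBruhat v φ) :
    ∃ w : Lp ℂ 2 dx, w =ᵐ[dx] conductorOp v dx φ ∧
      ∀ᵐ χ ∂μ, M (T w) χ = -tateLambda v dx χ (1 / 2) *
        M (T (schwartzToLp hv dx ⟨φ, hφ⟩)) χ := by
  have hinvμ := (Measure.measurePreserving_inv μ).quasiMeasurePreserving
  -- With `φ = 𝓕ψ` one has `Hφ = log|x| φ + 𝓕(log|y| ψ)`, and both terms are square integrable.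
  obtain ⟨ψ, hψ, hψφ, hψi⟩ := addFourier_surjective hv dx hF hφ
  have ha := (hv.moderate φ hφ).memLp_log_mul dx
  have hb := (hv.moderate ψ hψ).memLp_log_mul dx
  have hbi := (hv.moderate ψ hψ).integrable_log_mul dx
  set a := ha.toLp _ with ha'
  set b := hb.toLp _ with hb'
  have hFb : F b =ᵐ[dx] addFourier v dx (fun y => (Real.log (localModule y) : ℂ) * ψ y) := by
    refine (hFL b ((integrable_congr hb.coeFn_toLp).2 hbi)).trans (.of_forall fun x => ?_)
    refine integral_congr_ae ?_
    filter_upwards [hb.coeFn_toLp] with y hy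
    rw [hy]
  refine ⟨a + F b, ?_, ?_⟩
  · filter_upwards [Lp.coeFn_add a (F b), ha.coeFn_toLp, hFb] with x h1 h2 h3
    rw [h1, Pi.add_apply, h2, h3, conductorOp, hψi]
  · have ea := transform_log_schwartz dx hα hdt hT hM ha.coeFn_toLp (hv.moderate φ hφ)
    have eb := transform_log_schwartz dx hα hdt hT hM hb.coeFn_toLp (hv.moderate ψ hψ)
    have eφ := transform_schwartz dx hα hdt hT hM (coeFn_schwartzToLp hv dx ⟨φ, hφ⟩)
      (hv.moderate φ hφ)
    have eF := transform_fourier dx hα hdt hT hM hv hFS b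
    have hadd : M (T (a + F b)) = M (T a) + M (T (F b)) := by rw [map_add, map_add]
    rw [hadd]
    filter_upwards [Lp.coeFn_add (M (T a)) (M (T (F b))), ea, hinvμ.ae eb, eφ, eF]
      with χ h1 h2 h3 h4 h5
    rw [h1, Pi.add_apply, h2, h5, h3, h4]
    have hs : 0 < (1 / 2 : ℂ).re := by norm_num
    have hs1 : (1 / 2 : ℂ).re < 1 := by norm_num
    -- The differentiated functional equation contains `-Γ Z_log(ψ, χ⁻¹)`, which the contribution of
    -- `F b` cancels; `Γ' Z(ψ, χ⁻¹) = (Γ'/Γ) Z(φ, χ)` remains.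
    have e1 := zetaLog_addFourier hv dx χ hs hs1 hψ
    have e2 := zeta_addFourier hv dx χ hs hs1 hψ
    rw [show (1 : ℂ) - 1 / 2 = 1 / 2 by norm_num, hψφ] at e1 e2
    have hne := tateGamma_ne_zero hv dx hF χ hs hs1
    simp only [tateLambda, neg_neg]
    rw [e1, e2]
    field_simp
    ring

end Transform

end Main

/-! ### The transport statements at a regular place. -/

section Assembly

variable {K : Type*} [NormedField K] [ProperSpace K] [hK : Fact (∃ p : K, p ≠ 0 ∧ ‖p‖ < 1)]
variable [MeasurableSpace K] [BorelSpace K]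
  [MeasurableSpace (PontryaginDual Kˣ)] [BorelSpace (PontryaginDual Kˣ)]
variable (dx : Measure K) [dx.IsAddHaarMeasure] {dt : Measure Kˣ} [dt.IsHaarMeasure]
  {μ : Measure (PontryaginDual Kˣ)} [μ.IsHaarMeasure] {α : ℝ}

/-- On the units `x ↦ x⁻¹` preserves `dx/|x|`, which has the same null sets as `dx`. -/
theorem quasiMeasurePreserving_inv_addHaar :
    Measure.QuasiMeasurePreserving (Inv.inv : K → K) dx dx where
  measurable := measurable_inv
  absolutelyContinuous := by
    refine Measure.AbsolutelyContinuous.mk fun s hs h0 => ?_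
    rw [Measure.map_apply measurable_inv hs]
    obtain ⟨α, hα, hdt⟩ := exists_mulHaar_eq dx (mulHaarOfAdd dx)
    have hinv := (Measure.measurePreserving_inv (mulHaarOfAdd dx)).quasiMeasurePreserving
    have h1 : ∀ᵐ x ∂dx, x ∉ s := measure_eq_zero_iff_ae_notMem.1 h0
    have h2 := hinv.ae ((ae_mulHaar_iff dx hα hdt (fun x => x ∉ s)).2 h1)
    simp only [Units.val_inv_eq_inv_val] at h2
    exact measure_eq_zero_iff_ae_notMem.2
      ((ae_mulHaar_iff dx hα hdt (fun x => x⁻¹ ∉ s)).1 h2)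

theorem inversionFun_congr_ae {φ ψ : K → ℂ} (h : φ =ᵐ[dx] ψ) :
    inversionFun φ =ᵐ[dx] inversionFun ψ := by
  filter_upwards [(quasiMeasurePreserving_inv_addHaar dx).ae h] with x hx
  rw [inversionFun, hx, inversionFun]

/-- Since `√|t| · |t|⁻¹ = √|t⁻¹|`, the twist absorbs the factor of the Inversion and leaves `t ↦
t⁻¹`. -/
theorem isInversionL2_conj (hα : 0 < α)
    (hdt : dt = ENNReal.ofReal (α ^ 2)⁻¹ • mulHaarOfAdd dx)
    {T : Lp ℂ 2 dx ≃ₗᵢ[ℂ] Lp ℂ 2 dt} (hT : ∀ φ : Lp ℂ 2 dx, T φ =ᵐ[dt] unitsTwist α φ)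
    {R : Lp ℂ 2 dt ≃ₗᵢ[ℂ] Lp ℂ 2 dt} (hR : ∀ f : Lp ℂ 2 dt, R f =ᵐ[dt] fun t => f t⁻¹) :
    IsInversionL2 dx (T.trans (R.trans T.symm)) := by
  intro φ
  set ψ := (T.trans (R.trans T.symm)) φ with hψ
  have h1 : T ψ = R (T φ) := by simp [hψ]
  have hinv := (Measure.measurePreserving_inv dt).quasiMeasurePreserving
  refine (ae_mulHaar_iff dx hα hdt (fun x => ψ x = inversionFun φ x)).1 ?_
  filter_upwards [hT ψ, hR (T φ), hinv.ae (hT φ)] with t e1 e2 e3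
  rw [h1, e2, e3] at e1
  simp only [unitsTwist, Units.val_inv_eq_inv_val, localModule_inv] at e1
  have hm := localModule_units_pos t
  have hs := Real.sqrt_pos.2 hm
  have hne : ((α * √(localModule (t : K)) : ℝ) : ℂ) ≠ 0 := by
    exact_mod_cast (mul_pos hα hs).ne'
  refine mul_left_cancel₀ hne ?_
  rw [← e1, inversionFun, ← mul_assoc, ← Complex.ofReal_mul]
  congr 2
  rw [Real.sqrt_inv, mul_assoc]
  congr 1
  nth_rewrite 3 [← Real.mul_self_sqrt hm.le]
  field_simp

/-- The transport statements at a regular place, the Plancherel theorem being granted by one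
invertible function and enough characters. -/
theorem transport_of_regular {v : LocalPlace K} (hv : v.Regular) (hF : ∀ φ, IsSchwartzBruhat v φ →
      ∀ x, addFourier v dx (addFourier v dx φ) x = φ (-x)) (hμ : IsDualHaar dt μ)
    (hsep : ∀ x y : Kˣ, x ≠ y → ∃ χ : PontryaginDual Kˣ, χ x ≠ χ y)
    {k : Kˣ → ℂ} (hk : k ∈ fourierInvertible dt μ) (hk0 : k ≠ 0) :
    ∃ (T : Lp ℂ 2 dx ≃ₗᵢ[ℂ] Lp ℂ 2 dt) (M : Lp ℂ 2 dt ≃ₗᵢ[ℂ] Lp ℂ 2 μ)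
      (J F : Lp ℂ 2 dx ≃ₗᵢ[ℂ] Lp ℂ 2 dx),
      IsAddMulIsometry dx dt T ∧ IsPlancherelIsometry dt μ M ∧
      IsInversionL2 dx J ∧ IsFourierL2 v dx F ∧
      (∀ f : Lp ℂ 2 μ, ∀ᵐ χ ∂μ, M (T (J (T.symm (M.symm f)))) χ = f χ⁻¹) ∧
      (∀ f : Lp ℂ 2 μ, ∀ᵐ χ ∂μ,
        M (T (F (T.symm (M.symm f)))) χ = tateGamma v dx χ (1 / 2) * f χ⁻¹) ∧
      (∀ φ : K → ℂ, IsSchwartzBruhat v φ →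
        ∃ u w : Lp ℂ 2 dx, u =ᵐ[dx] φ ∧ w =ᵐ[dx] conductorOp v dx φ ∧
          ∀ᵐ χ ∂μ, M (T w) χ = -tateLambda v dx χ (1 / 2) * M (T u) χ) ∧
      (∀ χ : PontryaginDual Kˣ, (tateLambda v dx χ (1 / 2)).im = 0) ∧
      (∀ φ : K → ℂ, IsSchwartzBruhatZero v φ →
        IsSchwartzBruhatZero v (inversionFun φ) ∧
          conductorOp v dx (inversionFun φ) =ᵐ[dx] inversionFun (conductorOp v dx φ)) := by
  obtain ⟨α, hα, hdt⟩ := exists_mulHaar_eq dx dt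
  obtain ⟨T, hT⟩ := exists_isAddMulIsometry dx hα hdt
  obtain ⟨M, hM'⟩ := exists_plancherel_isometry dt μ hμ.2 hsep hk hk0
  -- `mulFourier` and `dualFourier` agree by definition.
  have hM : IsPlancherelIsometry dt μ M := hM'
  obtain ⟨F, hFL, hFS⟩ := exists_fourierL2 hv dx hF
  obtain ⟨R, hR⟩ := exists_inv_isometry dt
  obtain ⟨R', hR'⟩ := exists_inv_isometry μ
  have hMR := transform_comp_inv dx hα hdt hT hM hv hR hR'
  have hJ := isInversionL2_conj dx hα hdt hT hR
  set J := T.trans (R.trans T.symm) with hJdef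
  have hTJ : ∀ u, M (T (J u)) = R' (M (T u)) := fun u => by
    rw [← hMR]
    simp [hJdef]
  refine ⟨T, M, J, F, ⟨α, hα, hdt, hT⟩, hM, hJ, hFL, fun f => ?_, fun f => ?_, fun φ hφ => ?_,
    tateLambda_im hv dx hF, fun φ hφ => ⟨hv.inversion φ hφ, ?_⟩⟩
  · rw [hTJ, LinearIsometryEquiv.apply_symm_apply, LinearIsometryEquiv.apply_symm_apply]
    exact hR' f
  · simpa using transform_fourier dx hα hdt hT hM hv hFS (T.symm (M.symm f))
  · obtain ⟨w, hw1, hw2⟩ := transform_conductor dx hα hdt hT hM hv hF hFS hFL hφ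
    exact ⟨_, w, coeFn_schwartzToLp hv dx ⟨φ, hφ⟩, hw1, hw2⟩
  · obtain ⟨w, hw1, hw2⟩ := transform_conductor dx hα hdt hT hM hv hF hFS hFL hφ.1
    obtain ⟨w', hw1', hw2'⟩ := transform_conductor dx hα hdt hT hM hv hF hFS hFL
      (hv.inversion φ hφ).1
    have e1 : schwartzToLp hv dx ⟨inversionFun φ, (hv.inversion φ hφ).1⟩ =
        J (schwartzToLp hv dx ⟨φ, hφ.1⟩) := by
      refine Lp.ext ((coeFn_schwartzToLp hv dx _).trans (Filter.EventuallyEq.symm ?_))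
      exact (hJ _).trans (inversionFun_congr_ae dx (coeFn_schwartzToLp hv dx _))
    have hinvμ := (Measure.measurePreserving_inv μ).quasiMeasurePreserving
    -- The Inversion is `χ ↦ χ⁻¹` on transforms and the multiplier is invariant under it, so both
    -- sides have the same transform.
    have e2 : w' = J w := by
      refine T.injective (M.injective (Lp.ext ?_))
      rw [hTJ]
      rw [e1, hTJ] at hw2'
      filter_upwards [hw2', hR' (M (T w)), hinvμ.ae hw2,
        hR' (M (T (schwartzToLp hv dx ⟨φ, hφ.1⟩)))] with χ h1 h2 h3 h4
      rw [h1, h2, h3, h4, tateLambda_inv hv dx hF]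
    rw [e2] at hw1'
    exact hw1'.symm.trans ((hJ w).trans (inversionFun_congr_ae dx hw1))

end Assembly

/-! ### The additive character at a finite place. -/

theorem norm_sub_le_max_ultra {E : Type*} [SeminormedAddCommGroup E] [IsUltrametricDist E]
    (x y : E) : ‖x - y‖ ≤ max ‖x‖ ‖y‖ := by
  simpa [sub_eq_add_neg] using IsUltrametricDist.norm_add_le_max x (-y)

section PadicChar

variable (p : ℕ) [hp : Fact p.Prime]

theorem exists_padicPolarPart_eq (a : ℚ_[p]) : ∃ m n : ℕ, padicPolarPart p a = m / (p : ℚ) ^ n :=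
  ⟨_, _, rfl⟩

/-- `appr n` agrees with `a p ^ n` modulo `p ^ n`, and dividing by `p ^ n` leaves an integral
remainder. -/
theorem norm_sub_padicPolarPart_le (a : ℚ_[p]) : ‖a - (padicPolarPart p a : ℚ_[p])‖ ≤ 1 := by
  set n := (-a.valuation).toNat with hn
  set b : ℤ_[p] := ⟨a * (p : ℚ_[p]) ^ n, norm_mul_p_pow_le_one p a⟩ with hb
  have hp0 : (p : ℚ_[p]) ≠ 0 := by exact_mod_cast hp.out.ne_zero
  have h1 : ‖b - (b.appr n : ℤ_[p])‖ ≤ (p : ℝ) ^ (-n : ℤ) :=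
    (PadicInt.norm_le_pow_iff_mem_span_pow _ n).2 (PadicInt.appr_spec n b)
  have h2 : a - (padicPolarPart p a : ℚ_[p]) =
      ((b - (b.appr n : ℤ_[p]) : ℤ_[p]) : ℚ_[p]) / (p : ℚ_[p]) ^ n := by
    have : (padicPolarPart p a : ℚ_[p]) = (b.appr n : ℚ_[p]) / (p : ℚ_[p]) ^ n := by
      rw [show padicPolarPart p a = (b.appr n : ℚ) / (p : ℚ) ^ n from rfl]
      push_cast
      rfl
    rw [this, PadicInt.coe_sub, sub_div, PadicInt.coe_natCast, hb]
    field_simp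
  have hpr : (0 : ℝ) < p := by exact_mod_cast hp.out.pos
  rw [h2, norm_div, norm_pow, Padic.norm_p, ← PadicInt.norm_def, div_le_one (by positivity)]
  simpa [zpow_neg] using h1

theorem exists_int_eq_of_norm_le_one {q : ℚ} {m : ℤ} {n : ℕ} (hq : q = m / (p : ℚ) ^ n)
    (h : ‖(q : ℚ_[p])‖ ≤ 1) : ∃ z : ℤ, q = z := by
  have hpr : (0 : ℝ) < p := by exact_mod_cast hp.out.pos
  have h1 : ‖(m : ℚ_[p])‖ ≤ (p : ℝ) ^ (-n : ℤ) := by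
    rw [hq] at h
    push_cast at h
    rw [norm_div, norm_pow, Padic.norm_p, div_le_one (by positivity)] at h
    simpa [zpow_neg] using h
  obtain ⟨z, hz⟩ := (Padic.norm_int_le_pow_iff_dvd m n).1 h1
  refine ⟨z, ?_⟩
  have hp0 : (p : ℚ) ≠ 0 := by exact_mod_cast hp.out.ne_zero
  rw [hq, hz]
  push_cast
  field_simp

/-- The combination is a rational number whose denominator is a power of `p`, and it is `p`-integral
because it is a combination of three integral remainders; so it is an integer. -/
theorem padicPolarPart_add (a b : ℚ_[p]) :
    ∃ z : ℤ, padicPolarPart p a + padicPolarPart p b - padicPolarPart p (a + b) = z := by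
  obtain ⟨m₁, n₁, h₁⟩ := exists_padicPolarPart_eq p a
  obtain ⟨m₂, n₂, h₂⟩ := exists_padicPolarPart_eq p b
  obtain ⟨m₃, n₃, h₃⟩ := exists_padicPolarPart_eq p (a + b)
  have hp0 : (p : ℚ) ≠ 0 := by exact_mod_cast hp.out.ne_zero
  refine exists_int_eq_of_norm_le_one p (m := m₁ * p ^ (n₂ + n₃) + m₂ * p ^ (n₁ + n₃) -
    m₃ * p ^ (n₁ + n₂)) (n := n₁ + n₂ + n₃) ?_ ?_
  · rw [h₁, h₂, h₃]
    push_cast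
    field_simp
    ring
  · have e : ((padicPolarPart p a + padicPolarPart p b - padicPolarPart p (a + b) : ℚ) : ℚ_[p]) =
        ((a + b - (padicPolarPart p (a + b) : ℚ_[p])) - (a - (padicPolarPart p a : ℚ_[p]))) -
          (b - (padicPolarPart p b : ℚ_[p])) := by
      push_cast
      ring
    rw [e]
    have key : ∀ x y : ℚ_[p], ‖x‖ ≤ 1 → ‖y‖ ≤ 1 → ‖x - y‖ ≤ 1 := fun x y hx hy =>
      (norm_sub_le_max_ultra x y).trans (max_le hx hy)
    exact key _ _ (key _ _ (norm_sub_padicPolarPart_le p _) (norm_sub_padicPolarPart_le p _))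
      (norm_sub_padicPolarPart_le p _)

theorem exp_two_pi_rat_eq_one_iff (q : ℚ) :
    Complex.exp (2 * Real.pi * Complex.I * (q : ℂ)) = 1 ↔ ∃ z : ℤ, q = z := by
  rw [Complex.exp_eq_one_iff]
  have hne : (2 * Real.pi * Complex.I : ℂ) ≠ 0 := by simp [Real.pi_ne_zero]
  refine exists_congr fun z => ?_
  rw [mul_comm (z : ℂ), mul_right_inj' hne]
  norm_cast

/-- The standard additive character of `ℚ_p`. -/
noncomputable def padicChar (a : ℚ_[p]) : ℂ :=
  Complex.exp (2 * Real.pi * Complex.I * (padicPolarPart p a : ℂ))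

theorem padicChar_add (a b : ℚ_[p]) : padicChar p (a + b) = padicChar p a * padicChar p b := by
  obtain ⟨z, hz⟩ := padicPolarPart_add p a b
  have h := (exp_two_pi_rat_eq_one_iff _).2 ⟨z, hz⟩
  unfold padicChar
  rw [← Complex.exp_add, ← mul_one (Complex.exp _), ← h, ← Complex.exp_add]
  congr 1
  push_cast
  ring

theorem padicChar_eq_one_iff (a : ℚ_[p]) : padicChar p a = 1 ↔ ‖a‖ ≤ 1 := by
  unfold padicChar
  rw [exp_two_pi_rat_eq_one_iff]
  have h := norm_sub_padicPolarPart_le p a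
  constructor
  · rintro ⟨z, hz⟩
    have h2 : ‖(padicPolarPart p a : ℚ_[p])‖ ≤ 1 := by
      rw [hz]
      push_cast
      exact Padic.norm_int_le_one z
    have := IsUltrametricDist.norm_add_le_max (a - (padicPolarPart p a : ℚ_[p]))
      (padicPolarPart p a : ℚ_[p])
    rw [sub_add_cancel] at this
    exact this.trans (max_le h h2)
  · intro ha
    obtain ⟨m, n, e⟩ := exists_padicPolarPart_eq p a
    refine exists_int_eq_of_norm_le_one p (m := m) (n := n) (by simpa using e) ?_
    have := norm_sub_le_max_ultra a (a - (padicPolarPart p a : ℚ_[p]))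
    rw [sub_sub_cancel] at this
    exact this.trans (max_le ha h)

theorem norm_padicChar (a : ℚ_[p]) : ‖padicChar p a‖ = 1 := by
  unfold padicChar
  rw [Complex.norm_exp]
  simp

variable {K : Type*} [NormedField K] (algP : NormedAlgebra ℚ_[p] K)
  (fin : FiniteDimensional ℚ_[p] K)

theorem basicChar_finite (x : K) :
    basicChar (.finite p hp algP fin) x = padicChar p (Algebra.trace ℚ_[p] K x) := rfl

include fin in
theorem exists_ball_basicChar_eq_one :
    ∃ δ > 0, ∀ x : K, ‖x‖ < δ → basicChar (.finite p hp algP fin) x = 1 := by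
  have hc : Continuous (Algebra.trace ℚ_[p] K) := LinearMap.continuous_of_finiteDimensional _
  have h0 : ∀ᶠ x in nhds (0 : K), ‖Algebra.trace ℚ_[p] K x‖ < 1 := by
    refine hc.norm.continuousAt.eventually_lt continuousAt_const ?_
    simp
  obtain ⟨δ, hδ, h⟩ := Metric.eventually_nhds_iff.1 h0
  refine ⟨δ, hδ, fun x hx => ?_⟩
  rw [basicChar_finite, padicChar_eq_one_iff]
  exact (h (by simpa using hx)).le

theorem exists_basicChar_ne_one : ∃ z : K, basicChar (.finite p hp algP fin) z ≠ 1 := by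
  obtain ⟨x, hx⟩ : ∃ x : K, Algebra.trace ℚ_[p] K x ≠ 0 := by
    by_contra! h
    exact Algebra.trace_ne_zero ℚ_[p] K (LinearMap.ext h)
  -- The multiple of `x` whose trace is `p⁻¹`, which is not integral.
  refine ⟨((p : ℚ_[p])⁻¹ / Algebra.trace ℚ_[p] K x) • x, ?_⟩
  rw [basicChar_finite, Ne, padicChar_eq_one_iff, map_smul, smul_eq_mul, div_mul_cancel₀ _ hx,
    norm_inv, Padic.norm_p, inv_inv, not_le]
  exact_mod_cast hp.out.one_lt

include algP in
theorem isUltrametricDist_of_normedAlgebra_padic : IsUltrametricDist K := by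
  refine IsUltrametricDist.isUltrametricDist_of_forall_norm_natCast_le_one fun n => ?_
  have h : ((n : ℚ_[p]) : ℚ_[p]) = ((n : ℤ) : ℚ_[p]) := by simp
  rw [← map_natCast (algebraMap ℚ_[p] K) n, norm_algebraMap', h]
  exact Padic.norm_int_le_one n

end PadicChar

/-! ### Schwartz–Bruhat functions at a finite place. -/

section LocallyConstant

variable {K : Type*} [NormedField K] [ProperSpace K]

theorem isLocallyConstant_of_translation {φ : K → ℂ} {δ : ℝ} (hδ : 0 < δ)
    (h : ∀ x t, ‖t‖ < δ → φ (x + t) = φ x) : IsLocallyConstant φ := by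
  rw [IsLocallyConstant.iff_eventually_eq]
  intro x
  filter_upwards [Metric.ball_mem_nhds x hδ] with y hy
  rw [mem_ball_iff_norm] at hy
  simpa using h x (y - x) hy

/-- A Lebesgue number for the cover of the compact support by the open level sets is a uniform
period for translations. -/
theorem IsLocallyConstant.exists_translation {φ : K → ℂ} (h1 : IsLocallyConstant φ)
    (h2 : HasCompactSupport φ) : ∃ δ > 0, ∀ x t, ‖t‖ < δ → φ (x + t) = φ x := by
  obtain ⟨δ, hδ, h⟩ := lebesgue_number_lemma_of_metric h2 (c := fun z : ℂ => {x | φ x = z})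
    h1.isOpen_fiber (fun x _ => Set.mem_iUnion.2 ⟨φ x, rfl⟩)
  have key : ∀ x ∈ tsupport φ, ∀ t, ‖t‖ < δ → φ (x + t) = φ x := by
    intro x hx t ht
    obtain ⟨z, hz⟩ := h x hx
    have a1 : φ x = z := hz (Metric.mem_ball_self hδ)
    have a2 : φ (x + t) = z := hz (by simpa using ht)
    rw [a1, a2]
  refine ⟨δ, hδ, fun x t ht => ?_⟩
  by_cases hx : x ∈ tsupport φ
  · exact key x hx t ht
  -- If the translation enters the support from outside, apply the previous case to the translation
  -- back.
  · by_cases hxt : x + t ∈ tsupport φ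
    · have := key (x + t) hxt (-t) (by simpa using ht)
      rw [add_neg_cancel_right] at this
      exact this.symm
    · rw [image_eq_zero_of_notMem_tsupport hx, image_eq_zero_of_notMem_tsupport hxt]

theorem isLocallyConstant_indicator_of_translation {s : Set K} {δ : ℝ} (hδ : 0 < δ)
    (h : ∀ x t, ‖t‖ < δ → (x + t ∈ s ↔ x ∈ s)) : IsLocallyConstant (s.indicator (1 : K → ℂ)) := by
  classical
  refine isLocallyConstant_of_translation hδ fun x t ht => ?_
  simp [Set.indicator_apply, h x t ht]

/-- By the strong triangle inequality a thickening is a union of balls that are stable under small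
translations. Its indicator is therefore locally constant. -/
theorem thickening_translation [IsUltrametricDist K] (s : Set K) (δ : ℝ) (x t : K)
    (ht : ‖t‖ < δ) : x + t ∈ Metric.thickening δ s ↔ x ∈ Metric.thickening δ s := by
  simp only [Metric.mem_thickening_iff]
  refine exists_congr fun z => and_congr_right fun _ => ?_
  have e1 : dist (x + t) x < δ := by simpa using ht
  have e2 : dist x (x + t) < δ := by simpa using ht
  exact ⟨fun h => (dist_triangle_max _ _ _).trans_lt (max_lt e2 h),
    fun h => (dist_triangle_max _ _ _).trans_lt (max_lt e1 h)⟩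

variable [hK : Fact (∃ p : K, p ≠ 0 ∧ ‖p‖ < 1)] [MeasurableSpace K] [BorelSpace K]

theorem isModerate_of_hasCompactSupport {φ : K → ℂ} (h1 : Continuous φ)
    (h2 : HasCompactSupport φ) : IsModerate φ := by
  have h3 : Continuous fun x => φ x * ((1 + localModule x) ^ 3 : ℝ) :=
    h1.mul (Complex.continuous_ofReal.comp ((continuous_localModule.const_add 1).pow 3))
  obtain ⟨C, hC⟩ := h3.bounded_above_of_compact_support h2.mul_right
  refine ⟨h1, C, (norm_nonneg _).trans (hC 0), fun x => ?_⟩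
  have h := hC x
  have hm := localModule_nonneg x
  have hp : 0 < (1 + localModule x) ^ 3 := by positivity
  rw [norm_mul, Complex.norm_real, Real.norm_of_nonneg hp.le] at h
  rwa [← div_eq_mul_inv, le_div_iff₀ hp]

theorem localModule_add_eq [IsUltrametricDist K] {x t : K} (h : ‖t‖ < ‖x‖) :
    localModule (x + t) = localModule x := by
  obtain ⟨d, hd, e⟩ := exists_localModule_eq_norm_rpow (K := K)
  rw [e, e, IsUltrametricDist.norm_add_eq_max_of_norm_ne_norm h.ne', max_eq_left h.le]

/-- The inversion of a function with compact support in `K ∖ {0}` has the same property. -/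
theorem hasCompactSupport_inversionFun {φ : K → ℂ} (h : ∀ᶠ x in nhds (0 : K), φ x = 0) :
    HasCompactSupport (inversionFun φ) := by
  obtain ⟨δ, hδ, h⟩ := Metric.eventually_nhds_iff.1 h
  refine HasCompactSupport.intro (isCompact_closedBall (0 : K) (δ⁻¹)) fun x hx => ?_
  rw [mem_closedBall_zero_iff, not_le] at hx
  have h1 : φ x⁻¹ = 0 := h (by
    rw [dist_zero_right, norm_inv]
    exact inv_lt_of_inv_lt₀ hδ hx)
  rw [inversionFun, h1, mul_zero]

theorem eventually_inversionFun_eq_zero {φ : K → ℂ} (h : HasCompactSupport φ) :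
    ∀ᶠ x in nhds (0 : K), inversionFun φ x = 0 := by
  obtain ⟨R, hR⟩ := h.isBounded.subset_closedBall 0
  set R' := max R 1
  have hR' : 0 < R' := lt_max_of_lt_right one_pos
  filter_upwards [Metric.ball_mem_nhds (0 : K) (inv_pos.2 hR')] with x hx
  rw [mem_ball_zero_iff] at hx
  rcases eq_or_ne x 0 with rfl | hx0
  · simp [inversionFun, localModule_zero]
  · have h2 : R' < ‖x‖⁻¹ := (lt_inv_comm₀ (norm_pos_iff.2 hx0) hR').1 hx
    have h3 : φ x⁻¹ = 0 := image_eq_zero_of_notMem_tsupport fun hm => by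
      have h1 := hR hm
      rw [mem_closedBall_zero_iff, norm_inv] at h1
      exact absurd (h1.trans (le_max_left R 1)) (not_le.2 h2)
    rw [inversionFun, h3, mul_zero]

theorem isLocallyConstant_inversionFun [IsUltrametricDist K] {φ : K → ℂ}
    (h1 : IsLocallyConstant φ) (h2 : HasCompactSupport φ) :
    IsLocallyConstant (inversionFun φ) := by
  rw [IsLocallyConstant.iff_eventually_eq]
  intro x
  rcases eq_or_ne x 0 with rfl | hx
  · filter_upwards [eventually_inversionFun_eq_zero h2] with y hy
    rw [hy, inversionFun, localModule_zero]
    simp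
  · have e1 := (continuousAt_inv₀ hx).eventually (h1.eventually_eq x⁻¹)
    filter_upwards [e1, Metric.ball_mem_nhds x (norm_pos_iff.2 hx)] with y e2 e3
    rw [mem_ball_iff_norm] at e3
    have e4 := localModule_add_eq e3
    rw [add_sub_cancel] at e4
    rw [inversionFun, e2, e4, inversionFun]

variable (dx : Measure K) [dx.IsAddHaarMeasure]

/-- A compact set is the decreasing intersection of its thickenings, whose indicators are admissible
test functions. Hence the integral of `h` over every compact set vanishes. -/
theorem ae_eq_zero_of_forall_locallyConstant [IsUltrametricDist K] {h : K → ℂ}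
    (hh : LocallyIntegrable h dx) (h0 : ∀ φ : K → ℂ, IsLocallyConstant φ → HasCompactSupport φ →
      ∫ x, h x * φ x ∂dx = 0) : h =ᵐ[dx] 0 := by
  refine ae_eq_zero_of_forall_setIntegral_isCompact_eq_zero' hh fun s hs => ?_
  set δ : ℕ → ℝ := fun n => 1 / ((n : ℝ) + 1) with hδ
  have hδ0 : ∀ n, 0 < δ n := fun n => Nat.one_div_pos_of_nat
  have h1 : ∀ n, ∫ x in Metric.thickening (δ n) s, h x ∂dx = 0 := by
    intro n
    have hb : Bornology.IsBounded (Metric.thickening (δ n) s) := hs.isBounded.thickening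
    have := h0 ((Metric.thickening (δ n) s).indicator 1)
      (isLocallyConstant_indicator_of_translation (hδ0 n)
        (thickening_translation s (δ n)))
      (HasCompactSupport.intro hb.isCompact_closure fun x hx =>
        Set.indicator_of_notMem (fun h => hx (subset_closure h)) _)
    rw [← this, ← integral_indicator Metric.isOpen_thickening.measurableSet]
    congr 1
    ext x
    by_cases hx : x ∈ Metric.thickening (δ n) s <;> simp [hx]
  have h2 := tendsto_setIntegral_of_antitone (μ := dx) (f := h)
    (s := fun n => Metric.thickening (δ n) s)
    (fun n => Metric.isOpen_thickening.measurableSet)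
    (fun m n hmn => Metric.thickening_mono (Nat.one_div_le_one_div hmn) s)
    ⟨0, (hh.integrableOn_isCompact (hs.isBounded.thickening (δ := δ 0)).isCompact_closure).mono_set
      subset_closure⟩
  simp only [h1] at h2
  have h3 : ⋂ n, Metric.thickening (δ n) s = s := by
    refine Set.Subset.antisymm (fun x hx => ?_) (Set.subset_iInter fun n =>
      Metric.self_subset_thickening (hδ0 n) s)
    rw [← hs.isClosed.closure_eq, Metric.closure_eq_iInter_thickening]
    refine Set.mem_iInter₂.2 fun ε hε => ?_
    obtain ⟨n, hn⟩ := exists_nat_one_div_lt hε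
    exact Metric.thickening_mono hn.le s (Set.mem_iInter.1 hx n)
  rw [h3] at h2
  exact tendsto_nhds_unique h2 tendsto_const_nhds |>.symm ▸ rfl

variable {p : ℕ} [hp : Fact p.Prime] (algP : NormedAlgebra ℚ_[p] K)
  (fin : FiniteDimensional ℚ_[p] K)

theorem basicChar_finite_add (x y : K) : basicChar (.finite p hp algP fin) (x + y) =
    basicChar (.finite p hp algP fin) x * basicChar (.finite p hp algP fin) y := by
  simp only [basicChar_finite, map_add, padicChar_add]

theorem isLocallyConstant_basicChar_finite :
    IsLocallyConstant (basicChar (.finite p hp algP fin) : K → ℂ) := by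
  obtain ⟨δ, hδ, h⟩ := exists_ball_basicChar_eq_one p algP fin
  refine isLocallyConstant_of_translation hδ fun x t ht => ?_
  rw [basicChar_finite_add, h t ht, mul_one]

/-- The Fourier transform exchanges the two conditions: bounded support makes the transform locally
constant, and invariance under small translations bounds its support. -/
theorem isSchwartzBruhat_addFourier_finite {φ : K → ℂ}
    (hφ : IsSchwartzBruhat (.finite p hp algP fin) φ) :
    IsSchwartzBruhat (.finite p hp algP fin) (addFourier (.finite p hp algP fin) dx φ) := by
  obtain ⟨h1, h2⟩ := hφ
  obtain ⟨R, hR⟩ := h2.isBounded.subset_closedBall 0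
  set R' := max R 1
  have hR' : 0 < R' := lt_max_of_lt_right one_pos
  obtain ⟨δ, hδ, h⟩ := exists_ball_basicChar_eq_one p algP fin
  obtain ⟨ε, hε, h3⟩ := h1.exists_translation h2
  obtain ⟨z, hz⟩ := exists_basicChar_ne_one p algP fin
  constructor
  · refine isLocallyConstant_of_translation (div_pos hδ hR') fun y t ht => ?_
    unfold addFourier
    congr 1
    ext x
    by_cases hx : x ∈ tsupport φ
    · rw [add_mul, neg_add, basicChar_finite_add, h (-(t * x)), mul_one]
      rw [norm_neg, norm_mul]
      have h4 : ‖x‖ ≤ R' := (mem_closedBall_zero_iff.1 (hR hx)).trans (le_max_left _ _)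
      calc ‖t‖ * ‖x‖ ≤ ‖t‖ * R' := by gcongr
        _ < δ / R' * R' := by gcongr
        _ = δ := div_mul_cancel₀ _ hR'.ne'
    · rw [image_eq_zero_of_notMem_tsupport hx, zero_mul, zero_mul]
  · refine HasCompactSupport.intro (isCompact_closedBall (0 : K) (‖z‖ / ε)) fun y hy => ?_
    rw [mem_closedBall_zero_iff, not_le] at hy
    have hy0 : 0 < ‖y‖ := lt_of_le_of_lt (by positivity) hy
    have hyne : y ≠ 0 := norm_pos_iff.1 hy0
    have ht : ‖-(z / y)‖ < ε := by
      rw [norm_neg, norm_div, div_lt_comm₀ hy0 hε]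
      exact hy
    -- For `‖y‖ > ‖z‖ / ε` the translation by `-(z / y)` does not change `φ` but multiplies the
    -- character by `λ(z) ≠ 1`, so the integral is zero.
    have e1 : addFourier (.finite p hp algP fin) dx φ y =
        addFourier (.finite p hp algP fin) dx φ y * basicChar (.finite p hp algP fin) z := by
      conv_lhs => rw [addFourier, ← integral_add_right_eq_self _ (-(z / y))]
      rw [addFourier, ← integral_mul_const]
      congr 1
      ext x
      rw [h3 x _ ht, mul_assoc, ← basicChar_finite_add]
      congr 2
      field_simp
      ring
    by_contra hne
    exact hz ((mul_eq_left₀ hne).1 e1.symm)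

/-- The finite places are regular. -/
theorem regular_finite : (LocalPlace.finite p hp algP fin : LocalPlace K).Regular where
  char_add := basicChar_finite_add algP fin
  norm_char x := norm_padicChar p _
  continuous_char := (isLocallyConstant_basicChar_finite algP fin).continuous
  moderate φ hφ := isModerate_of_hasCompactSupport hφ.1.continuous hφ.2
  add φ ψ hφ hψ := ⟨hφ.1.comp₂ hψ.1 (· + ·), hφ.2.add hψ.2⟩
  smul c φ hφ := ⟨hφ.1.comp (c • ·), hφ.2.comp_left (g := fun z => c • z) (smul_zero c)⟩
  conj φ hφ := ⟨hφ.1.comp _, hφ.2.comp_left (map_zero _)⟩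
  neg φ hφ := ⟨hφ.1.comp_continuous continuous_neg, hφ.2.comp_homeomorph (Homeomorph.neg K)⟩
  fourier dx _ φ hφ := isSchwartzBruhat_addFourier_finite dx algP fin hφ
  bump U hU := by
    have := isUltrametricDist_of_normedAlgebra_padic p algP
    obtain ⟨δ, hδ, h⟩ := Metric.mem_nhds_iff.1 hU
    have h1 : IsLocallyConstant ((Metric.ball (1 : K) δ).indicator (1 : K → ℂ)) := by
      rw [← Metric.thickening_singleton]
      exact isLocallyConstant_indicator_of_translation hδ (thickening_translation _ _)
    have h2 : (fun x => (((Metric.ball (1 : K) δ).indicator (1 : K → ℝ) x : ℝ) : ℂ)) =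
        (Metric.ball (1 : K) δ).indicator (1 : K → ℂ) := by
      ext x
      by_cases hx : x ∈ Metric.ball (1 : K) δ
      · rw [Set.indicator_of_mem hx, Set.indicator_of_mem hx]; simp
      · rw [Set.indicator_of_notMem hx, Set.indicator_of_notMem hx]; simp
    have h3 : (Metric.ball (1 : K) δ).indicator (1 : K → ℝ) =
        Complex.re ∘ (Metric.ball (1 : K) δ).indicator (1 : K → ℂ) := by
      rw [← h2]
      rfl
    refine ⟨(Metric.ball (1 : K) δ).indicator 1, ?_, ?_, fun x => ?_, fun x hx => ?_, ?_⟩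
    · rw [h2]
      refine ⟨h1, HasCompactSupport.intro (isCompact_closedBall (1 : K) δ) fun x hx => ?_⟩
      exact Set.indicator_of_notMem (fun h => hx (Metric.ball_subset_closedBall h)) _
    · rw [h3]
      exact (h1.comp _).continuous
    · exact Set.indicator_nonneg (fun _ _ => zero_le_one) x
    · exact Set.indicator_of_notMem (fun h' => hx (h h')) _
    · rw [Set.indicator_of_mem (Metric.mem_ball_self hδ)]
      simp
  ae_eq_zero dx _ h hh h0 := by
    have := isUltrametricDist_of_normedAlgebra_padic p algP
    exact ae_eq_zero_of_forall_locallyConstant dx hh fun φ h1 h2 => h0 φ ⟨h1, h2⟩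
  inversion φ hφ := by
    have := isUltrametricDist_of_normedAlgebra_padic p algP
    have h2 := hasCompactSupport_inversionFun hφ.2.2
    exact ⟨⟨isLocallyConstant_inversionFun hφ.1.1 hφ.1.2, h2⟩, h2,
      eventually_inversionFun_eq_zero hφ.2.1⟩

end LocallyConstant

/-! ### Schwartz functions at an archimedean place. -/

section Archimedean

variable {K : Type*} [NormedField K] [ProperSpace K] [hK : Fact (∃ p : K, p ≠ 0 ∧ ‖p‖ < 1)]
variable [MeasurableSpace K] [BorelSpace K] [algR : NormedAlgebra ℝ K]
  [fin : FiniteDimensional ℝ K]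

open scoped FourierTransform SchwartzMap ContDiff Pointwise

theorem basicChar_archimedean (x : K) : basicChar (.archimedean algR fin) x =
    Complex.exp (((2 * Real.pi * -Algebra.trace ℝ K x : ℝ) : ℂ) * Complex.I) := by
  rw [basicChar]
  congr 1
  push_cast
  ring

theorem isModerate_schwartzMap (g : 𝓢(K, ℂ)) : IsModerate (g : K → ℂ) := by
  obtain ⟨d, hd, e⟩ := exists_localModule_eq_norm_rpow (K := K)
  refine ⟨g.continuous, ?_⟩
  -- The module is `‖x‖ ^ d`, so `1 + |x| ≤ 2 (1 + ‖x‖) ^ n`; cubing gives the exponent `3 * n` and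
  -- the constant 8.
  set n := ⌈d⌉₊ with hn
  have h := fun x => SchwartzMap.one_add_le_sup_seminorm_apply (𝕜 := ℝ) (m := (3 * n, 0))
    (k := 3 * n) (n := 0) le_rfl le_rfl g x
  simp only [norm_iteratedFDeriv_zero] at h
  set C := 2 ^ (3 * n) * ((Finset.Iic (3 * n, 0)).sup
    (fun m => SchwartzMap.seminorm ℝ m.1 m.2)) g with hC
  have hC0 : 0 ≤ C := (by positivity : 0 ≤ (1 + ‖(0 : K)‖) ^ (3 * n) * ‖g 0‖).trans (h 0)
  refine ⟨8 * C, by positivity, fun x => ?_⟩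
  have h1 : 1 + localModule x ≤ 2 * (1 + ‖x‖) ^ n := by
    have h2 : localModule x ≤ (1 + ‖x‖) ^ n := by
      rw [e, ← Real.rpow_natCast]
      calc ‖x‖ ^ d ≤ (1 + ‖x‖) ^ d := by gcongr; linarith
        _ ≤ (1 + ‖x‖) ^ (n : ℝ) :=
          Real.rpow_le_rpow_of_exponent_le (by linarith [norm_nonneg x]) (Nat.le_ceil d)
    have h3 : 1 ≤ (1 + ‖x‖) ^ n := one_le_pow₀ (by linarith [norm_nonneg x])
    linarith
  have hm := localModule_nonneg x
  have h4 : (1 + localModule x) ^ 3 ≤ 8 * (1 + ‖x‖) ^ (3 * n) := by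
    calc (1 + localModule x) ^ 3 ≤ (2 * (1 + ‖x‖) ^ n) ^ 3 := by gcongr
      _ = _ := by rw [mul_pow, ← pow_mul, mul_comm n 3]; norm_num
  rw [← div_eq_mul_inv, le_div_iff₀ (by positivity)]
  calc ‖g x‖ * (1 + localModule x) ^ 3 ≤ ‖g x‖ * (8 * (1 + ‖x‖) ^ (3 * n)) := by gcongr
    _ = 8 * ((1 + ‖x‖) ^ (3 * n) * ‖g x‖) := by ring
    _ ≤ 8 * C := by gcongr; exact h x

/-- Both sides measure the effect of multiplication by `x` on volumes, the right-hand one as a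
determinant. This makes the module smooth away from the origin. -/
theorem localModule_eq_abs_norm (x : K) : localModule x = |Algebra.norm ℝ x| := by
  rcases eq_or_ne x 0 with rfl | hx
  · rw [localModule_zero, Algebra.norm_zero, abs_zero]
  let ν : Measure K := Measure.addHaar
  have h1 := addHaar_smul_units ν (Units.mk0 x hx) (Metric.closedBall 0 1)
  have h2 := Measure.addHaar_image_linearMap ν (Algebra.lmul ℝ K x) (Metric.closedBall 0 1)
  have h3 : (Units.mk0 x hx) • Metric.closedBall (0 : K) 1 =
      (Algebra.lmul ℝ K x) '' Metric.closedBall (0 : K) 1 := rfl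
  rw [h3, h2] at h1
  have h4 : ν (Metric.closedBall 0 1) ≠ 0 := (Metric.measure_closedBall_pos ν 0 one_pos).ne'
  have h5 : ν (Metric.closedBall 0 1) ≠ ⊤ := (isCompact_closedBall (0 : K) 1).measure_lt_top.ne
  have h6 := (ENNReal.mul_left_inj h4 h5).1 h1
  rw [Units.val_mk0, ENNReal.ofReal_eq_ofReal_iff (abs_nonneg _) (localModule_nonneg _)] at h6
  exact h6.symm

theorem contDiff_algebraNorm : ContDiff ℝ ∞ (Algebra.norm ℝ : K → ℝ) := by
  classical
  let b := Module.finBasis ℝ K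
  have h : (Algebra.norm ℝ : K → ℝ) = fun x => Matrix.det (Algebra.leftMulMatrix b x) :=
    funext fun x => Algebra.norm_eq_matrix_det b x
  rw [h]
  simp_rw [Matrix.det_apply]
  refine ContDiff.sum fun σ _ => ContDiff.const_smul _ (contDiff_prod fun i _ => ?_)
  let L : K →ₗ[ℝ] ℝ := (LinearMap.proj i).comp ((LinearMap.proj (σ i)).comp
    (Algebra.leftMulMatrix b).toLinearMap)
  exact (LinearMap.toContinuousLinearMap L).contDiff

theorem contDiffAt_localModule {x : K} (hx : x ≠ 0) :
    ContDiffAt ℝ ∞ (localModule : K → ℝ) x := by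
  rw [show (localModule : K → ℝ) = fun x => |Algebra.norm ℝ x| from
    funext localModule_eq_abs_norm]
  refine ContDiffAt.comp x (contDiffAt_abs ?_) contDiff_algebraNorm.contDiffAt
  have := localModule_pos hx
  rw [localModule_eq_abs_norm] at this
  exact abs_pos.1 this

theorem contDiff_inversionFun {φ : K → ℂ} (h1 : ContDiff ℝ ∞ φ) (h2 : HasCompactSupport φ) :
    ContDiff ℝ ∞ (inversionFun φ) := by
  rw [contDiff_iff_contDiffAt]
  intro x
  rcases eq_or_ne x 0 with rfl | hx
  · exact contDiffAt_const.congr_of_eventuallyEq (eventually_inversionFun_eq_zero h2)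
  · have e1 : ContDiffAt ℝ ∞ (fun x => ((localModule x)⁻¹ : ℝ)) x :=
      (contDiffAt_localModule hx).inv (localModule_pos hx).ne'
    have e2 : ContDiffAt ℝ ∞ (fun x => (((localModule x)⁻¹ : ℝ) : ℂ)) x :=
      Complex.ofRealCLM.contDiff.contDiffAt.comp x e1
    exact e2.mul (h1.contDiffAt.comp x (contDiffAt_inv ℝ hx))

/-- Nondegeneracy of the trace form allows the trace pairing to be rewritten as an inner product.
The minus sign matches `λ(-yx) = exp(2πi Tr(yx))` with the kernel `exp(-2πi⟨w, By⟩)` of the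
Euclidean Fourier transform. -/
theorem exists_traceEquiv {E : Type*} [NormedAddCommGroup E] [InnerProductSpace ℝ E]
    [FiniteDimensional ℝ E] (e : K ≃L[ℝ] E) :
    ∃ B : K ≃L[ℝ] E, ∀ y w, inner ℝ w (B y) = -Algebra.trace ℝ K (y * e.symm w) := by
  let L₀ : K →ₗ[ℝ] (E →L[ℝ] ℝ) :=
    { toFun := fun y => LinearMap.toContinuousLinearMap
        (-((Algebra.traceForm ℝ K y).comp (e.symm : E →ₗ[ℝ] K)))
      map_add' := fun y z => by ext w; simp [add_comm]
      map_smul' := fun c y => by ext w; simp }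
  let B₀ : K →ₗ[ℝ] E :=
    { toFun := fun y => (InnerProductSpace.toDual ℝ E).symm (L₀ y)
      map_add' := fun y z => by rw [map_add, map_add]
      map_smul' := fun c y => by rw [map_smul, map_smulₛₗ]; rfl }
  have hB : ∀ y w, inner ℝ w (B₀ y) = -Algebra.trace ℝ K (y * e.symm w) := by
    intro y w
    rw [real_inner_comm]
    change inner ℝ ((InnerProductSpace.toDual ℝ E).symm (L₀ y)) w = _
    rw [InnerProductSpace.toDual_symm_apply]
    rfl
  have hinj : Function.Injective B₀ := by
    refine (injective_iff_map_eq_zero B₀).2 fun y hy => ?_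
    refine (traceForm_nondegenerate ℝ K).1 y fun z => ?_
    have h := hB y (e z)
    rw [hy, inner_zero_right, e.symm_apply_apply] at h
    rw [Algebra.traceForm_apply]
    linarith
  exact ⟨(LinearMap.linearEquivOfInjective B₀ hinj
    e.toLinearEquiv.finrank_eq).toContinuousLinearEquiv, hB⟩

theorem isSchwartzBruhat_addFourier_archimedean (dx : Measure K) [dx.IsAddHaarMeasure] {φ : K → ℂ}
    (hφ : IsSchwartzBruhat (.archimedean algR fin) φ) :
    IsSchwartzBruhat (.archimedean algR fin) (addFourier (.archimedean algR fin) dx φ) := by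
  obtain ⟨g, rfl⟩ := hφ
  let e : K ≃L[ℝ] EuclideanSpace ℝ (Fin (Module.finrank ℝ K)) := toEuclidean
  obtain ⟨B, hB⟩ := exists_traceEquiv e
  have hmp := e.isAddHaarMeasure_map dx
  let g' : 𝓢(EuclideanSpace ℝ (Fin (Module.finrank ℝ K)), ℂ) :=
    SchwartzMap.compCLMOfContinuousLinearEquiv ℂ e.symm g
  obtain ⟨c, hc⟩ : ∃ c : NNReal, dx.map e = c • volume :=
    ⟨_, Measure.isAddLeftInvariant_eq_smul _ _⟩
  refine ⟨(c : ℂ) • SchwartzMap.compCLMOfContinuousLinearEquiv ℂ B (𝓕 g'), ?_⟩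
  ext y
  have e1 : addFourier (.archimedean algR fin) dx g y =
      ∫ w, g (e.symm w) * basicChar (.archimedean algR fin) (-(y * e.symm w)) ∂(dx.map e) := by
    have hem : MeasurableEmbedding e := e.toHomeomorph.measurableEmbedding
    rw [hem.integral_map]
    simp [addFourier]
  rw [e1, hc]
  have e2 : (𝓕 g') (B y) = ∫ w, g (e.symm w) *
      basicChar (.archimedean algR fin) (-(y * e.symm w)) := by
    rw [SchwartzMap.fourier_coe, Real.fourier_eq']
    congr 1
    ext w
    rw [hB, basicChar_archimedean, map_neg, smul_eq_mul, mul_comm]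
    congr 2
    push_cast
    ring
  rw [integral_smul_nnreal_measure, ← e2]
  rfl

/-- The archimedean places are regular. -/
theorem regular_archimedean : (LocalPlace.archimedean algR fin : LocalPlace K).Regular where
  char_add x y := by
    simp only [basicChar_archimedean, ← Complex.exp_add, map_add]
    congr 1
    push_cast
    ring
  norm_char x := by rw [basicChar_archimedean, Complex.norm_exp_ofReal_mul_I]
  continuous_char := by
    have h : Continuous (Algebra.trace ℝ K) := LinearMap.continuous_of_finiteDimensional _
    rw [funext basicChar_archimedean]
    fun_prop
  moderate := by
    rintro _ ⟨g, rfl⟩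
    exact isModerate_schwartzMap g
  add := by
    rintro _ _ ⟨g, rfl⟩ ⟨g', rfl⟩
    exact ⟨g + g', rfl⟩
  smul := by
    rintro c _ ⟨g, rfl⟩
    exact ⟨c • g, rfl⟩
  conj := by
    rintro _ ⟨g, rfl⟩
    exact ⟨SchwartzMap.postcompCLM (𝕜 := ℝ) Complex.conjCLE.toContinuousLinearMap g, rfl⟩
  neg := by
    rintro _ ⟨g, rfl⟩
    exact ⟨SchwartzMap.compCLMOfContinuousLinearEquiv ℂ (ContinuousLinearEquiv.neg ℝ) g, rfl⟩
  fourier dx _ φ hφ := isSchwartzBruhat_addFourier_archimedean dx hφ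
  bump U hU := by
    obtain ⟨δ, hδ, h⟩ := Metric.mem_nhds_iff.1 hU
    let f : ContDiffBump (1 : K) := ⟨δ / 2, δ, by positivity, by linarith⟩
    have h1 : ContDiff ℝ ∞ fun x => (f x : ℂ) := Complex.ofRealCLM.contDiff.comp f.contDiff
    have h2 : HasCompactSupport fun x => (f x : ℂ) :=
      f.hasCompactSupport.comp_left Complex.ofReal_zero
    refine ⟨f, ⟨h2.toSchwartzMap h1, rfl⟩, f.continuous, fun x => f.nonneg, fun x hx => ?_, ?_⟩
    · refine f.zero_of_le_dist (not_lt.1 fun h' => hx (h h'))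
    · rw [f.one_of_mem_closedBall (Metric.mem_closedBall_self (by positivity))]
      exact one_ne_zero
  ae_eq_zero dx _ h hh h0 := by
    refine ae_eq_zero_of_integral_contDiff_smul_eq_zero hh fun g hg1 hg2 => ?_
    have h1 : ContDiff ℝ ∞ fun x => (g x : ℂ) := Complex.ofRealCLM.contDiff.comp hg1
    have h2 : HasCompactSupport fun x => (g x : ℂ) := hg2.comp_left Complex.ofReal_zero
    rw [← h0 _ ⟨h2.toSchwartzMap h1, rfl⟩]
    congr 1
    ext x
    rw [Complex.real_smul, mul_comm]
    rfl
  inversion := by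
    rintro _ ⟨⟨g, rfl⟩, h2, h3⟩
    have h4 := hasCompactSupport_inversionFun h3
    exact ⟨⟨h4.toSchwartzMap (contDiff_inversionFun (g.smooth ⊤) h2), rfl⟩, h4,
      eventually_inversionFun_eq_zero h2⟩

end Archimedean

/-! ### Characters and invertible functions on the multiplicative group. -/

/-- The continuous characters of `ℝ`. -/
theorem exists_eq_circle_exp_mul (η : ℝ → Circle) (hc : Continuous η)
    (hadd : ∀ x y, η (x + y) = η x * η y) : ∃ τ : ℝ, ∀ x, η x = Circle.exp (τ * x) := by
  set f : ℝ → ℂ := fun x => (η x : ℂ) with hf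
  have hfc : Continuous f := continuous_circle_coe.comp hc
  have hfadd : ∀ x y, f (x + y) = f x * f y := fun x y => by simp [hf, hadd]
  have hf0 : f 0 = 1 := by
    have h := hadd 0 0
    rw [add_zero, left_eq_mul] at h
    simp [hf, h]
  set G : ℝ → ℂ := fun x => ∫ y in (0 : ℝ)..x, f y with hG
  have hGd : ∀ x, HasDerivAt G (f x) x := fun x =>
    intervalIntegral.integral_hasDerivAt_right (hfc.intervalIntegrable _ _)
      (hfc.stronglyMeasurableAtFilter _ _) hfc.continuousAt
  obtain ⟨a, ha⟩ : ∃ a, G a ≠ 0 := by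
    by_contra! h
    have h1 := hGd 0
    rw [funext h, hf0] at h1
    exact one_ne_zero (h1.unique (hasDerivAt_const (0 : ℝ) (0 : ℂ)))
  -- Multiplicativity gives `f(x) ∫₀ᵃ f = ∫ₓ^(x+a) f`, so `f` is as differentiable as its primitive;
  -- then `f' = c f`.
  have hfG : ∀ x, f x = (G (x + a) - G x) / G a := by
    intro x
    rw [eq_div_iff ha, hG]
    simp only
    rw [intervalIntegral.integral_interval_sub_left (hfc.intervalIntegrable _ _)
      (hfc.intervalIntegrable _ _), ← intervalIntegral.integral_const_mul]
    simp_rw [← hfadd]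
    rw [intervalIntegral.integral_comp_add_left f x, add_zero]
  have hfd : Differentiable ℝ f := by
    intro x
    rw [funext hfG]
    exact (((hGd (x + a)).comp_add_const x a).sub (hGd x)).differentiableAt.div_const _
  set c := deriv f 0 with hcd
  have hd : ∀ x, HasDerivAt f (c * f x) x := by
    intro x
    have h1 : deriv (fun y => f (x + y)) 0 = deriv f x := by
      rw [deriv_comp_const_add, add_zero]
    have h2 : deriv (fun y => f (x + y)) 0 = f x * c := by
      simp_rw [hfadd]
      rw [deriv_const_mul _ (hfd 0)]
    rw [mul_comm c, ← h2, h1]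
    exact (hfd x).hasDerivAt
  have hexp : ∀ x, f x = Complex.exp (c * x) := by
    have h1 : ∀ x, HasDerivAt (fun x : ℝ => f x * Complex.exp (-(c * x))) 0 x := by
      intro x
      have h2 : HasDerivAt (fun x : ℝ => Complex.exp (-(c * x)))
          (Complex.exp (-(c * x)) * -(c * 1)) x :=
        ((Complex.ofRealCLM.hasDerivAt (x := x)).const_mul c).neg.cexp
      exact ((hd x).mul h2).congr_deriv (by ring)
    intro x
    have h2 := is_const_of_deriv_eq_zero (fun x => (h1 x).differentiableAt)
      (fun x => (h1 x).deriv) x 0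
    simp only [hf0, Complex.ofReal_zero, mul_zero, neg_zero, Complex.exp_zero, mul_one] at h2
    rw [Complex.exp_neg] at h2
    exact (mul_inv_eq_one₀ (Complex.exp_ne_zero _)).1 h2
  have hre : c.re = 0 := by
    have h1 : ‖f 1‖ = 1 := Circle.norm_coe _
    rw [hexp, Complex.norm_exp, Complex.ofReal_one, mul_one] at h1
    exact Real.exp_eq_one_iff _ |>.1 h1
  refine ⟨c.im, fun x => Circle.ext ?_⟩
  rw [Circle.coe_exp]
  refine (hexp x).trans ?_
  congr 1
  apply Complex.ext <;> simp [hre]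

section DualGroup

variable {G : Type*} [CommGroup G] [TopologicalSpace G] [IsTopologicalGroup G]

/-- The characters trivial on an open subgroup form a compact set. -/
theorem isCompact_annihilator (U : Subgroup G) (hU : IsOpen (U : Set G)) :
    IsCompact {χ : PontryaginDual G | ∀ u ∈ U, χ u = 1} := by
  -- The annihilator is the image of the dual of the discrete quotient, which is compact.
  have hd : DiscreteTopology (G ⧸ U) := QuotientGroup.discreteTopology hU
  let π : G →ₜ* G ⧸ U := ⟨QuotientGroup.mk' U, continuous_quotient_mk'⟩
  have h : {χ : PontryaginDual G | ∀ u ∈ U, χ u = 1} = Set.range (PontryaginDual.map π) := by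
    ext χ
    constructor
    · intro hχ
      refine ⟨⟨QuotientGroup.lift U (χ : G →* Circle) hχ, continuous_of_discreteTopology⟩, ?_⟩
      ext a
      rfl
    · rintro ⟨ψ, rfl⟩ u hu
      rw [PontryaginDual.map_apply]
      have : π u = 1 := (QuotientGroup.eq_one_iff u).2 hu
      rw [this, map_one]
  rw [h]
  exact isCompact_range (PontryaginDual.map π).continuous_toFun

/-- The characters `t ↦ exp (i τ L(t))` attached to an additive function `L`. -/
noncomputable def expChar (L : G → ℝ) (hL : Continuous L) (hadd : ∀ a b, L (a * b) = L a + L b)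
    (τ : ℝ) : PontryaginDual G :=
  { toFun := fun t => Circle.exp (τ * L t)
    map_one' := by
      have h := hadd 1 1
      rw [mul_one, left_eq_add] at h
      simp [h]
    map_mul' := fun a b => by rw [hadd, mul_add, Circle.exp_add]
    continuous_toFun := Circle.exp.continuous.comp (continuous_const.mul hL) }

theorem expChar_apply {L : G → ℝ} (hL : Continuous L) (hadd : ∀ a b, L (a * b) = L a + L b)
    (τ : ℝ) (t : G) : expChar L hL hadd τ t = Circle.exp (τ * L t) := rfl

theorem continuous_expChar {L : G → ℝ} (hL : Continuous L) (hadd : ∀ a b, L (a * b) = L a + L b) :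
    Continuous (expChar L hL hadd) := by
  refine (ContinuousMonoidHom.isInducing_toContinuousMap G Circle).continuous_iff.2 ?_
  have h : Continuous fun q : ℝ × G => Circle.exp (q.1 * L q.2) :=
    Circle.exp.continuous.comp (continuous_fst.mul (hL.comp continuous_snd))
  exact (ContinuousMap.curry ⟨_, h⟩).continuous

variable [LocallyCompactSpace G] [SecondCountableTopology G] [T2Space G]
  [MeasurableSpace G] [BorelSpace G]
  [MeasurableSpace (PontryaginDual G)] [BorelSpace (PontryaginDual G)]
  (dt : Measure G) [dt.IsHaarMeasure] (μ : Measure (PontryaginDual G)) [μ.IsHaarMeasure]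

/-- Translation by `a` leaves the integral unchanged and multiplies it by `χ a`. -/
theorem dualFourier_eq_zero_of_invariant {k : G → ℂ} {χ : PontryaginDual G} {a : G}
    (hk : ∀ t, k (a * t) = k t) (ha : χ a ≠ 1) : dualFourier dt k χ = 0 := by
  have h : dualFourier dt k χ = χ a * dualFourier dt k χ := by
    conv_lhs => rw [dualFourier, ← integral_mul_left_eq_self _ a]
    rw [dualFourier, ← integral_const_mul]
    congr 1
    ext t
    rw [hk, map_mul, Circle.coe_mul]
    ring
  by_contra hne
  exact ha (Circle.ext (by simpa using (right_eq_mul₀ hne).1 h))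

theorem mem_fourierInvertible_of_isCompact {k : G → ℂ} (h1 : Continuous k) (h2 : Integrable k dt)
    {S : Set (PontryaginDual G)} (hS : IsCompact S) (h3 : ∀ χ ∉ S, dualFourier dt k χ = 0) :
    k ∈ fourierInvertible dt μ :=
  ⟨h1, h2, (continuous_dualFourier dt h2).integrable_of_hasCompactSupport
    (HasCompactSupport.intro hS h3)⟩

/-- The indicator of a compact open subgroup satisfies the inversion formula. -/
theorem indicator_mem_fourierInvertible (U : Subgroup G) (hU : IsOpen (U : Set G))
    (hUc : IsCompact (U : Set G)) : (U : Set G).indicator (1 : G → ℂ) ∈ fourierInvertible dt μ := by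
  have hcl : IsClopen (U : Set G) := ⟨hUc.isClosed, hU⟩
  refine mem_fourierInvertible_of_isCompact dt μ
    (continuous_one.indicator (by simp [hcl.frontier_eq]))
    ((integrable_indicator_iff hU.measurableSet).2 (integrableOn_const hUc.measure_lt_top.ne))
    (isCompact_annihilator U hU) fun χ hχ => ?_
  simp only [Set.mem_ofPred_eq, not_forall] at hχ
  obtain ⟨u, hu, hne⟩ := hχ
  refine dualFourier_eq_zero_of_invariant dt (a := u) (fun t => ?_) hne
  have : u * t ∈ U ↔ t ∈ U := U.mul_mem_cancel_left hu
  classical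
  simp [Set.indicator_apply, this]

/-- The characters separate the points of a group with small compact open subgroups on which the
inversion formula holds. -/
theorem exists_char_ne_of_compact_open
    (hinv : ∀ f : G → ℂ, Continuous f → Integrable f dt → Integrable (dualFourier dt f) μ →
      ∀ t, f t = ∫ χ, dualFourier dt f χ * (starRingEnd ℂ) ((χ t : Circle) : ℂ) ∂μ)
    (hU : ∀ a : G, a ≠ 1 → ∃ U : Subgroup G, IsOpen (U : Set G) ∧ IsCompact (U : Set G) ∧ a ∉ U)
    {x y : G} (hxy : x ≠ y) : ∃ χ : PontryaginDual G, χ x ≠ χ y := by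
  by_contra! h
  obtain ⟨U, h1, h2, h3⟩ := hU (x / y) (div_ne_one.2 hxy)
  have hk := indicator_mem_fourierInvertible dt μ U h1 h2
  -- If no character distinguished `x / y` from `1`, the inversion formula would give the indicator
  -- of `U` equal values at these points.
  have e1 := hinv _ hk.1 hk.2.1 hk.2.2 (x / y)
  have e2 := hinv _ hk.1 hk.2.1 hk.2.2 1
  have e3 : ∀ χ : PontryaginDual G, χ (x / y) = χ 1 := fun χ => by
    rw [map_div, h, div_self', map_one]
  simp_rw [e3] at e1
  rw [← e2, Set.indicator_of_notMem h3, Set.indicator_of_mem U.one_mem] at e1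
  simp at e1

open scoped FourierTransform SchwartzMap ContDiff

/-- On a group with a split additive function `L` of compact kernel type (the push-forward of the
Haar measure is the Lebesgue measure), suitable functions of `L` satisfy the inversion formula. -/
theorem exists_mem_fourierInvertible_of_log {L : G → ℝ} (hL : Continuous L)
    (hadd : ∀ a b, L (a * b) = L a + L b) {s : ℝ → G} (hs : Continuous s)
    (hsadd : ∀ x y, s (x + y) = s x * s y) (hLs : ∀ x, L (s x) = x) (hdt : dt.map L = volume) :
    ∃ k ∈ fourierInvertible dt μ, k ≠ 0 := by
  let f : ContDiffBump (0 : ℝ) := ⟨1, 2, one_pos, one_lt_two⟩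
  have hf1 : ContDiff ℝ ∞ fun x => (f x : ℂ) := Complex.ofRealCLM.contDiff.comp f.contDiff
  have hf2 : HasCompactSupport fun x => (f x : ℂ) :=
    f.hasCompactSupport.comp_left Complex.ofReal_zero
  let b : 𝓢(ℝ, ℂ) := hf2.toSchwartzMap hf1
  -- A Schwartz function with compactly supported Fourier transform.
  let A : 𝓢(ℝ, ℂ) := 𝓕⁻ b
  have hAb : 𝓕 A = b := FourierTransform.fourier_fourierInv_eq b
  have hb0 : b 0 ≠ 0 := by
    change (f 0 : ℂ) ≠ 0
    rw [f.one_of_mem_closedBall (Metric.mem_closedBall_self zero_le_one)]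
    simp
  have hA : ∃ x, A x ≠ 0 := by
    by_contra! h
    have h1 : A = 0 := SchwartzMap.ext h
    rw [h1] at hAb
    apply hb0
    rw [← hAb]
    simp
  have hLm : Measurable L := hL.measurable
  -- At the character `exp(iτL)` the transform is `b(-τ/2π)`; as `b` vanishes outside radius 2, only
  -- `|τ| < 4π` counts.
  refine ⟨fun t => A (L t), mem_fourierInvertible_of_isCompact dt μ (A.continuous.comp hL) ?_
    ((isCompact_Icc (a := -(4 * Real.pi)) (b := 4 * Real.pi)).image
      (continuous_expChar hL hadd)) ?_, ?_⟩
  · have h := A.integrable (μ := volume)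
    rw [← hdt, integrable_map_measure A.continuous.aestronglyMeasurable hLm.aemeasurable] at h
    exact h
  · intro χ hχ
    -- Characters trivial on the kernel of `L` factor through `L` and are some `exp(iτL)`; for the
    -- others the transform vanishes, since `A ∘ L` is invariant under the kernel.
    by_cases hker : ∀ a, L a = 0 → χ a = 1
    · have e1 : ∀ t, χ t = χ (s (L t)) := by
        intro t
        have h1 : L (t * s (-L t)) = 0 := by rw [hadd, hLs, add_neg_cancel]
        have h2 := hker _ h1
        have h3 : s (-L t) * s (L t) = 1 := by
          rw [← hsadd, neg_add_cancel]
          have := hsadd 0 0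
          rwa [add_zero, left_eq_mul] at this
        calc χ t = χ (t * s (-L t) * s (L t)) := by rw [mul_assoc, h3, mul_one]
          _ = χ (s (L t)) := by rw [map_mul, h2, one_mul]
      obtain ⟨τ, hτ⟩ := exists_eq_circle_exp_mul (fun x => χ (s x))
        ((map_continuous χ).comp hs) (fun x y => by rw [hsadd, map_mul])
      have e2 : χ = expChar L hL hadd τ := by
        ext t
        rw [e1, hτ, expChar_apply]
      have e3 : dualFourier dt (fun t => A (L t)) χ = 𝓕 A (-(τ / (2 * Real.pi))) := by
        have h1 : dualFourier dt (fun t => A (L t)) χ =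
            ∫ x, A x * (Circle.exp (τ * x) : ℂ) ∂(dt.map L) := by
          rw [integral_map hLm.aemeasurable]
          · rw [e2]
            rfl
          · exact (A.continuous.mul (continuous_circle_coe.comp (Circle.exp.continuous.comp
              (continuous_const.mul continuous_id)))).aestronglyMeasurable
        rw [h1, hdt, SchwartzMap.fourier_coe, Real.fourier_eq']
        congr 1
        ext x
        rw [Circle.coe_exp, smul_eq_mul, mul_comm]
        congr 3
        simp only [RCLike.inner_apply, conj_trivial]
        push_cast
        field_simp
      rw [e3, hAb]
      change (f _ : ℂ) = 0
      have h2 : (f (-(τ / (2 * Real.pi))) : ℝ) = 0 := by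
        refine f.zero_of_le_dist (not_lt.1 fun hlt => hχ ⟨τ, ?_, e2.symm⟩)
        change dist _ _ < 2 at hlt
        have hpi := Real.pi_pos
        rw [dist_zero_right, norm_neg, norm_div,
          Real.norm_of_nonneg (by positivity : (0 : ℝ) ≤ 2 * Real.pi),
          div_lt_iff₀ (by positivity), Real.norm_eq_abs, abs_lt] at hlt
        constructor <;> linarith
      rw [h2, Complex.ofReal_zero]
    · push Not at hker
      obtain ⟨a, ha, hne⟩ := hker
      exact dualFourier_eq_zero_of_invariant dt (a := a)
        (fun t => by simp only [hadd, ha, zero_add]) hne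
  · obtain ⟨x, hx⟩ := hA
    intro h
    have := congrFun h (s x)
    simp only [hLs] at this
    exact hx this

end DualGroup

/-! ### Compact open subgroups of the units at a finite place. -/

section FiniteUnits

variable {K : Type*} [NormedField K] [ProperSpace K] [IsUltrametricDist K]

/-- The units congruent to one modulo an open ball. -/
def principalUnits (δ : ℝ) (hδ : 0 < δ) (hδ1 : δ ≤ 1) : Subgroup Kˣ where
  carrier := {t | ‖(t : K) - 1‖ < δ}
  one_mem' := by simpa using hδ
  mul_mem' {a b} ha hb := by
    have ha' : ‖(a : K)‖ ≤ 1 := by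
      have h := IsUltrametricDist.norm_add_le_max ((a : K) - 1) 1
      rw [sub_add_cancel, norm_one] at h
      exact h.trans (max_le (ha.le.trans hδ1) le_rfl)
    have h := IsUltrametricDist.norm_add_le_max ((a : K) * (b - 1)) (a - 1)
    have e : (a : K) * (b - 1) + (a - 1) = ((a * b : Kˣ) : K) - 1 := by push_cast; ring
    rw [e, norm_mul] at h
    refine h.trans_lt (max_lt (lt_of_le_of_lt ?_ hb) ha)
    exact mul_le_of_le_one_left (norm_nonneg _) ha'
  inv_mem' {a} ha := by
    have ha' : 1 ≤ ‖(a : K)‖ := by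
      by_contra! hlt
      have h := norm_sub_le_max_ultra (a : K) ((a : K) - 1)
      rw [sub_sub_cancel, norm_one] at h
      exact absurd h (not_le.2 (max_lt hlt (lt_of_lt_of_le ha hδ1)))
    have e : ((a⁻¹ : Kˣ) : K) - 1 = -((a : K) - 1) / a := by
      rw [Units.val_inv_eq_inv_val]
      field_simp [a.ne_zero]
      ring
    change ‖((a⁻¹ : Kˣ) : K) - 1‖ < δ
    rw [e, norm_div, norm_neg]
    exact (div_le_self (norm_nonneg _) ha').trans_lt ha

theorem isOpen_principalUnits (δ : ℝ) (hδ : 0 < δ) (hδ1 : δ ≤ 1) :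
    IsOpen ((principalUnits δ hδ hδ1 : Subgroup Kˣ) : Set Kˣ) :=
  isOpen_lt (Units.continuous_val.sub continuous_const).norm continuous_const

theorem isCompact_principalUnits (δ : ℝ) (hδ : 0 < δ) (hδ1 : δ ≤ 1) :
    IsCompact ((principalUnits δ hδ hδ1 : Subgroup Kˣ) : Set Kˣ) := by
  rw [Units.isEmbedding_val₀.isCompact_iff]
  have h : Units.val '' ((principalUnits δ hδ hδ1 : Subgroup Kˣ) : Set Kˣ) = Metric.ball (1 : K) δ := by
    ext x
    constructor
    · rintro ⟨t, ht, rfl⟩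
      exact mem_ball_iff_norm.2 ht
    · intro hx
      rw [mem_ball_iff_norm] at hx
      -- The bound `δ ≤ 1` keeps the origin out of the ball, so the whole ball consists of units.
      have hx0 : x ≠ 0 := by
        rintro rfl
        rw [zero_sub, norm_neg, norm_one] at hx
        exact absurd hδ1 (not_le.2 hx)
      exact ⟨Units.mk0 x hx0, hx, rfl⟩
  rw [h]
  exact (isCompact_closedBall (1 : K) δ).of_isClosed_subset
    (IsUltrametricDist.isClosed_ball _ _) Metric.ball_subset_closedBall

theorem exists_principalUnits_notMem {a : Kˣ} (ha : a ≠ 1) : ∃ U : Subgroup Kˣ,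
    IsOpen (U : Set Kˣ) ∧ IsCompact (U : Set Kˣ) ∧ a ∉ U := by
  have h0 : 0 < ‖(a : K) - 1‖ := by
    rw [norm_pos_iff, sub_ne_zero]
    exact fun h => ha (Units.ext h)
  refine ⟨principalUnits (min 1 ‖(a : K) - 1‖) (lt_min one_pos h0) (min_le_left _ _),
    isOpen_principalUnits _ _ _, isCompact_principalUnits _ _ _, fun h => ?_⟩
  have h' : ‖(a : K) - 1‖ < min 1 ‖(a : K) - 1‖ := h
  exact lt_irrefl _ (h'.trans_le (min_le_right _ _))

end FiniteUnits

/-! ### The units at an archimedean place. -/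

section ArchimedeanUnits

variable {K : Type*} [NormedField K] [ProperSpace K] [hK : Fact (∃ p : K, p ≠ 0 ∧ ‖p‖ < 1)]
variable [NormedAlgebra ℝ K] [FiniteDimensional ℝ K]

/-- The characters of the units of a finite extension of `ℝ` separate points. -/
theorem exists_char_ne_archimedean {x y : Kˣ} (hxy : x ≠ y) :
    ∃ χ : PontryaginDual Kˣ, χ x ≠ χ y := by
  let σ : K →ₐ[ℝ] ℂ := IsAlgClosed.lift
  have hσc : Continuous σ := LinearMap.continuous_of_finiteDimensional σ.toLinearMap
  have hσ0 : ∀ t : Kˣ, σ t ≠ 0 := fun t => (map_ne_zero σ).2 t.ne_zero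
  let L : Kˣ → ℝ := fun t => Real.log ‖σ t‖
  have hL : Continuous L := (hσc.comp Units.continuous_val).norm.log
    fun t => norm_ne_zero_iff.2 (hσ0 t)
  have hadd : ∀ a b, L (a * b) = L a + L b := fun a b => by
    simp only [L, Units.val_mul, map_mul, norm_mul]
    exact Real.log_mul (norm_ne_zero_iff.2 (hσ0 a)) (norm_ne_zero_iff.2 (hσ0 b))
  by_contra! h
  have hLxy : L x = L y := by
    by_contra hne
    -- This frequency makes the quotient of the two values `exp(iπ) = -1`.
    have h1 := h (expChar L hL hadd (Real.pi / (L x - L y)))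
    rw [expChar_apply, expChar_apply, ← div_eq_one, ← Circle.exp_sub, ← mul_sub,
      div_mul_cancel₀ _ (sub_ne_zero.2 hne)] at h1
    have h2 := congrArg ((↑) : Circle → ℂ) h1
    rw [Circle.coe_exp, Complex.exp_pi_mul_I] at h2
    norm_num at h2
  have hn : ‖σ x‖ = ‖σ y‖ := Real.log_injOn_pos (norm_pos_iff.2 (hσ0 x))
    (norm_pos_iff.2 (hσ0 y)) hLxy
  have hunit : ∀ t : Kˣ, ‖σ t / (‖σ t‖ : ℂ)‖ = 1 := fun t => by
    rw [norm_div, Complex.norm_real, norm_norm, div_self (norm_ne_zero_iff.2 (hσ0 t))]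
  -- The absolute values agree, so it remains to compare arguments in `ℂ`.
  let χ : PontryaginDual Kˣ :=
    { toFun := fun t => ⟨σ t / (‖σ t‖ : ℂ), mem_sphere_zero_iff_norm.2 (hunit t)⟩
      map_one' := Circle.ext (by simp)
      map_mul' := fun a b => Circle.ext (by
        change σ ((a * b : Kˣ) : K) / (‖σ ((a * b : Kˣ) : K)‖ : ℂ) =
          σ a / (‖σ a‖ : ℂ) * (σ b / (‖σ b‖ : ℂ))
        rw [Units.val_mul, map_mul, norm_mul, Complex.ofReal_mul, mul_div_mul_comm])
      continuous_toFun := by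
        refine Continuous.subtype_mk ?_ _
        exact (hσc.comp Units.continuous_val).div
          (Complex.continuous_ofReal.comp (hσc.comp Units.continuous_val).norm)
          fun t => by simp [hσ0 t] }
  have h1 : σ x / (‖σ x‖ : ℂ) = σ y / (‖σ y‖ : ℂ) := congrArg Subtype.val (h χ)
  rw [hn, div_left_inj' (by simp [hσ0 y])] at h1
  exact hxy (Units.ext (σ.toRingHom.injective h1))

variable [MeasurableSpace K] [BorelSpace K]
  [MeasurableSpace (PontryaginDual Kˣ)] [BorelSpace (PontryaginDual Kˣ)]
  (dt : Measure Kˣ) [dt.IsHaarMeasure] (μ : Measure (PontryaginDual Kˣ)) [μ.IsHaarMeasure]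

/-- By the substitution `u = exp x`, the archimedean normalization of `d*t` says exactly that
`log|t|` pushes it forward to Lebesgue measure. -/
theorem map_log_withDensity_inv :
    ((volume.restrict (Set.Ioi (0 : ℝ))).withDensity (fun u => ENNReal.ofReal u⁻¹)).map Real.log =
      volume := by
  ext s hs
  have hs' : MeasurableSet (Real.log ⁻¹' s) := Real.measurable_log hs
  rw [Measure.map_apply Real.measurable_log hs, withDensity_apply _ hs',
    ← lintegral_indicator hs']
  have h := lintegral_image_eq_lintegral_abs_deriv_mul MeasurableSet.univ
    (fun x _ => (Real.hasDerivAt_exp x).hasDerivWithinAt) Real.exp_injective.injOn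
    ((Real.log ⁻¹' s).indicator fun u => ENNReal.ofReal u⁻¹)
  rw [Set.image_univ, Real.range_exp, Measure.restrict_univ] at h
  rw [h, ← lintegral_indicator_one hs]
  congr 1
  ext x
  have hx := Real.exp_pos x
  by_cases hxs : x ∈ s
  · rw [Set.indicator_of_mem hxs, Set.indicator_of_mem (by simpa using hxs), abs_of_pos hx,
      ← ENNReal.ofReal_mul hx.le, mul_inv_cancel₀ hx.ne', ENNReal.ofReal_one]
    rfl
  · rw [Set.indicator_of_notMem hxs, Set.indicator_of_notMem (by simpa using hxs), mul_zero]

theorem exists_mem_fourierInvertible_archimedean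
    (hdt : dt.map (fun t : Kˣ => localModule (t : K)) =
      (volume.restrict (Set.Ioi (0 : ℝ))).withDensity (fun u => ENNReal.ofReal u⁻¹)) :
    ∃ k ∈ fourierInvertible dt μ, k ≠ 0 := by
  have hmc : Continuous fun t : Kˣ => localModule (t : K) :=
    continuous_localModule.comp Units.continuous_val
  have hn0 : (Module.finrank ℝ K : ℝ) ≠ 0 := by
    exact_mod_cast (Module.finrank_pos (R := ℝ) (M := K)).ne'
  -- A positive real number `r` has module `r ^ n` with `n` the degree of `K`, whence the division
  -- by `n` in this section of `log|t|`.
  let s : ℝ → Kˣ := fun x => Units.map (algebraMap ℝ K : ℝ →* K)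
    (Units.mk0 (Real.exp (x / Module.finrank ℝ K)) (Real.exp_pos _).ne')
  have hsval : ∀ x, (s x : K) = algebraMap ℝ K (Real.exp (x / Module.finrank ℝ K)) := fun x => rfl
  refine exists_mem_fourierInvertible_of_log dt μ
    (L := fun t : Kˣ => Real.log (localModule (t : K)))
    (hmc.log fun t => (localModule_units_pos t).ne') (fun a b => ?_) (s := s) ?_ (fun x y => ?_)
    (fun x => ?_) ?_
  · rw [Units.val_mul, localModule_mul, Real.log_mul (localModule_units_pos a).ne'
      (localModule_units_pos b).ne']
  · rw [Units.isEmbedding_val₀.continuous_iff]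
    exact (continuous_algebraMap ℝ K).comp
      (Real.continuous_exp.comp (continuous_id.div_const _))
  · refine Units.ext ?_
    rw [Units.val_mul, hsval, hsval, hsval, ← map_mul, ← Real.exp_add, add_div]
  · rw [hsval, localModule_eq_abs_norm, Algebra.norm_algebraMap, ← Real.exp_nat_mul,
      abs_of_pos (Real.exp_pos _), Real.log_exp]
    field_simp
  · rw [← map_log_withDensity_inv, ← hdt, Measure.map_map Real.measurable_log hmc.measurable]
    rfl

end ArchimedeanUnits

/-! ### The theorem at both kinds of place. -/

theorem theoremG1 {K : Type*} [NormedField K] [LocallyCompactSpace K]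
    [MeasurableSpace K] [BorelSpace K]
    [MeasurableSpace (PontryaginDual Kˣ)] [BorelSpace (PontryaginDual Kˣ)]
    (v : LocalPlace K)
    (dx : Measure K) (hdx : IsSelfDualMeasure v dx)
    (dt : Measure Kˣ) (hdt : IsNormalizedMulHaar v dt)
    (μ : Measure (PontryaginDual Kˣ)) (hμ : IsDualHaar dt μ) :
    -- the Gamma function is defined, analytic and non-vanishing in the critical strip
    (∀ (χ : PontryaginDual Kˣ) (s : ℂ), 0 < s.re → s.re < 1 →
      IsTateGamma v dx χ s (tateGamma v dx χ s) ∧ tateGamma v dx χ s ≠ 0 ∧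
        DifferentiableAt ℂ (tateGamma v dx χ) s) ∧
    ∃ (T : Lp ℂ 2 dx ≃ₗᵢ[ℂ] Lp ℂ 2 dt) (M : Lp ℂ 2 dt ≃ₗᵢ[ℂ] Lp ℂ 2 μ)
      (J F : Lp ℂ 2 dx ≃ₗᵢ[ℂ] Lp ℂ 2 dx),
      IsAddMulIsometry dx dt T ∧ IsPlancherelIsometry dt μ M ∧
      IsInversionL2 dx J ∧ IsFourierL2 v dx F ∧
      -- the Inversion
      (∀ f : Lp ℂ 2 μ, ∀ᵐ χ ∂μ, M (T (J (T.symm (M.symm f)))) χ = f χ⁻¹) ∧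
      -- the additive Fourier transform
      (∀ f : Lp ℂ 2 μ, ∀ᵐ χ ∂μ,
        M (T (F (T.symm (M.symm f)))) χ = tateGamma v dx χ (1 / 2) * f χ⁻¹) ∧
      -- the conductor operator, with domain the Schwartz-Bruhat functions
      (∀ φ : K → ℂ, IsSchwartzBruhat v φ →
        ∃ u w : Lp ℂ 2 dx, u =ᵐ[dx] φ ∧ w =ᵐ[dx] conductorOp v dx φ ∧
          ∀ᵐ χ ∂μ, M (T w) χ = -tateLambda v dx χ (1 / 2) * M (T u) χ) ∧
      -- its multiplier is real, so that the transported operator is hermitian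
      (∀ χ : PontryaginDual Kˣ, (tateLambda v dx χ (1 / 2)).im = 0) ∧
      -- the conductor operator commutes with the Inversion
      (∀ φ : K → ℂ, IsSchwartzBruhatZero v φ →
        IsSchwartzBruhatZero v (inversionFun φ) ∧
          conductorOp v dx (inversionFun φ) =ᵐ[dx] inversionFun (conductorOp v dx φ)) := by
  obtain ⟨hdxH, hF⟩ := hdx
  have hdtH := hdt.1
  have hμH := hμ.1
  -- Everything above is uniform in the place once these facts are known; properness and an element
  -- of norm strictly between 0 and 1 come from the base field.
  suffices h : ∃ (_ : ProperSpace K) (_ : Fact (∃ p : K, p ≠ 0 ∧ ‖p‖ < 1)), v.Regular ∧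
      (∀ x y : Kˣ, x ≠ y → ∃ χ : PontryaginDual Kˣ, χ x ≠ χ y) ∧
      ∃ k ∈ fourierInvertible dt μ, k ≠ 0 by
    obtain ⟨_, _, hv, hsep, k, hk, hk0⟩ := h
    exact ⟨fun χ s hs hs1 => ⟨isTateGamma_tateGamma hv dx χ hs hs1,
      tateGamma_ne_zero hv dx hF χ hs hs1, differentiableAt_tateGamma hv dx χ hs hs1⟩,
      transport_of_regular dx hv hF hμ hsep hk hk0⟩
  cases v with
  | archimedean algR fin =>
    have : ProperSpace K := FiniteDimensional.proper ℝ K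
    have : Fact (∃ p : K, p ≠ 0 ∧ ‖p‖ < 1) := ⟨algebraMap ℝ K 2⁻¹, by simp, by
      rw [norm_algebraMap']
      norm_num⟩
    exact ⟨inferInstance, inferInstance, regular_archimedean,
      fun _ _ => exists_char_ne_archimedean,
      exists_mem_fourierInvertible_archimedean dt μ hdt.2⟩
  | finite p hp algP fin =>
    have : ProperSpace K := FiniteDimensional.proper ℚ_[p] K
    have : Fact (∃ p : K, p ≠ 0 ∧ ‖p‖ < 1) := ⟨algebraMap ℚ_[p] K p,
      (map_ne_zero _).2 (Nat.cast_ne_zero.2 hp.out.ne_zero), by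
      rw [norm_algebraMap']
      exact Padic.norm_p_lt_one⟩
    have := isUltrametricDist_of_normedAlgebra_padic p algP
    refine ⟨inferInstance, inferInstance, regular_finite algP fin,
      fun x y => exists_char_ne_of_compact_open dt μ hμ.2 fun a ha =>
        exists_principalUnits_notMem ha, _,
      indicator_mem_fourierInvertible dt μ (principalUnits 1 one_pos le_rfl)
        (isOpen_principalUnits _ _ _) (isCompact_principalUnits _ _ _), fun h => ?_⟩
    have h1 := congrFun h 1
    rw [Set.indicator_of_mem (one_mem _)] at h1
    exact one_ne_zero h1
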